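/- **Setting.** Let $\mu$ be a $\sigma$-finite measure on a measurable space $\mathcal X$, let $\Theta\subset\mathbb R^p$ be open, and let $\{f_\theta:\theta\in\Theta\}$ be an identifiable family of probability densities with respect to $\mu$ with common support, measurable in $(\theta,x)$. Let $r<p$, and let $g:\Theta\to\mathbb R^r$ be continuously differentiable with $p\times r$ matrix $G(\theta)=\partial g^T(\theta)/\partial\theta$ of rank $r$. Put $\Theta_0=\{\theta\in\Theta: g(\theta)=0\}$, let $\theta_0\in\Theta_0$, and let $\omega\subset\Theta$ be an open neighbourhood of $\theta_0$. Let $\beta,\gamma\ge 0$, and write $u_\theta(x)=\partial\log f_\theta(x)/\partial\theta$, $$J_\tau(\theta)=\int u_\theta u_\theta^Tf_\theta^{1+\tau}d\mu,\quad \xi_\beta(\theta)=\int u_\theta f_\theta^{1+\beta}d\mu,\quad K_\beta(\theta)=\int u_\theta u_\theta^Tf_\theta^{1+2\beta}d\mu-\xi_\beta(\theta)\xi_\beta(\theta)^T,$$ $$A_\gamma(\theta)=(1+\gamma)\int f_\theta^{\gamma-1}\frac{\partial f_\theta}{\partial\theta}\frac{\partial f_\theta}{\partial\theta^T}d\mu,\qquad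 B_\beta=J_\beta^{-1}G\,[G^TJ_\beta^{-1}G]^{-1}G^TJ_\beta^{-1},$$ $V^\tau_\theta(x)=\int f_\theta^{1+\tau}d\mu-(1+\frac1\tau)f_\theta^\tau(x)$ for $\tau>0$ and $V^0_\theta(x)=-\log f_\theta(x)$. The density power divergence is $d_\gamma(h,f)=\int\{f^{1+\gamma}-(1+\frac1\gamma)f^\gamma h+\frac1\gamma h^{1+\gamma}\}d\mu$ for $\gamma>0$ and $d_0(h,f)=\int h\log(h/f)\,d\mu$. **Conditions.** For $\mu$-almost every $x$ the map $\theta\mapsto f_\theta(x)$ is three times continuously differentiable on $\omega$. (Lehmann conditions) Under $f_{\theta_0}$ the score $u_{\theta_0}$ has mean $0$; the Fisher information is finite, positive definite, and equal to the mean of $-\partial^2\log f_\theta/\partial\theta\,\partial\theta^T$ at $\theta=\theta_0$; and the third partial derivatives of $\log f_\theta(x)$ are bounded for $\theta\in\omega$ by functions of $x$ with finite mean under $f_{\theta_0}$. (Basu et al. conditions, with exponent $\tau$ and a set $N\ni\theta_0$ of true parameters) For every $\theta'\in N$, $\int f_\theta^{1+\tau}d\mu$ and $\int f_\theta^\tau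 f_{\theta'}d\mu$ are three times differentiable in $\theta\in\omega$, and their derivatives can be taken under the integral sign. The matrix $J_\tau$ is finite and positive definite on $N$, and continuous at $\theta_0$ within $N$. The third partial derivatives of $V^\tau_\theta(x)$ are bounded for $\theta\in\omega$ by functions of $x$ whose means under $f_{\theta'}$ are bounded over $\theta'\in N$. Assume the Lehmann conditions, the Basu et al. conditions with $\tau=\beta$, $N=\{\theta_0\}$, the Basu et al. conditions with $\tau=\gamma$, $N=\omega$, and that the integrals defining $K_\beta(\theta_0)$ are finite. **Estimators.** Let $\widehat\theta_\beta$ be a minimum density power divergence estimator: a measurable function of the sample that, with probability tending to one, is a (local or global) minimizer over $\Theta$ of $\frac1n\sum_{i}V^\beta_\theta(X_i)$ or a root of the estimating equation $\frac1n\sum_iu_\theta(X_i)f_\theta^\beta(X_i)-\xi_\beta(\theta)=0$. Let $\widetilde\theta_\beta$ be a restricted one: with probability tending to one it lies in $\Theta_0$ and is a (local or global) minimizer of the same objective over $\Theta_0$, or solves $\frac1n\sum_iu_\theta(X_i)f_\theta^\beta(X_i)-\xi_\beta(\theta)=G(\theta)c$ for some $c\in\mathbb R^r$. Both are assumed consistent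 for $\theta_0$ when the sample is drawn from $f_{\theta_0}$; the probabilities above are also under $f_{\theta_0}$. Let $T_\gamma(\widehat\theta_\beta,\widetilde\theta_\beta)=2n\,d_\gamma(f_{\widehat\theta_\beta},f_{\widetilde\theta_\beta})$. **Theorem.** Let $d\in\mathbb R^p$ and let $X_1,\dots,X_n$ be a random sample from $f_{\theta_n}$ with $\theta_n=\theta_0+n^{-1/2}d$. Write $A=A_\gamma(\theta_0)$, $B=B_\beta(\theta_0)$, $J=J_\beta(\theta_0)$, $K=K_\beta(\theta_0)$. Let $\lambda_1,\dots,\lambda_k$ be the positive eigenvalues of $ABKB$, counted with multiplicity, and $\Lambda_k=\mathrm{diag}(\lambda_1,\dots,\lambda_k)$. Let $S$ be any $p\times m$ matrix with $SS^T=BKB$, and let $V$ be an $m\times k$ matrix whose columns are orthonormal eigenvectors of $S^TAS$ for $\lambda_1,\dots,\lambda_k$. Put $$w=\Lambda_k^{-1}V^TS^TABJd,\qquad \eta=(BJd)^TA\,BJd-w^T\Lambda_kw .$$ Then, as $n\to\infty$, $T_\gamma(\widehat\theta_\beta,\widetilde\theta_\beta)$ converges in law to $$\sum_{i=1}^k\lambda_i(Z_i+w_i)^2+\eta,$$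 where $Z_1,\dots,Z_k$ are independent standard normal variables. -/

import Mathlib

open MeasureTheory Filter Topology ProbabilityTheory
open scoped Matrix BoundedContinuousFunction

noncomputable section

namespace DPD

/-- The ambient Euclidean space of the parameter. -/
abbrev Param (p : ℕ) := EuclideanSpace ℝ (Fin p)

/-- The `j`-th coordinate direction. -/
def dir {p : ℕ} (j : Fin p) : Param p := EuclideanSpace.single j 1

section Model

variable {𝒳 : Type*} [MeasurableSpace 𝒳] {p r : ℕ}

/-- The probability measure with density `f θ` with respect to `μ`. -/
def law (μ : Measure 𝒳) (f : Param p → 𝒳 → ℝ) (θ : Param p) : Measure 𝒳 :=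
  μ.withDensity fun x => ENNReal.ofReal (f θ x)

/-- The law of a random sample of size `n` from the density `f θ`. -/
def sampleLaw (μ : Measure 𝒳) (f : Param p → 𝒳 → ℝ) (n : ℕ) (θ : Param p) :
    Measure (Fin n → 𝒳) :=
  Measure.pi fun _ => law μ f θ

/-- An identifiable family of probability densities with common support, indexed by an open
parameter set `Θ` (the values of `f` off `Θ` play no role). -/
structure IsModel (μ : Measure 𝒳) (f : Param p → 𝒳 → ℝ) (Θ : Set (Param p)) : Prop where
  isOpen : IsOpen Θ
  measurable : Measurable (Function.uncurry f)
  nonneg : ∀ θ ∈ Θ, ∀ x, 0 ≤ f θ x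
  integrable : ∀ θ ∈ Θ, Integrable (f θ) μ
  integral_eq_one : ∀ θ ∈ Θ, ∫ x, f θ x ∂μ = 1
  identifiable : Set.InjOn (law μ f) Θ
  common_support : ∀ θ ∈ Θ, ∀ θ' ∈ Θ, {x | 0 < f θ x} = {x | 0 < f θ' x}

/-- The likelihood score function, `u_θ(x) = ∂/∂θ log f_θ(x)`. -/
def score (f : Param p → 𝒳 → ℝ) (θ : Param p) (x : 𝒳) : Fin p → ℝ :=
  fun j => fderiv ℝ (fun t => Real.log (f t x)) θ (dir j)

/-- `J_τ(θ) = ∫ u_θ u_θᵀ f_θ^(1+τ)`; for `τ = 0` this is the Fisher information matrix. -/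
def matJ (μ : Measure 𝒳) (f : Param p → 𝒳 → ℝ) (τ : ℝ) (θ : Param p) :
    Matrix (Fin p) (Fin p) ℝ :=
  Matrix.of fun j k => ∫ x, score f θ x j * score f θ x k * f θ x ^ (1 + τ) ∂μ

/-- `ξ_β(θ) = ∫ u_θ f_θ^(1+β)`. -/
def vecXi (μ : Measure 𝒳) (f : Param p → 𝒳 → ℝ) (β : ℝ) (θ : Param p) : Fin p → ℝ :=
  fun j => ∫ x, score f θ x j * f θ x ^ (1 + β) ∂μ

/-- `K_β(θ) = ∫ u_θ u_θᵀ f_θ^(1+2β) - ξ_β(θ) ξ_β(θ)ᵀ`. -/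
def matK (μ : Measure 𝒳) (f : Param p → 𝒳 → ℝ) (β : ℝ) (θ : Param p) :
    Matrix (Fin p) (Fin p) ℝ :=
  Matrix.of fun j k => (∫ x, score f θ x j * score f θ x k * f θ x ^ (1 + 2 * β) ∂μ)
    - vecXi μ f β θ j * vecXi μ f β θ k

/-- `A_γ(θ) = (1+γ) ∫ f_θ^(γ-1) (∂f_θ/∂θ_i) (∂f_θ/∂θ_j)`. -/
def matA (μ : Measure 𝒳) (f : Param p → 𝒳 → ℝ) (γ : ℝ) (θ : Param p) :
    Matrix (Fin p) (Fin p) ℝ :=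
  Matrix.of fun i j => (1 + γ) * ∫ x, f θ x ^ (γ - 1) *
    fderiv ℝ (fun t => f t x) θ (dir j) * fderiv ℝ (fun t => f t x) θ (dir i) ∂μ

/-- The `p × r` matrix `G(θ) = ∂gᵀ(θ)/∂θ`. -/
def matG (g : Param p → EuclideanSpace ℝ (Fin r)) (θ : Param p) : Matrix (Fin p) (Fin r) ℝ :=
  Matrix.of fun j i => fderiv ℝ g θ (dir j) i

/-- `B_β(θ) = J⁻¹ G (Gᵀ J⁻¹ G)⁻¹ Gᵀ J⁻¹` with `J = J_β(θ)`, `G = G(θ)`. -/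
def matB (μ : Measure 𝒳) (f : Param p → 𝒳 → ℝ) (g : Param p → EuclideanSpace ℝ (Fin r))
    (β : ℝ) (θ : Param p) : Matrix (Fin p) (Fin p) ℝ :=
  (matJ μ f β θ)⁻¹ * matG g θ * ((matG g θ)ᵀ * (matJ μ f β θ)⁻¹ * matG g θ)⁻¹
    * (matG g θ)ᵀ * (matJ μ f β θ)⁻¹

/-- The density power divergence `d_τ(h, f)` between two densities, `τ ≥ 0`. -/
def divergence (μ : Measure 𝒳) (τ : ℝ) (h f : 𝒳 → ℝ) : ℝ :=
  if τ = 0 then ∫ x, h x * Real.log (h x / f x) ∂μ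
  else ∫ x, (f x ^ (1 + τ) - (1 + 1 / τ) * (f x ^ τ * h x) + 1 / τ * h x ^ (1 + τ)) ∂μ

/-- The contribution `V_θ(x)` of one observation to the objective function. -/
def objTerm (μ : Measure 𝒳) (f : Param p → 𝒳 → ℝ) (τ : ℝ) (θ : Param p) (x : 𝒳) : ℝ :=
  if τ = 0 then -Real.log (f θ x)
  else (∫ y, f θ y ^ (1 + τ) ∂μ) - (1 + 1 / τ) * f θ x ^ τ

/-- The empirical objective function `n⁻¹ ∑ V_θ(X_i)`. -/
def objective (μ : Measure 𝒳) (f : Param p → 𝒳 → ℝ) (β : ℝ) {n : ℕ} (X : Fin n → 𝒳)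
    (θ : Param p) : ℝ :=
  1 / (n : ℝ) * ∑ i, objTerm μ f β θ (X i)

/-- The estimating function `n⁻¹ ∑ u_θ(X_i) f_θ^β(X_i) - ∫ u_θ f_θ^(1+β)`. -/
def estFun (μ : Measure 𝒳) (f : Param p → 𝒳 → ℝ) (β : ℝ) {n : ℕ} (X : Fin n → 𝒳)
    (θ : Param p) : Fin p → ℝ :=
  fun j => 1 / (n : ℝ) * ∑ i, score f θ (X i) j * f θ (X i) ^ β - vecXi μ f β θ j

/-- The restricted parameter set. -/
def nullSet (Θ : Set (Param p)) (g : Param p → EuclideanSpace ℝ (Fin r)) : Set (Param p) :=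
  {θ ∈ Θ | g θ = 0}

/-- `θ` is a value of the minimum density power divergence estimator at the sample `X`:
a (local or global) minimizer of the objective function over `Θ`, or a root of the estimating
equation. -/
def IsMDPDE (μ : Measure 𝒳) (f : Param p → 𝒳 → ℝ) (Θ : Set (Param p)) (β : ℝ) {n : ℕ}
    (X : Fin n → 𝒳) (θ : Param p) : Prop :=
  θ ∈ Θ ∧ (IsLocalMinOn (objective μ f β X) Θ θ ∨ estFun μ f β X θ = 0)

/-- `θ` is a value of the restricted estimator at the sample `X`: a (local or global) minimizer
of the objective function over the restricted set, or a solution of the constrained estimating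
equations with Lagrange multipliers. -/
def IsRMDPDE (μ : Measure 𝒳) (f : Param p → 𝒳 → ℝ) (Θ : Set (Param p))
    (g : Param p → EuclideanSpace ℝ (Fin r)) (β : ℝ) {n : ℕ}
    (X : Fin n → 𝒳) (θ : Param p) : Prop :=
  θ ∈ nullSet Θ g ∧ (IsLocalMinOn (objective μ f β X) (nullSet Θ g) θ ∨
    ∃ c : Fin r → ℝ, estFun μ f β X θ = matG g θ *ᵥ c)

/-- `θ̂ n` satisfies `E n` with probability tending to one and is consistent for `θ₀`, when
the sample comes from `f θ₀`. -/
def IsConsistentSolution (μ : Measure 𝒳) (f : Param p → 𝒳 → ℝ) (θ₀ : Param p)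
    (E : ∀ n : ℕ, (Fin n → 𝒳) → Param p → Prop)
    (est : ∀ n : ℕ, (Fin n → 𝒳) → Param p) : Prop :=
  (∀ n, Measurable (est n)) ∧
  Tendsto (fun n => sampleLaw μ f n θ₀ {X | ¬ E n X (est n X)}) atTop (𝓝 0) ∧
  ∀ ε : ℝ, 0 < ε →
    Tendsto (fun n => sampleLaw μ f n θ₀ {X | ε ≤ dist (est n X) θ₀}) atTop (𝓝 0)

/-- `∫ φ_θ dμ` is three times differentiable in `θ ∈ ω`, and its partial derivatives of order at
most three are obtained by differentiation under the integral sign. -/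
def DiffUnderIntegral (μ : Measure 𝒳) (ω : Set (Param p)) (φ : Param p → 𝒳 → ℝ) : Prop :=
  (∀ m : ℕ, m < 3 → DifferentiableOn ℝ (iteratedFDeriv ℝ m fun t => ∫ x, φ t x ∂μ) ω) ∧
  ∀ m : ℕ, m ≤ 3 → ∀ s : Fin m → Fin p, ∀ θ ∈ ω,
    Integrable (fun x => iteratedFDeriv ℝ m (fun t => φ t x) θ fun i => dir (s i)) μ ∧
    iteratedFDeriv ℝ m (fun t => ∫ x, φ t x ∂μ) θ (fun i => dir (s i)) =
      ∫ x, iteratedFDeriv ℝ m (fun t => φ t x) θ (fun i => dir (s i)) ∂μ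

/-- The third partial derivatives of `V_θ(x)` (exponent `τ`) are bounded on `ω` by functions of
`x` whose means are bounded over the true parameters in `N`. -/
def ThirdDerivBound (μ : Measure 𝒳) (f : Param p → 𝒳 → ℝ) (ω N : Set (Param p)) (τ : ℝ) :
    Prop :=
  ∃ (M : Fin p → Fin p → Fin p → 𝒳 → ℝ) (m : Fin p → Fin p → Fin p → ℝ),
    (∀ᵐ x ∂μ, ∀ θ ∈ ω, ∀ j k l,
      |iteratedFDeriv ℝ 3 (fun t => objTerm μ f τ t x) θ ![dir j, dir k, dir l]| ≤ M j k l x) ∧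
    ∀ θ' ∈ N, ∀ j k l, Integrable (M j k l) (law μ f θ') ∧
      ∫ x, M j k l x ∂(law μ f θ') ≤ m j k l

/-- For almost every `x` the density is three times continuously differentiable in `θ ∈ ω`. -/
def SmoothDensity (μ : Measure 𝒳) (f : Param p → 𝒳 → ℝ) (ω : Set (Param p)) : Prop :=
  ∀ᵐ x ∂μ, ContDiffOn ℝ 3 (fun θ => f θ x) ω

/-- The Lehmann conditions at the parameter `θ₀`: smooth density, score with mean zero,
information identity, finite positive definite Fisher information, and third derivatives of the
log-density dominated by integrable functions. -/
structure LehmannConditions (μ : Measure 𝒳) (f : Param p → 𝒳 → ℝ) (ω : Set (Param p))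
    (θ₀ : Param p) : Prop where
  smooth : SmoothDensity μ f ω
  score_mean : ∀ j, Integrable (fun x => score f θ₀ x j) (law μ f θ₀) ∧
    ∫ x, score f θ₀ x j ∂(law μ f θ₀) = 0
  info_integrable : ∀ j k, Integrable (fun x => score f θ₀ x j * score f θ₀ x k) (law μ f θ₀)
  info_identity : ∀ j k,
    Integrable (fun x => iteratedFDeriv ℝ 2 (fun t => Real.log (f t x)) θ₀ ![dir j, dir k])
      (law μ f θ₀) ∧
    ∫ x, -iteratedFDeriv ℝ 2 (fun t => Real.log (f t x)) θ₀ ![dir j, dir k] ∂(law μ f θ₀) =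
      ∫ x, score f θ₀ x j * score f θ₀ x k ∂(law μ f θ₀)
  info_posDef : (Matrix.of fun j k =>
    ∫ x, score f θ₀ x j * score f θ₀ x k ∂(law μ f θ₀)).PosDef
  third_deriv : ThirdDerivBound μ f ω {θ₀} 0

/-- The Basu et al. conditions with tuning parameter `τ`, on the neighbourhood `ω` of `θ₀`, when
the true density is any `f θ'` with `θ'` in the set `N`. (With `N = {θ₀}` the continuity
requirement is void.) -/
structure BasuConditions (μ : Measure 𝒳) (f : Param p → 𝒳 → ℝ) (ω N : Set (Param p))
    (θ₀ : Param p) (τ : ℝ) : Prop where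
  smooth : SmoothDensity μ f ω
  diff_self : DiffUnderIntegral μ ω fun θ x => f θ x ^ (1 + τ)
  diff_true : ∀ θ' ∈ N, DiffUnderIntegral μ ω fun θ x => f θ x ^ τ * f θ' x
  J_integrable : ∀ θ' ∈ N, ∀ j k,
    Integrable (fun x => score f θ' x j * score f θ' x k * f θ' x ^ (1 + τ)) μ
  J_posDef : ∀ θ' ∈ N, (matJ μ f τ θ').PosDef
  J_continuous : ContinuousWithinAt (matJ μ f τ) N θ₀
  third_deriv : ThirdDerivBound μ f ω N τ

/-- The test statistic `T_γ = 2 n d_γ(f_θ̂, f_θ̃)`. -/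
def testStat (μ : Measure 𝒳) (f : Param p → 𝒳 → ℝ) (γ : ℝ)
    (est estR : ∀ n : ℕ, (Fin n → 𝒳) → Param p) (n : ℕ) (X : Fin n → 𝒳) : ℝ :=
  2 * (n : ℝ) * divergence μ γ (f (est n X)) (f (estR n X))

/-- The alternative `θ_n = θ₀ + n^(-1/2) d`. -/
def localAlt (θ₀ d : Param p) (n : ℕ) : Param p :=
  θ₀ + ((n : ℝ) ^ (-(1 / 2) : ℝ)) • d

end Model

/-- Convergence in law: `T n`, under the law `Q n`, converges weakly to the distribution `ν`. -/
def ConvergesInLaw {Ω : ℕ → Type*} [∀ n, MeasurableSpace (Ω n)] (Q : ∀ n, Measure (Ω n))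
    (T : ∀ n, Ω n → ℝ) (ν : Measure ℝ) : Prop :=
  (∀ n, AEMeasurable (T n) (Q n)) ∧
  ∀ φ : ℝ →ᵇ ℝ, Tendsto (fun n => ∫ y, φ (T n y) ∂(Q n)) atTop (𝓝 (∫ t, φ t ∂ν))

/-- The distribution of `∑ λ_i (Z_i + w_i)² + η` with `Z_i` independent standard normal. -/
def shiftedChiSq {k : ℕ} (lam w : Fin k → ℝ) (η : ℝ) : Measure ℝ :=
  (Measure.pi fun _ : Fin k => gaussianReal 0 1).map
    fun z => ∑ i, lam i * (z i + w i) ^ 2 + η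

end DPD

end

/-!
Write `y` for the sum of the centred terms `u_θ₀ f_θ₀ ^ β - ξ_β(θ₀)` over the sample, divided by
`√n`. Under `θ₀` the two estimating equations can be linearized at `θ₀`, the restricted one as a
bordered linear system in the parameter and the Lagrange multiplier. Eliminating the multiplier
gives `√n (θ̂ - θ̃) = B y + o_P(1)`. The divergence between nearby densities is to second order the
quadratic form of `A`, so the test statistic is `(B y)ᵀ A (B y) + o_P(1)`.

The log-likelihood ratio of `θ₀ + d / √n` against `θ₀` is, up to `o_P(1)`, the normalized sum of
`⟨u_θ₀, d⟩` minus half its variance, and the covariance of that sum with `y` is `J d`. By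
Le Cam's third lemma the limit of `y` under the local alternatives is therefore normal with mean
`J d` and covariance `K`. Diagonalizing `A` on the range of `B K B` turns the quadratic form of this
limit into the shifted chi-square mixture.
-/

noncomputable section

namespace DPD

open scoped ENNReal

section ProductMeasure

variable {ι : Type*} [Fintype ι] {X : ι → Type*}

theorem prod_indicator_eval_eq_indicator_pi (s : ∀ i, Set (X i)) (g : ∀ i, X i → ℝ≥0∞)
    (x : ∀ i, X i) :
    ∏ i, (s i).indicator (g i) (x i) =
      (Set.univ.pi s).indicator (fun x => ∏ i, g i (x i)) x := by
  by_cases hx : x ∈ Set.univ.pi s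
  · rw [Set.indicator_of_mem hx]
    exact Finset.prod_congr rfl fun i _ => Set.indicator_of_mem (hx i trivial) _
  · rw [Set.indicator_of_notMem hx]
    obtain ⟨i, hi⟩ : ∃ i, x i ∉ s i := by simpa [Set.mem_pi] using hx
    exact Finset.prod_eq_zero (Finset.mem_univ i) (Set.indicator_of_notMem hi _)

variable [∀ i, MeasurableSpace (X i)]

theorem lintegral_prod_eval (ν : ∀ i, Measure (X i)) [∀ i, IsProbabilityMeasure (ν i)]
    {g : ∀ i, X i → ℝ≥0∞} (hg : ∀ i, Measurable (g i)) :
    ∫⁻ x, ∏ i, g i (x i) ∂Measure.pi ν = ∏ i, ∫⁻ y, g i y ∂ν i := by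
  rw [lintegral_prod_eq_prod_lintegral_of_indepFun Finset.univ _
    (iIndepFun_pi fun i => (hg i).aemeasurable) fun i => (hg i).comp (measurable_pi_apply i)]
  exact Finset.prod_congr rfl fun i _ => (measurePreserving_eval ν i).lintegral_comp (hg i)

theorem pi_withDensity (ν : ∀ i, Measure (X i)) [∀ i, IsProbabilityMeasure (ν i)]
    {g : ∀ i, X i → ℝ≥0∞} (hg : ∀ i, Measurable (g i))
    [∀ i, SigmaFinite ((ν i).withDensity (g i))] :
    Measure.pi (fun i => (ν i).withDensity (g i)) =
      (Measure.pi ν).withDensity fun x => ∏ i, g i (x i) := by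
  refine Measure.pi_eq fun s hs => ?_
  rw [withDensity_apply _ (MeasurableSet.univ_pi hs),
    ← lintegral_indicator (MeasurableSet.univ_pi hs)]
  simp_rw [← prod_indicator_eval_eq_indicator_pi, withDensity_apply _ (hs _),
    ← lintegral_indicator (hs _)]
  exact lintegral_prod_eval ν fun i => (hg i).indicator (hs i)

end ProductMeasure

section RandomSample

variable {𝒳 : Type*}

/-- The sample formed by the first `n` terms of an infinite one. -/
def firstObs (n : ℕ) (s : ℕ → 𝒳) : Fin n → 𝒳 := fun i => s i

theorem sum_firstObs {M : Type*} [AddCommMonoid M] (n : ℕ) (s : ℕ → 𝒳) (q : 𝒳 → M) :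
    ∑ i, q (firstObs n s i) = ∑ i ∈ Finset.range n, q (s i) :=
  Fin.sum_univ_eq_sum_range (fun i => q (s i)) n

variable [MeasurableSpace 𝒳]

/-- The law of an infinite random sample from `ν`; samples of all sizes live on this one space, so
that convergence in probability makes sense. -/
abbrev seqLaw (ν : Measure 𝒳) : Measure (ℕ → 𝒳) := Measure.infinitePi fun _ => ν

theorem measurable_firstObs (n : ℕ) : Measurable (firstObs (𝒳 := 𝒳) n) := by
  unfold firstObs; fun_prop

variable {ν : Measure 𝒳} [IsProbabilityMeasure ν]

theorem map_firstObs (n : ℕ) : (seqLaw ν).map (firstObs n) = Measure.pi fun _ : Fin n => ν := by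
  rw [← Measure.infinitePi_eq_pi]
  exact Measure.map_infinitePi_infinitePi_of_inj (P := fun _ : ℕ => ν) Fin.val_injective

theorem measurePreserving_obs (i : ℕ) : MeasurePreserving (fun s : ℕ → 𝒳 => s i) (seqLaw ν) ν :=
  measurePreserving_eval_infinitePi (fun _ => ν) i

theorem integral_obs {ψ : 𝒳 → ℝ} (hψ : AEStronglyMeasurable ψ ν) (i : ℕ) :
    ∫ s, ψ (s i) ∂(seqLaw ν) = ∫ x, ψ x ∂ν := by
  have h := measurePreserving_obs (ν := ν) i
  rw [← integral_map h.aemeasurable (by rwa [h.map_eq]), h.map_eq]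

theorem memLp_obs {ψ : 𝒳 → ℝ} (hψ : MemLp ψ 2 ν) (i : ℕ) :
    MemLp (fun s : ℕ → 𝒳 => ψ (s i)) 2 (seqLaw ν) :=
  hψ.comp_measurePreserving (measurePreserving_obs i)

theorem ae_obs {q : 𝒳 → Prop} (h : ∀ᵐ x ∂ν, q x) : ∀ᵐ s ∂(seqLaw ν), ∀ i, q (s i) :=
  ae_all_iff.2 fun i => (measurePreserving_obs i).quasiMeasurePreserving.ae h

section

variable {E : Type*} [MeasurableSpace E] {ψ : 𝒳 → E}

theorem iIndepFun_obs (hψ : AEMeasurable ψ ν) :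
    iIndepFun (fun i (s : ℕ → 𝒳) => ψ (s i)) (seqLaw ν) :=
  (iIndepFun_infinitePi (P := fun _ : ℕ => ν) (X := fun _ x => x) fun _ => measurable_id).comp₀
    (fun _ => ψ) (fun i => (measurable_pi_apply i).aemeasurable)
    (fun i => by rwa [(measurePreserving_obs i).map_eq])

theorem identDistrib_obs (hψ : AEMeasurable ψ ν) (i j : ℕ) :
    IdentDistrib (fun s : ℕ → 𝒳 => ψ (s i)) (fun s => ψ (s j)) (seqLaw ν) (seqLaw ν) :=
  IdentDistrib.comp_of_aemeasurable
    ⟨(measurable_pi_apply i).aemeasurable, (measurable_pi_apply j).aemeasurable, by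
      rw [(measurePreserving_obs i).map_eq, (measurePreserving_obs j).map_eq]⟩
    (by rwa [(measurePreserving_obs i).map_eq])

end

variable {ψ : 𝒳 → ℝ}

theorem ae_tendsto_sampleMean (hψ : Integrable ψ ν) :
    ∀ᵐ s ∂(seqLaw ν), Tendsto (fun n : ℕ => (n : ℝ)⁻¹ * ∑ i ∈ Finset.range n, ψ (s i)) atTop
      (𝓝 (∫ x, ψ x ∂ν)) := by
  have h := strong_law_ae (fun i (s : ℕ → 𝒳) => ψ (s i))
    ((measurePreserving_obs 0).integrable_comp_of_integrable hψ)
    (fun i j hij => (iIndepFun_obs hψ.aemeasurable).indepFun hij)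
    (fun i => identDistrib_obs hψ.aemeasurable i 0)
  simpa only [integral_obs hψ.aestronglyMeasurable, smul_eq_mul] using h

theorem memLp_sum_obs (hψ : MemLp ψ 2 ν) (n : ℕ) :
    MemLp (fun s : ℕ → 𝒳 => ∑ i ∈ Finset.range n, ψ (s i)) 2 (seqLaw ν) :=
  memLp_finsetSum _ fun i _ => memLp_obs hψ i

theorem variance_obs (hψ : MemLp ψ 2 ν) (h0 : ∫ x, ψ x ∂ν = 0) (i : ℕ) :
    variance (fun s : ℕ → 𝒳 => ψ (s i)) (seqLaw ν) = ∫ x, ψ x ^ 2 ∂ν := by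
  rw [variance_of_integral_eq_zero (memLp_obs hψ i).aestronglyMeasurable.aemeasurable
    (by rw [integral_obs hψ.aestronglyMeasurable, h0])]
  exact integral_obs (ψ := fun x => ψ x ^ 2) (hψ.aestronglyMeasurable.pow 2) i

theorem integral_sq_sum_obs (hψ : MemLp ψ 2 ν) (h0 : ∫ x, ψ x ∂ν = 0) (n : ℕ) :
    ∫ s, (∑ i ∈ Finset.range n, ψ (s i)) ^ 2 ∂(seqLaw ν) = n * ∫ x, ψ x ^ 2 ∂ν := by
  have hmean : ∫ s, ∑ i ∈ Finset.range n, ψ (s i) ∂(seqLaw ν) = 0 := by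
    rw [integral_finsetSum _ fun i _ => (memLp_obs hψ i).integrable one_le_two]
    simp [integral_obs hψ.aestronglyMeasurable, h0]
  have hsum := IndepFun.variance_sum (μ := seqLaw ν) (X := fun i (s : ℕ → 𝒳) => ψ (s i))
    (s := Finset.range n) (fun i _ => memLp_obs hψ i)
    (fun i _ j _ hij => (iIndepFun_obs hψ.aestronglyMeasurable.aemeasurable).indepFun hij)
  rw [Finset.sum_fn, variance_of_integral_eq_zero
    (memLp_sum_obs hψ n).aestronglyMeasurable.aemeasurable hmean] at hsum
  simpa [variance_obs hψ h0] using hsum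

end RandomSample

section CentralLimitTheorem

open scoped InnerProductSpace

theorem charFun_map_inner {E Ω : Type*} [NormedAddCommGroup E] [InnerProductSpace ℝ E]
    [MeasurableSpace E] [BorelSpace E] [SecondCountableTopology E] [MeasurableSpace Ω]
    {P : Measure Ω} {Y : Ω → E} (hY : AEMeasurable Y P) (t : E) :
    charFun (P.map fun a => ⟪Y a, t⟫_ℝ) 1 = charFun (P.map Y) t := by
  rw [charFun_apply, charFun_apply, integral_map (by fun_prop) (by fun_prop),
    integral_map hY (by fun_prop)]
  simp

/-- The Cramér–Wold device: characteristic functions see only one-dimensional projections. -/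
theorem tendstoInDistribution_of_forall_inner {E Ω Ω' : Type*} [NormedAddCommGroup E]
    [InnerProductSpace ℝ E] [FiniteDimensional ℝ E] [MeasurableSpace E] [BorelSpace E]
    [MeasurableSpace Ω] [MeasurableSpace Ω'] {P : Measure Ω} {P' : Measure Ω'}
    [IsProbabilityMeasure P] [IsProbabilityMeasure P'] {X : ℕ → Ω → E} {Z : Ω' → E}
    (hX : ∀ n, AEMeasurable (X n) P) (hZ : AEMeasurable Z P')
    (h : ∀ t : E, TendstoInDistribution (fun n a => ⟪X n a, t⟫_ℝ) atTop (fun a => ⟪Z a, t⟫_ℝ)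
      (fun _ => P) P') :
    TendstoInDistribution X atTop Z (fun _ => P) P' where
  forall_aemeasurable := hX
  tendsto := by
    refine ProbabilityMeasure.tendsto_iff_tendsto_charFun.2 fun t => ?_
    have ht := ProbabilityMeasure.tendsto_iff_tendsto_charFun.1 (h t).tendsto 1
    simp only [ProbabilityMeasure.coe_mk] at ht ⊢
    simpa only [charFun_map_inner (hX _), charFun_map_inner hZ] using ht

variable {𝒳 ι : Type*}

/-- The normalized sum `n^(-1/2) ∑_{i < n} ψ (s i)` of a vector-valued function of the
observations, to which the central limit theorem applies. -/
def normSum (ψ : ι → 𝒳 → ℝ) (n : ℕ) (s : ℕ → 𝒳) : EuclideanSpace ℝ ι :=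
  WithLp.toLp 2 fun j => (√(n : ℝ))⁻¹ * ∑ i ∈ Finset.range n, ψ j (s i)

theorem inner_normSum [Fintype ι] (ψ : ι → 𝒳 → ℝ) (n : ℕ) (s : ℕ → 𝒳) (t : EuclideanSpace ℝ ι) :
    ⟪normSum ψ n s, t⟫_ℝ =
      (√(n : ℝ))⁻¹ * ∑ i ∈ Finset.range n, ∑ j, t j * ψ j (s i) := by
  simp only [normSum, PiLp.inner_apply, RCLike.inner_apply, conj_trivial]
  rw [Finset.sum_comm, Finset.mul_sum]
  refine Finset.sum_congr rfl fun j _ => ?_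
  rw [← Finset.mul_sum]
  ring

variable [MeasurableSpace 𝒳] {ν : Measure 𝒳}

/-- The matrix of second moments of a vector-valued function; the covariance matrix when the
function is centred. -/
def momentMatrix (ν : Measure 𝒳) (ψ : ι → 𝒳 → ℝ) : Matrix ι ι ℝ :=
  Matrix.of fun j k => ∫ x, ψ j x * ψ k x ∂ν

theorem aemeasurable_normSum [IsProbabilityMeasure ν] [Countable ι] {ψ : ι → 𝒳 → ℝ}
    (hψ : ∀ j, AEMeasurable (ψ j) ν) (n : ℕ) :
    AEMeasurable (normSum ψ n) (seqLaw ν) := by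
  refine (WithLp.measurable_toLp 2 (ι → ℝ)).comp_aemeasurable (aemeasurable_pi_lambda _ fun j => ?_)
  exact (Finset.aemeasurable_fun_sum _ fun i _ => (hψ j).comp_quasiMeasurePreserving
    (measurePreserving_obs i).quasiMeasurePreserving).const_mul _

variable [Fintype ι] {ψ : ι → 𝒳 → ℝ}

theorem memLp_linearCombination (hψ : ∀ j, MemLp (ψ j) 2 ν) (t : ι → ℝ) :
    MemLp (fun x => ∑ j, t j * ψ j x) 2 ν :=
  memLp_finsetSum _ fun j _ => (hψ j).const_mul (t j)

theorem integral_sq_linearCombination (hψ : ∀ j, MemLp (ψ j) 2 ν) (t : ι → ℝ) :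
    ∫ x, (∑ j, t j * ψ j x) ^ 2 ∂ν = t ⬝ᵥ momentMatrix ν ψ *ᵥ t := by
  have hint : ∀ j k, Integrable (fun x => t j * (t k * (ψ j x * ψ k x))) ν := fun j k =>
    (((hψ j).integrable_mul (hψ k)).const_mul _).const_mul _
  calc ∫ x, (∑ j, t j * ψ j x) ^ 2 ∂ν
      = ∫ x, ∑ j, ∑ k, t j * (t k * (ψ j x * ψ k x)) ∂ν := by
        refine integral_congr_ae (ae_of_all _ fun x => ?_)
        simp only [sq, Finset.sum_mul_sum]
        exact Finset.sum_congr rfl fun j _ => Finset.sum_congr rfl fun k _ => by ring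
    _ = ∑ j, ∑ k, t j * (t k * ∫ x, ψ j x * ψ k x ∂ν) := by
        rw [integral_finsetSum _ fun j _ => integrable_finsetSum _ fun k _ => hint j k]
        simp_rw [integral_finsetSum _ fun k _ => hint _ k, integral_const_mul]
    _ = t ⬝ᵥ momentMatrix ν ψ *ᵥ t := by
        simp only [dotProduct, Matrix.mulVec, momentMatrix, Matrix.of_apply, Finset.mul_sum]
        exact Finset.sum_congr rfl fun j _ => Finset.sum_congr rfl fun k _ => by ring

theorem posSemidef_momentMatrix {ι : Type*} [Finite ι] {ψ : ι → 𝒳 → ℝ}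
    (hψ : ∀ j, MemLp (ψ j) 2 ν) : (momentMatrix ν ψ).PosSemidef := by
  cases nonempty_fintype ι
  refine Matrix.PosSemidef.of_dotProduct_mulVec_nonneg ?_ fun t => ?_
  · ext j k
    simp [momentMatrix, mul_comm]
  · rw [star_trivial, ← integral_sq_linearCombination hψ]
    exact integral_nonneg fun x => sq_nonneg _

theorem hasLaw_inner_multivariateGaussian [DecidableEq ι] {C : Matrix ι ι ℝ} (hC : C.PosSemidef)
    (t : EuclideanSpace ℝ ι) :
    HasLaw (fun z => ⟪z, t⟫_ℝ) (gaussianReal 0 (t ⬝ᵥ C *ᵥ t).toNNReal)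
      (multivariateGaussian 0 C) where
  aemeasurable := by fun_prop
  map_eq := by
    have hvar : variance (innerSL ℝ t) (multivariateGaussian 0 C) = t ⬝ᵥ C *ᵥ t := by
      rw [← covarianceBilin_multivariateGaussian hC, covarianceBilin_self IsGaussian.memLp_two_id]
      rfl
    have hmean : (multivariateGaussian 0 C)[innerSL ℝ t] = 0 := by
      rw [ContinuousLinearMap.integral_comp_id_comm IsGaussian.integrable_id,
        integral_id_multivariateGaussian, map_zero]
    simp_rw [real_inner_comm]
    rw [← hvar, ← hmean]
    exact IsGaussian.map_eq_gaussianReal (innerSL ℝ t)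

variable [IsProbabilityMeasure ν]

theorem tendstoInDistribution_normSum [DecidableEq ι] (hψ : ∀ j, MemLp (ψ j) 2 ν)
    (h0 : ∀ j, ∫ x, ψ j x ∂ν = 0) :
    TendstoInDistribution (normSum ψ) atTop id (fun _ => seqLaw ν)
      (multivariateGaussian 0 (momentMatrix ν ψ)) := by
  refine tendstoInDistribution_of_forall_inner
    (aemeasurable_normSum fun j => (hψ j).aestronglyMeasurable.aemeasurable) aemeasurable_id
    fun t => ?_
  have hY := memLp_linearCombination hψ t
  have hYm := hY.aestronglyMeasurable.aemeasurable
  have hY0 : ∫ x, ∑ j, t j * ψ j x ∂ν = 0 := by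
    rw [integral_finsetSum _ fun j _ => ((hψ j).integrable one_le_two).const_mul _]
    simp [integral_const_mul, h0]
  have hlaw := hasLaw_inner_multivariateGaussian (posSemidef_momentMatrix hψ) t
  rw [← integral_sq_linearCombination hψ, ← variance_obs hY hY0 0] at hlaw
  have hclt := tendstoInDistribution_inv_sqrt_mul_sum_sub (P := seqLaw ν)
    (X := fun i s => ∑ j, t j * ψ j (s i)) hlaw (memLp_obs hY 0) (iIndepFun_obs hYm)
    fun i => identDistrib_obs hYm i 0
  rw [integral_obs hY.aestronglyMeasurable, hY0] at hclt
  simp only [mul_zero, sub_zero] at hclt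
  simpa only [inner_normSum, id] using hclt

end CentralLimitTheorem

section ConvergenceInProbability

open Asymptotics

variable {Ω : Type*} [MeasurableSpace Ω] {P : Measure Ω}

/-- The events whose probability tends to one. Limits along this filter are limits in probability,
and Landau symbols along it are the stochastic ones `o_P` and `O_P`. -/
def whp (P : Measure Ω) : Filter (ℕ × Ω) where
  sets := {S | Tendsto (fun n => P {ω | (n, ω) ∉ S}) atTop (𝓝 0)}
  univ_sets := by simp
  sets_of_superset hS hST := tendsto_of_tendsto_of_tendsto_of_le_of_le tendsto_const_nhds hS
    (fun _ => zero_le) fun _ => measure_mono fun _ hω hS => hω (hST hS)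
  inter_sets {S T} hS hT := by
    have hsum := Tendsto.add hS hT
    rw [add_zero] at hsum
    refine tendsto_of_tendsto_of_tendsto_of_le_of_le tendsto_const_nhds hsum (fun _ => zero_le)
      fun n => ?_
    simp only [Set.mem_inter_iff, not_and_or, Set.ofPred_or]
    exact measure_union_le _ _

theorem eventually_whp {q : ℕ × Ω → Prop} :
    (∀ᶠ a in whp P, q a) ↔ Tendsto (fun n => P {ω | ¬ q (n, ω)}) atTop (𝓝 0) :=
  Iff.rfl

theorem tendsto_fst_whp : Tendsto Prod.fst (whp P) atTop := by
  refine tendsto_atTop.2 fun m => eventually_whp.2 (tendsto_const_nhds.congr' ?_)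
  filter_upwards [eventually_ge_atTop m] with n hn
  simp [hn]

theorem tendsto_snd_whp : Tendsto Prod.snd (whp P) (ae P) := by
  intro S (hS : P Sᶜ = 0)
  exact eventually_whp.2 (tendsto_const_nhds.congr fun _ => hS.symm)

theorem tendsto_whp_of_tendstoInMeasure {E : Type*} [PseudoMetricSpace E] {X : ℕ → Ω → E} {c : E}
    (h : TendstoInMeasure P X atTop fun _ => c) :
    Tendsto (fun a => X a.1 a.2) (whp P) (𝓝 c) := by
  refine Metric.tendsto_nhds.2 fun ε hε => eventually_whp.2 ?_
  simpa only [not_lt] using tendstoInMeasure_iff_dist.1 h ε hε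

theorem measureReal_ge_le_div_of_integral_le {W : Ω → ℝ} {C M : ℝ} (hW0 : 0 ≤ W)
    (hW : Integrable W P) (hWC : ∫ ω, W ω ∂P ≤ C) (hM : 0 < M) :
    P.real {ω | M ≤ W ω} ≤ C / M := by
  rw [le_div_iff₀' hM]
  exact (mul_meas_ge_le_integral_of_nonneg (ae_of_all P hW0) hW M).trans hWC

theorem tendstoInMeasure_zero_of_isLittleO_whp [IsFiniteMeasure P] {R W : ℕ → Ω → ℝ} {C : ℝ}
    (hW0 : ∀ n, 0 ≤ W n) (hWi : ∀ n, Integrable (W n) P) (hWC : ∀ n, ∫ ω, W n ω ∂P ≤ C)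
    (h : (fun a => R a.1 a.2) =o[whp P] fun a => W a.1 a.2) :
    TendstoInMeasure P R atTop 0 := by
  have hC : 0 ≤ C := (integral_nonneg (hW0 0)).trans (hWC 0)
  rw [tendstoInMeasure_iff_measureReal_norm]
  intro ε hε
  rw [Metric.tendsto_nhds]
  intro η hη
  obtain ⟨M, hM, hCM⟩ : ∃ M > 0, C / M < η / 2 :=
    ⟨(C + 1) / (η / 2), by positivity, by
      rw [div_div_eq_mul_div, div_lt_iff₀ (by positivity)]; nlinarith⟩
  have hR := ((ENNReal.tendsto_toReal ENNReal.zero_ne_top).comp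
    (eventually_whp.1 (h.bound (div_pos hε hM)))).eventually (Iio_mem_nhds (half_pos hη))
  filter_upwards [hR] with n hn
  rw [dist_zero_right, Real.norm_of_nonneg measureReal_nonneg]
  have hsub : {ω | ε ≤ ‖R n ω - (0 : ℕ → Ω → ℝ) n ω‖} ⊆
      {ω | ¬ ‖R n ω‖ ≤ ε / M * ‖W n ω‖} ∪ {ω | M ≤ W n ω} := by
    intro ω (hω : ε ≤ ‖R n ω - 0‖)
    rw [sub_zero] at hω
    by_contra! hcon
    simp only [Set.mem_union, Set.mem_ofPred_eq, not_or, not_le] at hcon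
    obtain ⟨hle, hlt⟩ := hcon
    rw [Real.norm_of_nonneg (hW0 n ω)] at hle
    have : ε / M * W n ω < ε := by
      calc ε / M * W n ω < ε / M * M := by gcongr
        _ = ε := div_mul_cancel₀ ε hM.ne'
    linarith
  calc P.real {ω | ε ≤ ‖R n ω - (0 : ℕ → Ω → ℝ) n ω‖}
      ≤ P.real {ω | ¬ ‖R n ω‖ ≤ ε / M * ‖W n ω‖} + P.real {ω | M ≤ W n ω} :=
        (measureReal_mono hsub).trans (measureReal_union_le _ _)
    _ < η / 2 + η / 2 := add_lt_add_of_lt_of_le hn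
        ((measureReal_ge_le_div_of_integral_le (hW0 n) (hWi n) (hWC n) hM).trans hCM.le)
    _ = η := add_halves η

end ConvergenceInProbability

section LeCam

variable {Ω Ω' F : Type*} [MeasurableSpace Ω] [MeasurableSpace Ω'] {P : Measure Ω}
  {P' : Measure Ω'} [IsProbabilityMeasure P] [IsProbabilityMeasure P']

section

variable [TopologicalSpace F] [MeasurableSpace F]

theorem abs_integral_sub_integral_min_le [OpensMeasurableSpace F] (φ : F →ᵇ ℝ) {T : Ω → F}
    {L : Ω → ℝ} (hT : AEMeasurable T P) (hL : Integrable L P) (c : ℝ) :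
    |∫ ω, φ (T ω) * L ω ∂P - ∫ ω, φ (T ω) * min (L ω) c ∂P| ≤
      ‖φ‖ * (∫ ω, L ω ∂P - ∫ ω, min (L ω) c ∂P) := by
  have hmin : Integrable (fun ω => min (L ω) c) P := hL.inf (integrable_const _)
  have hφ : AEStronglyMeasurable (fun ω => φ (T ω)) P :=
    (φ.continuous.measurable.comp_aemeasurable hT).aestronglyMeasurable
  have hb : ∀ᵐ ω ∂P, ‖φ (T ω)‖ ≤ ‖φ‖ := ae_of_all _ fun ω => φ.norm_coe_le_norm _
  rw [← integral_sub (hL.bdd_mul hφ hb) (hmin.bdd_mul hφ hb), ← integral_sub hL hmin,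
    ← integral_const_mul, ← Real.norm_eq_abs]
  refine norm_integral_le_of_norm_le ((hL.sub hmin).const_mul _) (ae_of_all _ fun ω => ?_)
  rw [← mul_sub, norm_mul, Real.norm_of_nonneg (sub_nonneg.2 (min_le_left _ _))]
  exact mul_le_mul_of_nonneg_right (φ.norm_coe_le_norm _) (sub_nonneg.2 (min_le_left _ _))

theorem tendsto_integral_of_tendstoInDistribution [OpensMeasurableSpace F] {X : ℕ → Ω → F}
    {Z : Ω' → F}
    (h : TendstoInDistribution X atTop Z (fun _ => P) P') (G : F →ᵇ ℝ) :
    Tendsto (fun n => ∫ ω, G (X n ω) ∂P) atTop (𝓝 (∫ ω, G (Z ω) ∂P')) := by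
  have hG := ProbabilityMeasure.tendsto_iff_forall_integral_tendsto.1 h.tendsto G
  have hGm {Q : Measure F} : AEStronglyMeasurable G Q :=
    G.continuous.measurable.aestronglyMeasurable
  simp only [ProbabilityMeasure.coe_mk] at hG
  rw [integral_map h.aemeasurable_limit hGm] at hG
  exact hG.congr fun n => integral_map (h.forall_aemeasurable n) hGm

theorem tendsto_integral_min_natCast {L : Ω → ℝ} (hL : Integrable L P) (hL0 : 0 ≤ L) :
    Tendsto (fun c : ℕ => ∫ ω, min (L ω) c ∂P) atTop (𝓝 (∫ ω, L ω ∂P)) := by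
  refine tendsto_integral_of_dominated_convergence L
    (fun c => (hL.inf (integrable_const _)).aestronglyMeasurable) hL
    (fun c => ae_of_all _ fun ω => ?_) (ae_of_all _ fun ω => ?_)
  · rw [Real.norm_of_nonneg (le_min (hL0 ω) (Nat.cast_nonneg c))]
    exact min_le_left _ _
  · refine tendsto_const_nhds.congr' ?_
    filter_upwards [tendsto_natCast_atTop_atTop.eventually_ge_atTop (L ω)] with c hc
    exact (min_eq_left hc).symm

theorem tendsto_integral_mul_min [OpensMeasurableSpace (F × ℝ)] {T : ℕ → Ω → F} {L : ℕ → Ω → ℝ}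
    {T' : Ω' → F} {L' : Ω' → ℝ}
    (h : TendstoInDistribution (fun n ω => (T n ω, L n ω)) atTop (fun ω => (T' ω, L' ω))
      (fun _ => P) P')
    (hL : ∀ n, 0 ≤ L n) (hL' : 0 ≤ L') (φ : F →ᵇ ℝ) (c : ℕ) :
    Tendsto (fun n => ∫ ω, φ (T n ω) * min (L n ω) c ∂P) atTop
      (𝓝 (∫ ω, φ (T' ω) * min (L' ω) c ∂P')) := by
  have hG := tendsto_integral_of_tendstoInDistribution h
    (BoundedContinuousFunction.ofNormedAddCommGroup
      (fun x : F × ℝ => φ x.1 * min |x.2| c) (by fun_prop) (‖φ‖ * c) fun x => ?_)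
  · simpa [abs_of_nonneg (hL _ _), abs_of_nonneg (hL' _)] using hG
  · rw [norm_mul, Real.norm_of_nonneg (le_min (abs_nonneg _) (Nat.cast_nonneg c))]
    gcongr
    exacts [φ.norm_coe_le_norm _, min_le_right _ _]

/-- **Le Cam's third lemma**. As the limiting weight `L'` still has total mass one, no mass of
`L n` escapes to infinity, and truncating the weights costs little uniformly in `n`. -/
theorem tendsto_integral_mul_of_tendstoInDistribution [OpensMeasurableSpace F]
    [OpensMeasurableSpace (F × ℝ)] {T : ℕ → Ω → F} {L : ℕ → Ω → ℝ} {T' : Ω' → F}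
    {L' : Ω' → ℝ}
    (h : TendstoInDistribution (fun n ω => (T n ω, L n ω)) atTop (fun ω => (T' ω, L' ω))
      (fun _ => P) P')
    (hL0 : ∀ n, 0 ≤ L n) (hL'0 : 0 ≤ L')
    (hL : ∀ᶠ n in atTop, Integrable (L n) P ∧ ∫ ω, L n ω ∂P = 1)
    (hL' : Integrable L' P') (hL'1 : ∫ ω, L' ω ∂P' = 1) (φ : F →ᵇ ℝ) :
    Tendsto (fun n => ∫ ω, φ (T n ω) * L n ω ∂P) atTop (𝓝 (∫ ω, φ (T' ω) * L' ω ∂P')) := by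
  have hT (n : ℕ) : AEMeasurable (T n) P :=
    measurable_fst.comp_aemeasurable (h.forall_aemeasurable n)
  have hT' : AEMeasurable T' P' := measurable_fst.comp_aemeasurable h.aemeasurable_limit
  have htrunc : Tendsto (fun c : ℕ => ‖φ‖ * (1 - ∫ ω, min (L' ω) c ∂P')) atTop (𝓝 0) := by
    simpa [hL'1] using ((tendsto_integral_min_natCast hL' hL'0).const_sub 1).const_mul ‖φ‖
  rw [Metric.tendsto_nhds]
  intro ε hε
  obtain ⟨c, hc⟩ := (htrunc.eventually (Iio_mem_nhds (show 0 < ε / 4 by positivity))).exists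
  have hmass : Tendsto (fun n => ‖φ‖ * (1 - ∫ ω, min (L n ω) c ∂P)) atTop
      (𝓝 (‖φ‖ * (1 - ∫ ω, min (L' ω) c ∂P'))) := by
    simpa using ((tendsto_integral_mul_min h hL0 hL'0
      (BoundedContinuousFunction.const F 1) c).const_sub 1).const_mul ‖φ‖
  filter_upwards [hL, hmass.eventually (Iio_mem_nhds hc), Metric.tendsto_nhds.1
    (tendsto_integral_mul_min h hL0 hL'0 φ c) (ε / 4) (by positivity)] with n hLn hmassn hn
  have hcut := abs_integral_sub_integral_min_le φ (hT n) hLn.1 c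
  have hcut' := abs_integral_sub_integral_min_le φ hT' hL' c
  rw [hLn.2, abs_le] at hcut
  rw [hL'1, abs_le] at hcut'
  rw [Real.dist_eq, abs_lt] at hn ⊢
  constructor <;> linarith [hcut.1, hcut.2, hcut'.1, hcut'.2, hn.1, hn.2]

end

theorem tendstoInDistribution_prodMk_of_tendstoInMeasure_sub {E F F' : Type*}
    [TopologicalSpace E] [MeasurableSpace E] [OpensMeasurableSpace E]
    [SeminormedAddCommGroup F] [MeasurableSpace F] [BorelSpace F] [SecondCountableTopology F]
    [SeminormedAddCommGroup F'] [MeasurableSpace F'] [BorelSpace F'] [SecondCountableTopology F']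
    {W : ℕ → Ω → E} {Z : Ω' → E} (hW : TendstoInDistribution W atTop Z (fun _ => P) P')
    {q : E → F} {l : E → F'} (hq : Continuous q) (hl : Continuous l)
    {T : ℕ → Ω → F} {Λ : ℕ → Ω → F'} (hT : ∀ n, AEMeasurable (T n) P)
    (hΛ : ∀ n, AEMeasurable (Λ n) P)
    (hTq : TendstoInMeasure P (fun n ω => T n ω - q (W n ω)) atTop 0)
    (hΛl : TendstoInMeasure P (fun n ω => Λ n ω - l (W n ω)) atTop 0) :
    TendstoInDistribution (fun n ω => (T n ω, Λ n ω)) atTop (fun ω => (q (Z ω), l (Z ω)))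
      (fun _ => P) P' := by
  refine tendstoInDistribution_of_tendstoInMeasure_sub (X := fun n ω => (q (W n ω), l (W n ω)))
    _ _ (hW.continuous_comp (hq.prodMk hl)) ?_ fun n => (hT n).prodMk (hΛ n)
  rw [tendstoInMeasure_iff_norm] at hTq hΛl ⊢
  intro ε hε
  have hsum := (hTq ε hε).add (hΛl ε hε)
  rw [add_zero] at hsum
  refine tendsto_of_tendsto_of_tendsto_of_le_of_le tendsto_const_nhds hsum (fun _ => zero_le)
    fun n => (measure_mono fun ω hω => ?_).trans (measure_union_le _ _)
  simpa [Prod.norm_def, le_max_iff] using hω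

end LeCam

section SpectralDecomposition

open Matrix

variable {l m n : Type*} [Fintype l] [Fintype n]

theorem filter_roots_charpoly_mul_comm [Fintype m] [DecidableEq m] [DecidableEq n]
    {R : Type*} [CommRing R] [IsDomain R] {q : R → Prop} [DecidablePred q] (hq : ¬ q 0)
    (M : Matrix m n R) (N : Matrix n m R) :
    (M * N).charpoly.roots.filter q = (N * M).charpoly.roots.filter q := by
  have hX (j : ℕ) : (Multiset.filter q (j • {0})) = 0 :=
    Multiset.filter_eq_nil.2 fun a ha =>
      Multiset.mem_singleton.1 (Multiset.mem_of_mem_nsmul ha) ▸ hq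
  have hne (j : ℕ) {P : Polynomial R} (hP : P.Monic) : Polynomial.X ^ j * P ≠ 0 :=
    ((Polynomial.monic_X_pow j).mul hP).ne_zero
  have h := congrArg (fun P : Polynomial R => P.roots.filter q) (charpoly_mul_comm' M N)
  simpa only [Polynomial.roots_mul (hne _ (charpoly_monic _)), Polynomial.roots_X_pow,
    Multiset.filter_add, hX, zero_add] using h

theorem trace_eq_sum_filter_pos_roots_charpoly [DecidableEq n] {H : Matrix n n ℝ}
    (hH : H.PosSemidef) : H.trace = (H.charpoly.roots.filter (0 < ·)).sum := by
  have hroots : ∀ t ∈ H.charpoly.roots.filter (¬ 0 < ·), t = 0 := by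
    intro t ht
    obtain ⟨ht, ht0⟩ := Multiset.mem_filter.1 ht
    rw [hH.1.roots_charpoly_eq_eigenvalues, Multiset.mem_map] at ht
    obtain ⟨i, -, rfl⟩ := ht
    exact le_antisymm (not_lt.1 ht0) (hH.eigenvalues_nonneg i)
  rw [trace_eq_sum_roots_charpoly_of_splits hH.1.splits_charpoly,
    ← Multiset.filter_add_not (0 < ·) H.charpoly.roots, Multiset.sum_add,
    Multiset.sum_eq_zero hroots, add_zero, Multiset.filter_add_not]

theorem eq_mul_diagonal_mul_transpose_of_trace_eq [DecidableEq l] {H : Matrix n n ℝ}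
    (hH : H.PosSemidef) {V : Matrix n l ℝ} (hV : Vᵀ * V = 1) {lam : l → ℝ}
    (hHV : H * V = V * diagonal lam) (htr : H.trace = ∑ i, lam i) :
    H = V * diagonal lam * Vᵀ := by
  classical
  have hHT : Hᵀ = H := by simpa using hH.1.eq
  have hVH : Vᵀ * H = diagonal lam * Vᵀ := by
    simpa [transpose_mul, hHT] using congrArg transpose hHV
  have hcompress : (1 - V * Vᵀ) * H * (1 - V * Vᵀ) = H - V * diagonal lam * Vᵀ := by
    have hleft : V * Vᵀ * H = V * diagonal lam * Vᵀ := by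
      rw [Matrix.mul_assoc, hVH, Matrix.mul_assoc]
    have hright : H * (V * Vᵀ) = V * diagonal lam * Vᵀ := by rw [← Matrix.mul_assoc, hHV]
    have hboth : V * diagonal lam * Vᵀ * (V * Vᵀ) = V * diagonal lam * Vᵀ := by
      rw [Matrix.mul_assoc, ← Matrix.mul_assoc Vᵀ, hV, Matrix.one_mul]
    rw [Matrix.sub_mul, Matrix.one_mul, hleft, Matrix.mul_sub, Matrix.mul_one, Matrix.sub_mul,
      hright, hboth, sub_self, sub_zero]
  have hproj : (1 - V * Vᵀ)ᴴ = 1 - V * Vᵀ := by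
    rw [conjTranspose_eq_transpose_of_trivial, transpose_sub, transpose_mul, transpose_transpose,
      transpose_one]
  have hpsd : (H - V * diagonal lam * Vᵀ).PosSemidef := by
    rw [← hcompress]
    nth_rw 1 [← hproj]
    exact hH.conjTranspose_mul_mul_same _
  refine sub_eq_zero.1 (hpsd.trace_eq_zero_iff.1 ?_)
  rw [trace_sub, trace_mul_cycle V, hV, Matrix.one_mul, htr, trace_diagonal, sub_self]

theorem eq_zero_of_transpose_mul_mul_eq_zero [Finite m] {A : Matrix n n ℝ} (hA : A.PosDef)
    {M : Matrix n m ℝ} (h : Mᵀ * A * M = 0) : M = 0 := by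
  classical
  have := Fintype.ofFinite m
  refine ext_of_mulVec_single fun j => ?_
  by_contra hne
  rw [zero_mulVec] at hne
  have hpos := hA.dotProduct_mulVec_pos hne
  rw [star_trivial, dotProduct_comm, ← dotProduct_transpose_mulVec, mulVec_mulVec, mulVec_mulVec,
    h, zero_mulVec, dotProduct_zero] at hpos
  exact hpos.false

/-- The trace of `Sᵀ A S` is exhausted by the eigenvalues in `lam`, so that `Sᵀ A S` vanishes on
the orthogonal complement of the columns of `V`, and so does `S`. -/
theorem mul_mul_transpose_eq_of_eigenvectors [Fintype m] [DecidableEq n] [DecidableEq l]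
    {A : Matrix n n ℝ} (hA : A.PosDef) {S : Matrix n m ℝ} {lam : l → ℝ}
    (hlam : (A * (S * Sᵀ)).charpoly.roots.filter (0 < ·) = Finset.univ.val.map lam)
    {V : Matrix m l ℝ} (hV : Vᵀ * V = 1) (hSV : (Sᵀ * A * S) * V = V * diagonal lam) :
    S * V * Vᵀ = S := by
  classical
  have hH : (Sᵀ * A * S).PosSemidef := by
    simpa using hA.posSemidef.conjTranspose_mul_mul_same S
  have htr : (Sᵀ * A * S).trace = ∑ i, lam i := by
    rw [trace_eq_sum_filter_pos_roots_charpoly hH, Matrix.mul_assoc,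
      filter_roots_charpoly_mul_comm (lt_irrefl _), Matrix.mul_assoc, hlam]
    rfl
  have hdiag := eq_mul_diagonal_mul_transpose_of_trace_eq hH hV hSV htr
  have hzero : (Sᵀ * A * S) * (1 - V * Vᵀ) = 0 := by
    rw [Matrix.mul_sub, Matrix.mul_one, ← Matrix.mul_assoc, hSV, ← hdiag, sub_self]
  have hS : S * (1 - V * Vᵀ) = 0 := eq_zero_of_transpose_mul_mul_eq_zero hA <| by
    rw [transpose_mul, Matrix.mul_assoc, Matrix.mul_assoc, ← Matrix.mul_assoc A,
      ← Matrix.mul_assoc Sᵀ, ← Matrix.mul_assoc Sᵀ, hzero, Matrix.mul_zero]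
  rw [Matrix.mul_sub, Matrix.mul_one, sub_eq_zero, ← Matrix.mul_assoc] at hS
  exact hS.symm

theorem quadraticForm_mulVec_add {A : Matrix n n ℝ} (hA : A.IsSymm) {M : Matrix n l ℝ}
    {D : Matrix l l ℝ} (hM : Mᵀ * A * M = D) {b : n → ℝ} {w : l → ℝ}
    (hw : D *ᵥ w = Mᵀ *ᵥ A *ᵥ b) (z : l → ℝ) :
    (M *ᵥ z + b) ⬝ᵥ A *ᵥ (M *ᵥ z + b) =
      (z + w) ⬝ᵥ D *ᵥ (z + w) + (b ⬝ᵥ A *ᵥ b - w ⬝ᵥ D *ᵥ w) := by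
  have hD : D.IsSymm := by
    rw [IsSymm, ← hM, transpose_mul, transpose_mul, hA, transpose_transpose, Matrix.mul_assoc]
  have hAzz : M *ᵥ z ⬝ᵥ A *ᵥ M *ᵥ z = z ⬝ᵥ D *ᵥ z := by
    rw [dotProduct_comm, ← dotProduct_transpose_mulVec, mulVec_mulVec, mulVec_mulVec, ← hM]
  have hAzb : M *ᵥ z ⬝ᵥ A *ᵥ b = z ⬝ᵥ D *ᵥ w := by
    rw [dotProduct_comm, ← dotProduct_transpose_mulVec, ← hw]
  have hAbz : b ⬝ᵥ A *ᵥ M *ᵥ z = z ⬝ᵥ D *ᵥ w := by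
    rw [← hAzb, ← dotProduct_transpose_mulVec, hA]
  have hDwz : w ⬝ᵥ D *ᵥ z = z ⬝ᵥ D *ᵥ w := by
    rw [← dotProduct_transpose_mulVec, hD]
  simp only [mulVec_add, dotProduct_add, add_dotProduct, hAzz, hAzb, hAbz, hDwz]
  ring

end SpectralDecomposition

section ExponentialDensity

variable {Ω : Type*} [MeasurableSpace Ω] {P : Measure Ω}

theorem map_withDensity_comp {E : Type*} [MeasurableSpace E] {T : Ω → E} (hT : Measurable T)
    {g : E → ℝ≥0∞} (hg : Measurable g) :
    (P.withDensity fun ω => g (T ω)).map T = (P.map T).withDensity g := by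
  ext s hs
  rw [Measure.map_apply hT hs, withDensity_apply _ (hT hs), withDensity_apply _ hs,
    setLIntegral_map hs hg hT]

variable {l : Ω → ℝ}

theorem integral_withDensity_exp (hl : Measurable l) (q : Ω → ℝ) :
    ∫ ω, q ω ∂(P.withDensity fun ω => ENNReal.ofReal (Real.exp (l ω))) =
      ∫ ω, q ω * Real.exp (l ω) ∂P := by
  rw [integral_withDensity_eq_integral_toReal_smul (by fun_prop)
    (ae_of_all _ fun x => ENNReal.ofReal_lt_top)]
  simp only [ENNReal.toReal_ofReal (Real.exp_pos _).le, smul_eq_mul, mul_comm]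

theorem integral_exp_eq_one (hl : Measurable l)
    [IsProbabilityMeasure (P.withDensity fun ω => ENNReal.ofReal (Real.exp (l ω)))] :
    ∫ ω, Real.exp (l ω) ∂P = 1 := by
  simpa using (integral_withDensity_exp (P := P) hl fun _ => 1).symm

end ExponentialDensity

section GaussianShift

open scoped MatrixOrder

theorem gaussianReal_withDensity_exp (a : ℝ) :
    (gaussianReal 0 1).withDensity (fun x => ENNReal.ofReal (Real.exp (a * x - a ^ 2 / 2))) =
      gaussianReal a 1 := by
  rw [gaussianReal_of_var_ne_zero _ one_ne_zero, gaussianReal_of_var_ne_zero _ one_ne_zero,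
    ← withDensity_mul _ (measurable_gaussianPDF 0 1) (by fun_prop)]
  congr 1
  ext x
  rw [Pi.mul_apply, gaussianPDF, gaussianPDF, ← ENNReal.ofReal_mul (gaussianPDFReal_nonneg _ _ _),
    gaussianPDFReal, gaussianPDFReal, mul_assoc, ← Real.exp_add]
  congr 3
  simp only [NNReal.coe_one]
  ring

variable {ι : Type*} [Fintype ι]

/-- The law of a vector of independent standard normal variables, on the plain function space that
`shiftedChiSq` uses. -/
abbrev stdPi (ι : Type*) [Fintype ι] : Measure (ι → ℝ) := Measure.pi fun _ : ι => gaussianReal 0 1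

theorem stdPi_withDensity_exp (a : ι → ℝ) :
    (stdPi ι).withDensity (fun x => ENNReal.ofReal (Real.exp (a ⬝ᵥ x - a ⬝ᵥ a / 2))) =
      (stdPi ι).map fun x => x + a := by
  have hshift : (stdPi ι).map (fun x => x + a) = Measure.pi fun i => gaussianReal (a i) 1 := by
    have h := Measure.pi_map_pi (μ := fun _ : ι => gaussianReal 0 1) (f := fun i t => t + a i)
      fun i => (measurable_id.add_const _).aemeasurable
    simp only [gaussianReal_map_add_const, zero_add] at h
    exact h
  have hfin (i : ι) : SigmaFinite ((gaussianReal 0 1).withDensity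
      fun x => ENNReal.ofReal (Real.exp (a i * x - a i ^ 2 / 2))) := by
    rw [gaussianReal_withDensity_exp]
    infer_instance
  rw [hshift, ← funext fun i => gaussianReal_withDensity_exp (a i),
    pi_withDensity (fun _ : ι => gaussianReal 0 1)
    (g := fun i x => ENNReal.ofReal (Real.exp (a i * x - a i ^ 2 / 2))) fun i => by fun_prop]
  congr 1
  ext x
  rw [← ENNReal.ofReal_prod_of_nonneg fun i _ => (Real.exp_pos _).le, ← Real.exp_sum,
    Finset.sum_sub_distrib, ← Finset.sum_div]
  simp only [dotProduct, sq]

variable [DecidableEq ι]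

theorem multivariateGaussian_zero_eq_map_stdPi (C : Matrix ι ι ℝ) :
    multivariateGaussian 0 C = (stdPi ι).map fun x => WithLp.toLp 2 (CFC.sqrt C *ᵥ x) := by
  rw [multivariateGaussian, ← map_pi_eq_stdGaussian, Measure.map_map (by fun_prop) (by fun_prop)]
  congr 1
  ext x i
  rw [Function.comp_apply, zero_add, Matrix.toEuclideanCLM_toLp]

theorem multivariateGaussian_withDensity_exp {C : Matrix ι ι ℝ} (hC : C.PosSemidef) (a : ι → ℝ) :
    (multivariateGaussian 0 C).withDensity
        (fun z => ENNReal.ofReal (Real.exp (a ⬝ᵥ z - a ⬝ᵥ C *ᵥ a / 2))) =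
      (multivariateGaussian 0 C).map fun z => z + WithLp.toLp 2 (C *ᵥ a) := by
  set R := CFC.sqrt C
  have hRR : R * R = C := CFC.sqrt_mul_sqrt_self _ hC.nonneg
  have hRT : Rᵀ = R := by
    simpa [Matrix.star_eq_conjTranspose] using (CFC.sqrt_nonneg C).isSelfAdjoint.star_eq
  have hadj (x y : ι → ℝ) : R *ᵥ x ⬝ᵥ y = x ⬝ᵥ R *ᵥ y := by
    rw [← Matrix.dotProduct_transpose_mulVec, hRT, dotProduct_comm]
  have hquad : a ⬝ᵥ C *ᵥ a = R *ᵥ a ⬝ᵥ R *ᵥ a := by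
    rw [hadj, Matrix.mulVec_mulVec, hRR]
  have hlaw : multivariateGaussian 0 C = (stdPi ι).map fun x => WithLp.toLp 2 (R *ᵥ x) :=
    multivariateGaussian_zero_eq_map_stdPi C
  rw [hlaw, ← map_withDensity_comp (by fun_prop) (by fun_prop),
    Measure.map_map (by fun_prop) (by fun_prop)]
  simp_rw [hquad, ← hadj a]
  rw [stdPi_withDensity_exp, Measure.map_map (by fun_prop) (by fun_prop)]
  congr 1
  ext1 x
  rw [Function.comp_apply, Function.comp_apply, Matrix.mulVec_add, Matrix.mulVec_mulVec, hRR,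
    WithLp.toLp_add]

variable {κ : Type*}

theorem charFun_map_mulVec [Fintype κ] {C : Matrix ι ι ℝ} (hC : C.PosSemidef) (M : Matrix κ ι ℝ)
    (t : EuclideanSpace ℝ κ) :
    charFun ((multivariateGaussian 0 C).map
        fun z => (WithLp.toLp 2 (M *ᵥ z.ofLp) : EuclideanSpace ℝ κ)) t =
      Complex.exp (-((t.ofLp ⬝ᵥ (M * C * Mᵀ) *ᵥ t.ofLp : ℝ) : ℂ) / 2) := by
  have hadj : charFun ((multivariateGaussian 0 C).map
        fun z => (WithLp.toLp 2 (M *ᵥ z.ofLp) : EuclideanSpace ℝ κ)) t =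
      charFun (multivariateGaussian 0 C) (WithLp.toLp 2 (Mᵀ *ᵥ t.ofLp)) := by
    rw [charFun_apply, charFun_apply,
      integral_map (by fun_prop) (Continuous.aestronglyMeasurable (by fun_prop))]
    simp only [EuclideanSpace.inner_eq_star_dotProduct, star_trivial]
    simp only [dotProduct_comm (Mᵀ *ᵥ _), Matrix.dotProduct_transpose_mulVec]
  rw [hadj, charFun_multivariateGaussian hC, inner_zero_right, Complex.ofReal_zero, zero_mul,
    zero_sub, dotProduct_comm, Matrix.dotProduct_transpose_mulVec, Matrix.mulVec_mulVec,
    Matrix.mulVec_mulVec, neg_div]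

theorem map_multivariateGaussian_eq {ι' : Type*} [Fintype ι'] [DecidableEq ι']
    [Finite κ] {C : Matrix ι ι ℝ} (hC : C.PosSemidef) {C' : Matrix ι' ι' ℝ} (hC' : C'.PosSemidef)
    {M : Matrix κ ι ℝ} {M' : Matrix κ ι' ℝ} (h : M * C * Mᵀ = M' * C' * M'ᵀ) :
    (multivariateGaussian 0 C).map (fun z => (WithLp.toLp 2 (M *ᵥ z.ofLp) : EuclideanSpace ℝ κ)) =
      (multivariateGaussian 0 C').map fun z => WithLp.toLp 2 (M' *ᵥ z.ofLp) := by
  have := Fintype.ofFinite κ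
  exact Measure.ext_of_charFun <| funext fun t => by
    rw [charFun_map_mulVec hC, charFun_map_mulVec hC', h]

theorem map_mulVec_multivariateGaussian_eq_map_stdPi [Fintype κ] {n : Type*} [Finite n]
    {C : Matrix ι ι ℝ} (hC : C.PosSemidef) {M : Matrix n ι ℝ} {R : Matrix n κ ℝ}
    (h : M * C * Mᵀ = R * Rᵀ) :
    (multivariateGaussian 0 C).map (fun z => (WithLp.toLp 2 (M *ᵥ z.ofLp) : EuclideanSpace ℝ n)) =
      (stdPi κ).map fun x => WithLp.toLp 2 (R *ᵥ x) := by
  classical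
  rw [map_multivariateGaussian_eq hC .one (M' := R) (by rw [h, Matrix.mul_one]),
    multivariateGaussian_zero_one, ← map_pi_eq_stdGaussian,
    Measure.map_map (by fun_prop) (by fun_prop)]
  rfl

theorem map_quadraticForm_multivariateGaussian {n m : Type*} [Fintype n] [Fintype m]
    [DecidableEq n] {k : ℕ} {A : Matrix n n ℝ} (hA : A.PosDef) {C : Matrix ι ι ℝ}
    (hC : C.PosSemidef) {M : Matrix n ι ℝ} {lam : Fin k → ℝ}
    (hlam : (A * (M * C * Mᵀ)).charpoly.roots.filter (0 < ·) = Finset.univ.val.map lam)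
    {S : Matrix n m ℝ} (hS : S * Sᵀ = M * C * Mᵀ) {V : Matrix m (Fin k) ℝ} (hV : Vᵀ * V = 1)
    (hSV : (Sᵀ * A * S) * V = V * Matrix.diagonal lam) (b : n → ℝ) {w : Fin k → ℝ}
    (hw : w = ((Matrix.diagonal lam)⁻¹ * Vᵀ * Sᵀ * A) *ᵥ b) :
    (multivariateGaussian 0 C).map (fun z => (M *ᵥ z.ofLp + b) ⬝ᵥ A *ᵥ (M *ᵥ z.ofLp + b)) =
      shiftedChiSq lam w (b ⬝ᵥ A *ᵥ b - w ⬝ᵥ Matrix.diagonal lam *ᵥ w) := by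
  have hpos (i : Fin k) : 0 < lam i :=
    (Multiset.mem_filter.1 (hlam ▸ Multiset.mem_map_of_mem lam (Finset.mem_univ i))).2
  have hdet : IsUnit (Matrix.diagonal lam).det := by
    rw [Matrix.det_diagonal, isUnit_iff_ne_zero]
    exact Finset.prod_ne_zero_iff.2 fun i _ => (hpos i).ne'
  have hSVV := mul_mul_transpose_eq_of_eigenvectors hA (hS ▸ hlam) hV hSV
  have hcov : M * C * Mᵀ = (S * V) * (S * V)ᵀ := by
    rw [← hS, Matrix.transpose_mul, ← Matrix.mul_assoc, hSVV]
  have hquad : (S * V)ᵀ * A * (S * V) = Matrix.diagonal lam := by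
    calc (S * V)ᵀ * A * (S * V) = Vᵀ * ((Sᵀ * A * S) * V) := by
          simp only [Matrix.transpose_mul, Matrix.mul_assoc]
      _ = Matrix.diagonal lam := by rw [hSV, ← Matrix.mul_assoc, hV, Matrix.one_mul]
  have hlin : Matrix.diagonal lam *ᵥ w = (S * V)ᵀ *ᵥ A *ᵥ b := by
    rw [hw, Matrix.mulVec_mulVec, Matrix.mulVec_mulVec, Matrix.transpose_mul]
    simp only [Matrix.mul_assoc, Matrix.mul_nonsing_inv_cancel_left _ _ hdet]
  have hmap := congrArg (Measure.map fun y : EuclideanSpace ℝ n =>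
    (y.ofLp + b) ⬝ᵥ A *ᵥ (y.ofLp + b)) (map_mulVec_multivariateGaussian_eq_map_stdPi hC hcov)
  rw [Measure.map_map (by fun_prop) (by fun_prop), Measure.map_map (by fun_prop) (by fun_prop)]
    at hmap
  refine hmap.trans (congrArg (Measure.map · (stdPi (Fin k))) (funext fun x => ?_))
  refine (quadraticForm_mulVec_add (by simpa using hA.1) hquad hlin x).trans ?_
  congr 1
  refine Finset.sum_congr rfl fun i _ => ?_
  rw [Matrix.mulVec_diagonal, Pi.add_apply]
  ring

end GaussianShift

section LeCamShift

/-- Le Cam's third lemma in the Gaussian case: tilting by a likelihood ratio shifts the limit of `W`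
by its asymptotic covariance with the log-likelihood ratio. -/
theorem tendsto_integral_mul_exp_of_multivariateGaussian {Ω ι : Type*} [MeasurableSpace Ω]
    {P : Measure Ω} [IsProbabilityMeasure P] [Fintype ι] [DecidableEq ι] {C : Matrix ι ι ℝ}
    (hC : C.PosSemidef) (i : ι) {W : ℕ → Ω → EuclideanSpace ℝ ι}
    (hW : TendstoInDistribution W atTop id (fun _ => P) (multivariateGaussian 0 C))
    {q : EuclideanSpace ℝ ι → ℝ} (hq : Continuous q) {T Λ : ℕ → Ω → ℝ}
    (hT : ∀ n, AEMeasurable (T n) P) (hΛ : ∀ n, AEMeasurable (Λ n) P)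
    (hTq : TendstoInMeasure P (fun n ω => T n ω - q (W n ω)) atTop 0)
    (hΛW : TendstoInMeasure P (fun n ω => Λ n ω - (W n ω i - C i i / 2)) atTop 0)
    (hexp : ∀ᶠ n in atTop, ∫ ω, Real.exp (Λ n ω) ∂P = 1) (φ : ℝ →ᵇ ℝ) :
    Tendsto (fun n => ∫ ω, φ (T n ω) * Real.exp (Λ n ω) ∂P) atTop
      (𝓝 (∫ z, φ (q (z + WithLp.toLp 2 (C.col i))) ∂(multivariateGaussian 0 C))) := by
  have hl : Continuous fun z : EuclideanSpace ℝ ι => z i - C i i / 2 := by fun_prop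
  have hshift : (multivariateGaussian 0 C).withDensity
      (fun z => ENNReal.ofReal (Real.exp (z i - C i i / 2))) =
      (multivariateGaussian 0 C).map fun z => z + WithLp.toLp 2 (C.col i) := by
    simpa using multivariateGaussian_withDensity_exp hC (Pi.single i 1)
  have hprob : IsProbabilityMeasure ((multivariateGaussian 0 C).withDensity fun z =>
      ENNReal.ofReal (Real.exp (z i - C i i / 2))) :=
    hshift ▸ Measure.isProbabilityMeasure_map (by fun_prop)
  have hone := integral_exp_eq_one hl.measurable (P := multivariateGaussian 0 C)
  have hjoint : TendstoInDistribution (fun n ω => (T n ω, Real.exp (Λ n ω))) atTop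
      (fun z => (q z, Real.exp (z i - C i i / 2))) (fun _ => P) (multivariateGaussian 0 C) :=
    (tendstoInDistribution_prodMk_of_tendstoInMeasure_sub hW hq hl hT hΛ hTq hΛW).continuous_comp
      (g := fun y => (y.1, Real.exp y.2)) (by fun_prop)
  have hlim := tendsto_integral_mul_of_tendstoInDistribution hjoint
    (fun n ω => (Real.exp_pos _).le) (fun z => (Real.exp_pos _).le)
    (hexp.mono fun n hn => ⟨.of_integral_ne_zero (hn ▸ one_ne_zero), hn⟩)
    (.of_integral_ne_zero (hone ▸ one_ne_zero)) hone φ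
  rwa [← integral_withDensity_exp hl.measurable fun z => φ (q z), hshift,
    integral_map (by fun_prop) (by fun_prop)] at hlim

end LeCamShift

-- Instances on the space of third derivatives need nested synthesis.
set_option maxSynthPendingDepth 3

section Taylor

variable {E : Type*} [NormedAddCommGroup E] [NormedSpace ℝ E]

/-- `F` is three times differentiable at every point of `U`, stated through iterated `fderiv`: the
regularity both of `θ ↦ f_θ(x)` and of the integrals in the Basu et al. conditions. -/
def ThriceDifferentiableOn (F : E → ℝ) (U : Set E) : Prop :=
  ∀ θ ∈ U, DifferentiableAt ℝ F θ ∧ DifferentiableAt ℝ (fderiv ℝ F) θ ∧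
    DifferentiableAt ℝ (fderiv ℝ (fderiv ℝ F)) θ

theorem thriceDifferentiableOn_of_contDiffOn {F : E → ℝ} {U : Set E} (hU : IsOpen U)
    (hF : ContDiffOn ℝ 3 F U) :
    ThriceDifferentiableOn F U := by
  intro θ hθ
  have h0 : ContDiffAt ℝ 3 F θ := hF.contDiffAt (hU.mem_nhds hθ)
  have h1 : ContDiffAt ℝ 2 (fderiv ℝ F) θ := h0.fderiv_right (by norm_num)
  have h2 : ContDiffAt ℝ 1 (fderiv ℝ (fderiv ℝ F)) θ := h1.fderiv_right (by norm_num)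
  exact ⟨h0.differentiableAt (by norm_num), h1.differentiableAt (by norm_num),
    h2.differentiableAt (by norm_num)⟩

theorem differentiableAt_of_iteratedFDeriv_zero {G : Type*} [NormedAddCommGroup G]
    [NormedSpace ℝ G] {H : E → G} {θ : E} (h : DifferentiableAt ℝ (iteratedFDeriv ℝ 0 H) θ) :
    DifferentiableAt ℝ H θ := by
  rw [iteratedFDeriv_zero_eq_comp] at h
  exact (LinearIsometryEquiv.comp_differentiableAt_iff _).1 h

theorem differentiableAt_iteratedFDeriv_fderiv {G : Type*} [NormedAddCommGroup G]
    [NormedSpace ℝ G] {m : ℕ} {H : E → G} {θ : E}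
    (h : DifferentiableAt ℝ (iteratedFDeriv ℝ (m + 1) H) θ) :
    DifferentiableAt ℝ (iteratedFDeriv ℝ m (fderiv ℝ H)) θ := by
  rw [show iteratedFDeriv ℝ (m + 1) H = (continuousMultilinearCurryRightEquiv' ℝ m E G).symm ∘
    iteratedFDeriv ℝ m (fderiv ℝ H) from funext fun x => iteratedFDeriv_succ_eq_comp_right] at h
  exact (LinearIsometryEquiv.comp_differentiableAt_iff _).1 h

theorem thriceDifferentiableOn_of_iteratedFDeriv {F : E → ℝ} {U : Set E} (hU : IsOpen U)
    (hF : ∀ m : ℕ, m < 3 → DifferentiableOn ℝ (iteratedFDeriv ℝ m F) U) :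
    ThriceDifferentiableOn F U := by
  intro θ hθ
  have hn := hU.mem_nhds hθ
  exact ⟨differentiableAt_of_iteratedFDeriv_zero ((hF 0 (by norm_num)).differentiableAt hn),
    differentiableAt_of_iteratedFDeriv_zero (differentiableAt_iteratedFDeriv_fderiv
      ((hF 1 (by norm_num)).differentiableAt hn)),
    differentiableAt_of_iteratedFDeriv_zero (differentiableAt_iteratedFDeriv_fderiv
      (differentiableAt_iteratedFDeriv_fderiv ((hF 2 (by norm_num)).differentiableAt hn)))⟩

theorem iteratedFDeriv_three_apply (F : E → ℝ) (θ a b c : E) :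
    iteratedFDeriv ℝ 3 F θ ![a, b, c] = fderiv ℝ (fderiv ℝ (fderiv ℝ F)) θ a b c := by
  rw [iteratedFDeriv_succ_apply_right, iteratedFDeriv_two_apply]
  rfl

theorem fderiv_sub_const_mul {I G : E → ℝ} {U : Set E} (hI : ThriceDifferentiableOn I U)
    (hG : ThriceDifferentiableOn G U) (c : ℝ) {θ : E} (hθ : θ ∈ U) :
    fderiv ℝ (fun t => I t - c * G t) θ = fderiv ℝ I θ - c • fderiv ℝ G θ := by
  rw [fderiv_fun_sub (hI θ hθ).1 ((hG θ hθ).1.const_mul c), fderiv_const_mul (hG θ hθ).1]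

theorem fderiv_fderiv_sub_const_mul {I G : E → ℝ} {U : Set E} (hU : IsOpen U)
    (hI : ThriceDifferentiableOn I U) (hG : ThriceDifferentiableOn G U) (c : ℝ) {θ : E}
    (hθ : θ ∈ U) :
    fderiv ℝ (fderiv ℝ fun t => I t - c * G t) θ =
      fderiv ℝ (fderiv ℝ I) θ - c • fderiv ℝ (fderiv ℝ G) θ := by
  have h1 : fderiv ℝ (fun t => I t - c * G t) =ᶠ[𝓝 θ]
      fun t => fderiv ℝ I t - c • fderiv ℝ G t := by
    filter_upwards [hU.mem_nhds hθ] with t ht using fderiv_sub_const_mul hI hG c ht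
  rw [h1.fderiv_eq]
  exact ((hI θ hθ).2.1.hasFDerivAt.sub ((hG θ hθ).2.1.hasFDerivAt.const_smul c)).fderiv

theorem ThriceDifferentiableOn.sub_const_mul {I G : E → ℝ} {U : Set E} (hU : IsOpen U)
    (hI : ThriceDifferentiableOn I U) (hG : ThriceDifferentiableOn G U) (c : ℝ) :
    ThriceDifferentiableOn (fun t => I t - c * G t) U := by
  intro θ hθ
  have h1 : fderiv ℝ (fun t => I t - c * G t) =ᶠ[𝓝 θ]
      fun t => fderiv ℝ I t - c • fderiv ℝ G t := by
    filter_upwards [hU.mem_nhds hθ] with t ht using fderiv_sub_const_mul hI hG c ht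
  have h2 : fderiv ℝ (fderiv ℝ fun t => I t - c * G t) =ᶠ[𝓝 θ]
      fun t => fderiv ℝ (fderiv ℝ I) t - c • fderiv ℝ (fderiv ℝ G) t := by
    filter_upwards [hU.mem_nhds hθ] with t ht using fderiv_fderiv_sub_const_mul hU hI hG c ht
  exact ⟨(hI θ hθ).1.sub ((hG θ hθ).1.const_mul c),
    h1.differentiableAt_iff.2 ((hI θ hθ).2.1.sub ((hG θ hθ).2.1.const_smul c)),
    h2.differentiableAt_iff.2 ((hI θ hθ).2.2.fun_sub ((hG θ hθ).2.2.fun_const_smul c))⟩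

theorem norm_fderiv_sub_fderiv_fderiv_le {F : E → ℝ} {U : Set E} (hc : Convex ℝ U)
    (hF : ThriceDifferentiableOn F U) {C : ℝ}
    (hC : ∀ θ ∈ U, ‖fderiv ℝ (fderiv ℝ (fderiv ℝ F)) θ‖ ≤ C) {a b : E} (ha : a ∈ U) (hb : b ∈ U) :
    ‖fderiv ℝ F b - fderiv ℝ F a - fderiv ℝ (fderiv ℝ F) a (b - a)‖ ≤ C * ‖b - a‖ ^ 2 := by
  have hC0 : 0 ≤ C := (norm_nonneg _).trans (hC a ha)
  have hseg : segment ℝ a b ⊆ U := hc.segment_subset ha hb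
  have h := (convex_segment a b).norm_image_sub_le_of_norm_hasFDerivWithin_le' (𝕜 := ℝ)
    (f := fderiv ℝ F) (f' := fderiv ℝ (fderiv ℝ F)) (φ := fderiv ℝ (fderiv ℝ F) a)
    (C := C * ‖b - a‖)
    (fun x hx => (hF x (hseg hx)).2.1.hasFDerivAt.hasFDerivWithinAt) (fun x hx => ?_)
    (left_mem_segment ℝ a b) (right_mem_segment ℝ a b)
  · rw [sq, ← mul_assoc]; exact h
  · refine (hc.norm_image_sub_le_of_norm_hasFDerivWithin_le (𝕜 := ℝ)
      (f' := fderiv ℝ (fderiv ℝ (fderiv ℝ F)))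
      (fun y hy => (hF y hy).2.2.hasFDerivAt.hasFDerivWithinAt) hC ha (hseg hx)).trans ?_
    gcongr
    exact norm_sub_le_of_mem_segment hx

theorem hasFDerivAt_half_quadraticForm {H : E →L[ℝ] E →L[ℝ] ℝ} (hH : ∀ u v, H u v = H v u)
    (a x : E) : HasFDerivAt (fun y => 1 / 2 * H (y - a) (y - a)) (H (x - a)) x := by
  have hsub : HasFDerivAt (fun y => y - a) (ContinuousLinearMap.id ℝ E) x :=
    (hasFDerivAt_id x).sub_const a
  refine (((H.hasFDerivAt.comp x hsub).clm_apply hsub).const_mul (1 / 2)).congr_fderiv ?_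
  ext v
  change 1 / 2 * (H (x - a) v + H v (x - a)) = H (x - a) v
  rw [hH v]
  ring

theorem abs_sub_taylor_le {F : E → ℝ} {U : Set E} (hU : IsOpen U) (hc : Convex ℝ U)
    (hF : ThriceDifferentiableOn F U) {C : ℝ}
    (hC : ∀ θ ∈ U, ‖fderiv ℝ (fderiv ℝ (fderiv ℝ F)) θ‖ ≤ C) {a b : E} (ha : a ∈ U)
    (hb : b ∈ U) :
    |F b - F a - fderiv ℝ F a (b - a) - 1 / 2 * fderiv ℝ (fderiv ℝ F) a (b - a) (b - a)| ≤
      C * ‖b - a‖ ^ 3 := by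
  have hC0 : 0 ≤ C := (norm_nonneg _).trans (hC a ha)
  have hseg : segment ℝ a b ⊆ U := hc.segment_subset ha hb
  set H := fderiv ℝ (fderiv ℝ F) a
  have hsymm : ∀ u v, H u v = H v u := by
    refine second_derivative_symmetric_of_eventually_of_real (f := F) (f' := fderiv ℝ F) (x := a)
      ?_ (hF a ha).2.1.hasFDerivAt
    filter_upwards [hU.mem_nhds ha] with y hy using (hF y hy).1.hasFDerivAt
  have h := (convex_segment a b).norm_image_sub_le_of_norm_hasFDerivWithin_le' (𝕜 := ℝ)
    (f := fun y => F y - 1 / 2 * H (y - a) (y - a))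
    (f' := fun y => fderiv ℝ F y - H (y - a)) (φ := fderiv ℝ F a)
    (C := C * ‖b - a‖ ^ 2)
    (fun x hx => ((hF x (hseg hx)).1.hasFDerivAt.sub
      (hasFDerivAt_half_quadraticForm hsymm a x)).hasFDerivWithinAt)
    (fun x hx => ?_)
    (left_mem_segment ℝ a b) (right_mem_segment ℝ a b)
  · have hsplit : F b - F a - fderiv ℝ F a (b - a) - 1 / 2 * H (b - a) (b - a) =
        F b - 1 / 2 * H (b - a) (b - a) - (F a - 1 / 2 * H (a - a) (a - a)) -
          fderiv ℝ F a (b - a) := by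
      rw [sub_self, map_zero, mul_zero]
      ring
    rw [hsplit, pow_succ, ← mul_assoc]
    exact h
  · rw [sub_right_comm]
    refine (norm_fderiv_sub_fderiv_fderiv_le hc hF hC ha (hseg hx)).trans ?_
    gcongr
    exact norm_sub_le_of_mem_segment hx

end Taylor

section LogRpow

variable {E : Type*} [NormedAddCommGroup E] [NormedSpace ℝ E] {F : E → ℝ} {θ : E}

theorem fderiv_eq_smul_fderiv_log (hF : DifferentiableAt ℝ F θ) (h0 : F θ ≠ 0) :
    fderiv ℝ F θ = F θ • fderiv ℝ (fun t => Real.log (F t)) θ := by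
  rw [fderiv.log hF h0, smul_smul, mul_inv_cancel₀ h0, one_smul]

theorem fderiv_rpow_eq_smul_fderiv_log (hF : DifferentiableAt ℝ F θ) (h0 : F θ ≠ 0) (a : ℝ) :
    fderiv ℝ (fun t => F t ^ a) θ =
      (a * F θ ^ a) • fderiv ℝ (fun t => Real.log (F t)) θ := by
  rw [(hF.hasFDerivAt.rpow_const (p := a) (Or.inl h0)).fderiv, fderiv_eq_smul_fderiv_log hF h0,
    smul_smul, Real.rpow_sub_one h0, mul_assoc, div_mul_cancel₀ _ h0]

theorem fderiv_fderiv_rpow_apply (hF : ContDiffAt ℝ 2 F θ) (h0 : F θ ≠ 0) (a : ℝ) (u v : E) :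
    fderiv ℝ (fderiv ℝ fun t => F t ^ a) θ u v =
      a ^ 2 * F θ ^ a * (fderiv ℝ (fun t => Real.log (F t)) θ u *
        fderiv ℝ (fun t => Real.log (F t)) θ v) +
      a * F θ ^ a * fderiv ℝ (fderiv ℝ fun t => Real.log (F t)) θ u v := by
  have hfderiv : fderiv ℝ (fun t => F t ^ a) =ᶠ[𝓝 θ]
      fun t => (a * F t ^ a) • fderiv ℝ (fun t => Real.log (F t)) t := by
    filter_upwards [hF.eventually (by simp), hF.continuousAt.eventually_ne h0] with t ht ht0
    exact fderiv_rpow_eq_smul_fderiv_log (ht.differentiableAt (by norm_num)) ht0 a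
  have hrpow : DifferentiableAt ℝ (fun t => F t ^ a) θ :=
    (hF.rpow_const_of_ne h0).differentiableAt (by norm_num)
  have hlog : DifferentiableAt ℝ (fderiv ℝ fun t => Real.log (F t)) θ :=
    ((hF.log h0).fderiv_right (m := 1) (by norm_num)).differentiableAt (by norm_num)
  rw [hfderiv.fderiv_eq, fderiv_fun_smul (hrpow.const_mul a) hlog, fderiv_const_mul hrpow,
    fderiv_rpow_eq_smul_fderiv_log (hF.differentiableAt (by norm_num)) h0]
  simp only [add_apply, smul_apply, ContinuousLinearMap.smulRight_apply, smul_eq_mul]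
  ring

end LogRpow

section Coordinates

variable {p : ℕ} {F : Type*} [NormedAddCommGroup F] [NormedSpace ℝ F]

theorem eq_sum_dir (v : Param p) : v = ∑ j, v j • dir j := by
  ext i
  simp [dir, Finset.sum_apply, Pi.single_apply]

theorem clm_apply_eq_sum (L : Param p →L[ℝ] F) (v : Param p) : L v = ∑ j, v j • L (dir j) := by
  conv_lhs => rw [eq_sum_dir v]
  simp

theorem norm_clm_le_sum (L : Param p →L[ℝ] F) : ‖L‖ ≤ ∑ j, ‖L (dir j)‖ := by
  refine L.opNorm_le_bound (Finset.sum_nonneg fun j _ => norm_nonneg _) fun v => ?_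
  rw [clm_apply_eq_sum, Finset.sum_mul]
  refine (norm_sum_le _ _).trans (Finset.sum_le_sum fun j _ => ?_)
  rw [norm_smul, mul_comm]
  gcongr
  exact PiLp.norm_apply_le v j

theorem norm_trilinear_le (T : Param p →L[ℝ] Param p →L[ℝ] Param p →L[ℝ] ℝ)
    {M : Fin p → Fin p → Fin p → ℝ} (hM : ∀ j k l, |T (dir j) (dir k) (dir l)| ≤ M j k l) :
    ‖T‖ ≤ ∑ j, ∑ k, ∑ l, M j k l := by
  refine (norm_clm_le_sum T).trans (Finset.sum_le_sum fun j _ => ?_)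
  refine (norm_clm_le_sum _).trans (Finset.sum_le_sum fun k _ => ?_)
  exact (norm_clm_le_sum _).trans (Finset.sum_le_sum fun l _ => hM j k l)

theorem bilinear_eq_sum (T : Param p →L[ℝ] Param p →L[ℝ] ℝ) (u v : Param p) :
    T u v = ∑ j, ∑ k, u j * v k * T (dir j) (dir k) := by
  rw [clm_apply_eq_sum T u, sum_apply]
  refine Finset.sum_congr rfl fun j _ => ?_
  rw [smul_apply, clm_apply_eq_sum (T (dir j)) v, Finset.smul_sum]
  exact Finset.sum_congr rfl fun k _ => by simp [mul_assoc]

end Coordinates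

section SmoothPosOrZeroOn

variable {E : Type*} [NormedAddCommGroup E] [NormedSpace ℝ E] {F : E → ℝ} {U : Set E} {θ : E}

/-- A smooth function that is positive throughout `U` or vanishes throughout `U`, such as the
likelihood `θ ↦ f_θ(x)` of an observation `x` when the densities have common support. -/
def SmoothPosOrZeroOn (F : E → ℝ) (U : Set E) : Prop :=
  ContDiffOn ℝ 3 F U ∧ ((∀ t ∈ U, 0 < F t) ∨ ∀ t ∈ U, F t = 0)

theorem fderiv_eq_zero_of_eqOn_const (hU : IsOpen U) {G : E → ℝ} {c : ℝ}
    (h : ∀ t ∈ U, G t = c) (hθ : θ ∈ U) : fderiv ℝ G θ = 0 := by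
  rw [Filter.EventuallyEq.fderiv_eq (Set.EqOn.eventuallyEq_of_mem h (hU.mem_nhds hθ)),
    fderiv_const_apply]

theorem fderiv_fderiv_eq_zero_of_eqOn_const (hU : IsOpen U) {G : E → ℝ} {c : ℝ}
    (h : ∀ t ∈ U, G t = c) (hθ : θ ∈ U) : fderiv ℝ (fderiv ℝ G) θ = 0 := by
  have h0 : Set.EqOn (fderiv ℝ G) (fun _ => 0) U := fun t ht => fderiv_eq_zero_of_eqOn_const hU h ht
  rw [(h0.eventuallyEq_of_mem (hU.mem_nhds hθ)).fderiv_eq, fderiv_const_apply]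

namespace SmoothPosOrZeroOn

omit [NormedAddCommGroup E] [NormedSpace ℝ E] in
theorem log_eq_zero (h0 : ∀ t ∈ U, F t = 0) : ∀ t ∈ U, Real.log (F t) = 0 :=
  fun t ht => by rw [h0 t ht, Real.log_zero]

theorem thriceDifferentiableOn_log (h : SmoothPosOrZeroOn F U) (hU : IsOpen U) :
    ThriceDifferentiableOn (fun t => Real.log (F t)) U := by
  refine thriceDifferentiableOn_of_contDiffOn hU ?_
  rcases h.2 with hpos | h0
  · exact h.1.log fun t ht => (hpos t ht).ne'
  · exact contDiffOn_const.congr (log_eq_zero h0)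

theorem thriceDifferentiableOn_rpow (h : SmoothPosOrZeroOn F U) (hU : IsOpen U) (a : ℝ) :
    ThriceDifferentiableOn (fun t => F t ^ a) U := by
  refine thriceDifferentiableOn_of_contDiffOn hU ?_
  rcases h.2 with hpos | h0
  · exact h.1.rpow_const_of_ne fun t ht => (hpos t ht).ne'
  · exact (contDiffOn_const (c := 0 ^ a)).congr fun t ht => by rw [h0 t ht]

theorem fderiv_eq_smul_fderiv_log (h : SmoothPosOrZeroOn F U) (hU : IsOpen U) (hθ : θ ∈ U) :
    fderiv ℝ F θ = F θ • fderiv ℝ (fun t => Real.log (F t)) θ := by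
  rcases h.2 with hpos | h0
  · exact DPD.fderiv_eq_smul_fderiv_log
      ((h.1.contDiffAt (hU.mem_nhds hθ)).differentiableAt (by norm_num)) (hpos θ hθ).ne'
  · rw [fderiv_eq_zero_of_eqOn_const hU h0 hθ, h0 θ hθ, zero_smul]

theorem fderiv_rpow_eq_smul_fderiv_log (h : SmoothPosOrZeroOn F U) (hU : IsOpen U) (a : ℝ)
    (hθ : θ ∈ U) :
    fderiv ℝ (fun t => F t ^ a) θ = (a * F θ ^ a) • fderiv ℝ (fun t => Real.log (F t)) θ := by
  rcases h.2 with hpos | h0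
  · exact DPD.fderiv_rpow_eq_smul_fderiv_log
      ((h.1.contDiffAt (hU.mem_nhds hθ)).differentiableAt (by norm_num)) (hpos θ hθ).ne' a
  · rw [fderiv_eq_zero_of_eqOn_const hU (log_eq_zero h0) hθ, smul_zero,
      fderiv_eq_zero_of_eqOn_const hU (c := 0 ^ a) (fun t ht => by rw [h0 t ht]) hθ]

theorem fderiv_fderiv_rpow_apply (h : SmoothPosOrZeroOn F U) (hU : IsOpen U) (a : ℝ)
    (hθ : θ ∈ U) (u v : E) :
    fderiv ℝ (fderiv ℝ fun t => F t ^ a) θ u v =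
      a ^ 2 * F θ ^ a * (fderiv ℝ (fun t => Real.log (F t)) θ u *
        fderiv ℝ (fun t => Real.log (F t)) θ v) +
      a * F θ ^ a * fderiv ℝ (fderiv ℝ fun t => Real.log (F t)) θ u v := by
  rcases h.2 with hpos | h0
  · exact DPD.fderiv_fderiv_rpow_apply
      ((h.1.contDiffAt (hU.mem_nhds hθ)).of_le (by norm_num)) (hpos θ hθ).ne' a u v
  · rw [fderiv_eq_zero_of_eqOn_const hU (log_eq_zero h0) hθ,
      fderiv_fderiv_eq_zero_of_eqOn_const hU (log_eq_zero h0) hθ,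
      fderiv_fderiv_eq_zero_of_eqOn_const hU (c := 0 ^ a) (fun t ht => by rw [h0 t ht]) hθ]
    simp only [zero_apply, mul_zero, add_zero]

end SmoothPosOrZeroOn

end SmoothPosOrZeroOn

section Law

variable {𝒳 : Type*} [MeasurableSpace 𝒳] {μ : Measure 𝒳} {p : ℕ} {f : Param p → 𝒳 → ℝ}
  {Θ : Set (Param p)}

theorem IsModel.measurable_density (h : IsModel μ f Θ) (θ : Param p) : Measurable (f θ) :=
  h.measurable.comp measurable_prodMk_left

theorem IsModel.pos_or_zero (h : IsModel μ f Θ) (x : 𝒳) :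
    (∀ t ∈ Θ, 0 < f t x) ∨ ∀ t ∈ Θ, f t x = 0 := by
  by_cases hx : ∃ t ∈ Θ, 0 < f t x
  · obtain ⟨t, ht, hpos⟩ := hx
    exact Or.inl fun t' ht' => (Set.ext_iff.1 (h.common_support t ht t' ht') x).1 hpos
  · push Not at hx
    exact Or.inr fun t ht => le_antisymm (hx t ht) (h.nonneg t ht x)

theorem IsModel.integrable_law_iff (h : IsModel μ f Θ) {θ : Param p} (hθ : θ ∈ Θ) {q : 𝒳 → ℝ} :
    Integrable q (law μ f θ) ↔ Integrable (fun x => f θ x * q x) μ := by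
  rw [law, integrable_withDensity_iff_integrable_smul' (h.measurable_density θ).ennreal_ofReal
    (ae_of_all _ fun x => ENNReal.ofReal_lt_top)]
  simp only [ENNReal.toReal_ofReal (h.nonneg θ hθ _), smul_eq_mul]

theorem IsModel.integral_law (h : IsModel μ f Θ) {θ : Param p} (hθ : θ ∈ Θ) (q : 𝒳 → ℝ) :
    ∫ x, q x ∂(law μ f θ) = ∫ x, f θ x * q x ∂μ := by
  rw [law, integral_withDensity_eq_integral_toReal_smul (h.measurable_density θ).ennreal_ofReal
    (ae_of_all _ fun x => ENNReal.ofReal_lt_top)]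
  simp only [ENNReal.toReal_ofReal (h.nonneg θ hθ _), smul_eq_mul]

theorem IsModel.isProbabilityMeasure_law (h : IsModel μ f Θ) {θ : Param p} (hθ : θ ∈ Θ) :
    IsProbabilityMeasure (law μ f θ) := by
  constructor
  rw [law, withDensity_apply _ MeasurableSet.univ, Measure.restrict_univ,
    ← ofReal_integral_eq_lintegral_ofReal (h.integrable θ hθ) (ae_of_all _ (h.nonneg θ hθ)),
    h.integral_eq_one θ hθ, ENNReal.ofReal_one]

end Law

section Objective

variable {𝒳 : Type*} [MeasurableSpace 𝒳] {μ : Measure 𝒳} {p : ℕ} {f : Param p → 𝒳 → ℝ}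
  {Θ ω N : Set (Param p)} {τ : ℝ} {θ : Param p}

theorem IsModel.ae_smoothPosOrZeroOn (h : IsModel μ f Θ) (hωΘ : ω ⊆ Θ)
    (hs : SmoothDensity μ f ω) : ∀ᵐ x ∂μ, SmoothPosOrZeroOn (fun t => f t x) ω := by
  filter_upwards [hs] with x hx
  exact ⟨hx, (h.pos_or_zero x).imp (fun hx' t ht => hx' t (hωΘ ht)) fun hx' t ht => hx' t (hωΘ ht)⟩

theorem ThirdDerivBound.exists_norm_le (h : ThirdDerivBound μ f ω N τ) :
    ∃ (M : 𝒳 → ℝ) (m : ℝ),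
      (∀ᵐ x ∂μ, ∀ θ ∈ ω,
        ‖fderiv ℝ (fderiv ℝ (fderiv ℝ fun t => objTerm μ f τ t x)) θ‖ ≤ M x) ∧
      ∀ θ' ∈ N, Integrable M (law μ f θ') ∧ ∫ x, M x ∂(law μ f θ') ≤ m := by
  obtain ⟨M, m, hM, hm⟩ := h
  have hint (θ') (hθ' : θ' ∈ N) (j k l) := (hm θ' hθ' j k l).1
  refine ⟨fun x => ∑ j, ∑ k, ∑ l, M j k l x, ∑ j, ∑ k, ∑ l, m j k l, ?_, fun θ' hθ' => ⟨?_, ?_⟩⟩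
  · filter_upwards [hM] with x hx θ hθ
    refine norm_trilinear_le _ fun j k l => ?_
    rw [← iteratedFDeriv_three_apply]
    exact hx θ hθ j k l
  · exact integrable_finsetSum _ fun j _ => integrable_finsetSum _ fun k _ =>
      integrable_finsetSum _ fun l _ => hint θ' hθ' j k l
  · rw [integral_finsetSum _ fun j _ => integrable_finsetSum _ fun k _ =>
      integrable_finsetSum _ fun l _ => hint θ' hθ' j k l]
    refine Finset.sum_le_sum fun j _ => ?_
    rw [integral_finsetSum _ fun k _ => integrable_finsetSum _ fun l _ => hint θ' hθ' j k l]
    refine Finset.sum_le_sum fun k _ => ?_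
    rw [integral_finsetSum _ fun l _ => hint θ' hθ' j k l]
    exact Finset.sum_le_sum fun l _ => (hm θ' hθ' j k l).2

namespace DiffUnderIntegral

variable {φ : Param p → 𝒳 → ℝ}

theorem integrable (h : DiffUnderIntegral μ ω φ) (hθ : θ ∈ ω) : Integrable (φ θ) μ := by
  simpa using (h.2 0 (by norm_num) (fun i => i.elim0) θ hθ).1

theorem integrable_fderiv (h : DiffUnderIntegral μ ω φ) (hθ : θ ∈ ω) (j : Fin p) :
    Integrable (fun x => fderiv ℝ (fun t => φ t x) θ (dir j)) μ := by
  simpa using (h.2 1 (by norm_num) (fun _ => j) θ hθ).1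

theorem fderiv_integral (h : DiffUnderIntegral μ ω φ) (hθ : θ ∈ ω) (j : Fin p) :
    fderiv ℝ (fun t => ∫ x, φ t x ∂μ) θ (dir j) =
      ∫ x, fderiv ℝ (fun t => φ t x) θ (dir j) ∂μ := by
  simpa using (h.2 1 (by norm_num) (fun _ => j) θ hθ).2

theorem integrable_fderiv_fderiv (h : DiffUnderIntegral μ ω φ) (hθ : θ ∈ ω) (j k : Fin p) :
    Integrable (fun x => fderiv ℝ (fderiv ℝ fun t => φ t x) θ (dir j) (dir k)) μ := by
  simpa [iteratedFDeriv_two_apply] using (h.2 2 (by norm_num) ![j, k] θ hθ).1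

theorem fderiv_fderiv_integral (h : DiffUnderIntegral μ ω φ) (hθ : θ ∈ ω) (j k : Fin p) :
    fderiv ℝ (fderiv ℝ fun t => ∫ x, φ t x ∂μ) θ (dir j) (dir k) =
      ∫ x, fderiv ℝ (fderiv ℝ fun t => φ t x) θ (dir j) (dir k) ∂μ := by
  simpa [iteratedFDeriv_two_apply] using (h.2 2 (by norm_num) ![j, k] θ hθ).2

end DiffUnderIntegral

variable (μ f τ) in
/-- The integral `∫ f_θ^(1+τ)` as a function of the parameter: the deterministic part of the
objective function. -/
def powInt (θ : Param p) : ℝ := ∫ x, f θ x ^ (1 + τ) ∂μ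

theorem objTerm_zero (x : 𝒳) :
    (fun t => objTerm μ f 0 t x) = fun t => 0 - 1 * Real.log (f t x) := by
  ext t
  rw [objTerm, if_pos rfl, one_mul, zero_sub]

theorem objTerm_of_ne_zero (hτ : τ ≠ 0) (x : 𝒳) :
    (fun t => objTerm μ f τ t x) = fun t => powInt μ f τ t - (1 + 1 / τ) * f t x ^ τ := by
  ext t
  rw [objTerm, if_neg hτ, powInt]

theorem powInt_zero (hmodel : IsModel μ f Θ) (hθ : θ ∈ Θ) : powInt μ f 0 θ = 1 := by
  simp only [powInt, add_zero, Real.rpow_one]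
  exact hmodel.integral_eq_one θ hθ

theorem thriceDifferentiableOn_powInt (hω : IsOpen ω)
    (h : DiffUnderIntegral μ ω fun θ x => f θ x ^ (1 + τ)) :
    ThriceDifferentiableOn (powInt μ f τ) ω :=
  thriceDifferentiableOn_of_iteratedFDeriv hω h.1

theorem thriceDifferentiableOn_const (c : ℝ) :
    ThriceDifferentiableOn (fun _ : Param p => c) ω := fun θ _ => by
  simp only [fderiv_fun_const, Pi.zero_def, differentiableAt_const, and_self]

theorem thriceDifferentiableOn_objTerm (hω : IsOpen ω)
    (h : DiffUnderIntegral μ ω fun θ x => f θ x ^ (1 + τ)) {x : 𝒳}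
    (hx : SmoothPosOrZeroOn (fun t => f t x) ω) :
    ThriceDifferentiableOn (fun t => objTerm μ f τ t x) ω := by
  by_cases hτ : τ = 0
  · subst hτ
    rw [objTerm_zero]
    exact (thriceDifferentiableOn_const 0).sub_const_mul hω (hx.thriceDifferentiableOn_log hω) 1
  · rw [objTerm_of_ne_zero hτ]
    exact (thriceDifferentiableOn_powInt hω h).sub_const_mul hω
      (hx.thriceDifferentiableOn_rpow hω τ) _

theorem fderiv_objTerm (hmodel : IsModel μ f Θ) (hω : IsOpen ω) (hωΘ : ω ⊆ Θ)
    (h : DiffUnderIntegral μ ω fun θ x => f θ x ^ (1 + τ)) {x : 𝒳}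
    (hx : SmoothPosOrZeroOn (fun t => f t x) ω) (hθ : θ ∈ ω) :
    fderiv ℝ (fun t => objTerm μ f τ t x) θ = fderiv ℝ (powInt μ f τ) θ -
      ((1 + τ) * f θ x ^ τ) • fderiv ℝ (fun t => Real.log (f t x)) θ := by
  by_cases hτ : τ = 0
  · subst hτ
    rw [objTerm_zero, fderiv_sub_const_mul (thriceDifferentiableOn_const 0)
      (hx.thriceDifferentiableOn_log hω) 1 hθ,
      fderiv_eq_zero_of_eqOn_const hω (fun t ht => powInt_zero hmodel (hωΘ ht)) hθ]
    simp
  · rw [objTerm_of_ne_zero hτ, fderiv_sub_const_mul (thriceDifferentiableOn_powInt hω h)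
      (hx.thriceDifferentiableOn_rpow hω τ) _ hθ, hx.fderiv_rpow_eq_smul_fderiv_log hω τ hθ,
      smul_smul]
    congr 2
    field_simp
    ring

theorem fderiv_fderiv_objTerm (hmodel : IsModel μ f Θ) (hω : IsOpen ω) (hωΘ : ω ⊆ Θ)
    (h : DiffUnderIntegral μ ω fun θ x => f θ x ^ (1 + τ)) {x : 𝒳}
    (hx : SmoothPosOrZeroOn (fun t => f t x) ω) (hθ : θ ∈ ω) (u v : Param p) :
    fderiv ℝ (fderiv ℝ fun t => objTerm μ f τ t x) θ u v =
      fderiv ℝ (fderiv ℝ (powInt μ f τ)) θ u v -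
      (1 + τ) * f θ x ^ τ * (τ * (fderiv ℝ (fun t => Real.log (f t x)) θ u *
        fderiv ℝ (fun t => Real.log (f t x)) θ v) +
        fderiv ℝ (fderiv ℝ fun t => Real.log (f t x)) θ u v) := by
  by_cases hτ : τ = 0
  · subst hτ
    rw [objTerm_zero, fderiv_fderiv_sub_const_mul hω (thriceDifferentiableOn_const 0)
      (hx.thriceDifferentiableOn_log hω) 1 hθ,
      fderiv_fderiv_eq_zero_of_eqOn_const hω (fun t ht => powInt_zero hmodel (hωΘ ht)) hθ,
      fderiv_fderiv_eq_zero_of_eqOn_const hω (c := (0 : ℝ)) (fun _ _ => rfl) hθ]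
    simp
  · rw [objTerm_of_ne_zero hτ, fderiv_fderiv_sub_const_mul hω (thriceDifferentiableOn_powInt hω h)
      (hx.thriceDifferentiableOn_rpow hω τ) _ hθ, sub_apply, sub_apply, smul_apply, smul_apply,
      hx.fderiv_fderiv_rpow_apply hω τ hθ, smul_eq_mul]
    field_simp
    ring

theorem mul_score_sub_vecXi (hmodel : IsModel μ f Θ) (hτ : 0 ≤ τ) (hθ : θ ∈ Θ) (j : Fin p)
    (x : 𝒳) :
    f θ x * (score f θ x j * f θ x ^ τ - vecXi μ f τ θ j) =
      score f θ x j * f θ x ^ (1 + τ) - vecXi μ f τ θ j * f θ x := by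
  rw [Real.rpow_one_add' (hmodel.nonneg θ hθ x) (by linarith)]
  ring

section ScoreMoments

variable (hω : IsOpen ω) (hn : ∀ᵐ x ∂μ, SmoothPosOrZeroOn (fun t => f t x) ω)
  (hself : DiffUnderIntegral μ ω fun θ x => f θ x ^ (1 + τ)) (hτ : 0 ≤ τ)
  (hmodel : IsModel μ f Θ) (hωΘ : ω ⊆ Θ) (hθ : θ ∈ ω)
include hω hn hθ

theorem fderiv_rpow_one_add_dir_ae_eq (j : Fin p) :
    (fun x => fderiv ℝ (fun t => f t x ^ (1 + τ)) θ (dir j)) =ᵐ[μ]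
      fun x => (1 + τ) * (score f θ x j * f θ x ^ (1 + τ)) := by
  filter_upwards [hn] with x hx
  rw [hx.fderiv_rpow_eq_smul_fderiv_log hω (1 + τ) hθ, smul_apply, smul_eq_mul, score]
  ring

include hself

theorem fderiv_powInt_dir (j : Fin p) :
    fderiv ℝ (powInt μ f τ) θ (dir j) = (1 + τ) * vecXi μ f τ θ j := by
  rw [show powInt μ f τ = fun t => ∫ x, f t x ^ (1 + τ) ∂μ from rfl, hself.fderiv_integral hθ,
    integral_congr_ae (fderiv_rpow_one_add_dir_ae_eq hω hn hθ j), integral_const_mul, vecXi]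

include hmodel hωΘ in
theorem fderiv_objTerm_dir (j : Fin p) {x : 𝒳} (hx : SmoothPosOrZeroOn (fun t => f t x) ω) :
    fderiv ℝ (fun t => objTerm μ f τ t x) θ (dir j) =
      -(1 + τ) * (score f θ x j * f θ x ^ τ - vecXi μ f τ θ j) := by
  rw [fderiv_objTerm hmodel hω hωΘ hself hx hθ, sub_apply,
    fderiv_powInt_dir hω hn hself hθ, smul_apply, smul_eq_mul, score]
  ring

include hτ

theorem integrable_score_mul_rpow (j : Fin p) :
    Integrable (fun x => score f θ x j * f θ x ^ (1 + τ)) μ := by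
  have h0 : 1 + τ ≠ 0 := by linarith
  exact (integrable_const_mul_iff (isUnit_iff_ne_zero.2 h0) _).1
    ((hself.integrable_fderiv hθ j).congr (fderiv_rpow_one_add_dir_ae_eq hω hn hθ j))

include hmodel hωΘ

theorem integrable_score_sub_vecXi (j : Fin p) :
    Integrable (fun x => score f θ x j * f θ x ^ τ - vecXi μ f τ θ j) (law μ f θ) := by
  simp only [hmodel.integrable_law_iff (hωΘ hθ), mul_score_sub_vecXi hmodel hτ (hωΘ hθ) j]
  exact (integrable_score_mul_rpow hω hn hself hτ hθ j).sub
    ((hmodel.integrable θ (hωΘ hθ)).const_mul _)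

theorem integral_score_sub_vecXi (j : Fin p) :
    ∫ x, (score f θ x j * f θ x ^ τ - vecXi μ f τ θ j) ∂(law μ f θ) = 0 := by
  simp only [hmodel.integral_law (hωΘ hθ), mul_score_sub_vecXi hmodel hτ (hωΘ hθ) j]
  rw [integral_sub (integrable_score_mul_rpow hω hn hself hτ hθ j)
    ((hmodel.integrable θ (hωΘ hθ)).const_mul _), integral_const_mul,
    hmodel.integral_eq_one θ (hωΘ hθ), mul_one]
  exact sub_self _

theorem mul_fderiv_fderiv_objTerm_ae_eq (j k : Fin p) :
    (fun x => f θ x * fderiv ℝ (fderiv ℝ fun t => objTerm μ f τ t x) θ (dir j) (dir k)) =ᵐ[μ]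
      fun x => fderiv ℝ (fderiv ℝ (powInt μ f τ)) θ (dir j) (dir k) * f θ x +
        ((1 + τ) * (score f θ x j * score f θ x k * f θ x ^ (1 + τ)) -
        fderiv ℝ (fderiv ℝ fun t => f t x ^ (1 + τ)) θ (dir j) (dir k)) := by
  filter_upwards [hn] with x hx
  rw [fderiv_fderiv_objTerm hmodel hω hωΘ hself hx hθ, hx.fderiv_fderiv_rpow_apply hω (1 + τ) hθ,
    Real.rpow_one_add' (hmodel.nonneg θ (hωΘ hθ) x) (by linarith)]
  simp only [score]
  ring

theorem integrable_fderiv_fderiv_objTerm {j k : Fin p}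
    (hJ : Integrable (fun x => score f θ x j * score f θ x k * f θ x ^ (1 + τ)) μ) :
    Integrable (fun x => fderiv ℝ (fderiv ℝ fun t => objTerm μ f τ t x) θ (dir j) (dir k))
      (law μ f θ) :=
  (hmodel.integrable_law_iff (hωΘ hθ)).2 <|
    (((hmodel.integrable θ (hωΘ hθ)).const_mul _).add
      ((hJ.const_mul (1 + τ)).sub (hself.integrable_fderiv_fderiv hθ j k))).congr
      (mul_fderiv_fderiv_objTerm_ae_eq hω hn hself hτ hmodel hωΘ hθ j k).symm

theorem integral_fderiv_fderiv_objTerm {j k : Fin p}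
    (hJ : Integrable (fun x => score f θ x j * score f θ x k * f θ x ^ (1 + τ)) μ) :
    ∫ x, fderiv ℝ (fderiv ℝ fun t => objTerm μ f τ t x) θ (dir j) (dir k) ∂(law μ f θ) =
      (1 + τ) * matJ μ f τ θ j k := by
  have hJ' : Integrable (fun x => (1 + τ) * (score f θ x j * score f θ x k * f θ x ^ (1 + τ)) -
      fderiv ℝ (fderiv ℝ fun t => f t x ^ (1 + τ)) θ (dir j) (dir k)) μ :=
    (hJ.const_mul (1 + τ)).sub (hself.integrable_fderiv_fderiv hθ j k)
  rw [hmodel.integral_law (hωΘ hθ),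
    integral_congr_ae (mul_fderiv_fderiv_objTerm_ae_eq hω hn hself hτ hmodel hωΘ hθ j k),
    integral_add ((hmodel.integrable θ (hωΘ hθ)).const_mul _) hJ',
    integral_sub (hJ.const_mul _) (hself.integrable_fderiv_fderiv hθ j k),
    ← hself.fderiv_fderiv_integral hθ, integral_const_mul, integral_const_mul,
    hmodel.integral_eq_one θ (hωΘ hθ), matJ, Matrix.of_apply,
    show powInt μ f τ = fun t => ∫ x, f t x ^ (1 + τ) ∂μ from rfl]
  ring

end ScoreMoments

end Objective

section MatrixLandau

open Asymptotics

variable {α m n : Type*} [Fintype m] [Fintype n] {l : Filter α}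

theorem isTheta_ofLp {p : ℕ} (v : α → Param p) : (fun a => (v a).ofLp) =Θ[l] v :=
  ⟨(EuclideanSpace.equiv (Fin p) ℝ).isBigO_comp v l,
    (EuclideanSpace.equiv (Fin p) ℝ).isBigO_comp_rev v l⟩

theorem isBigO_mulVec (M : Matrix m n ℝ) (v : α → n → ℝ) : (fun a => M *ᵥ v a) =O[l] v :=
  (LinearMap.toContinuousLinearMap M.mulVecLin).isBigO_comp v l

theorem isLittleO_mulVec_of_tendsto_zero {M : α → Matrix m n ℝ} (hM : Tendsto M l (𝓝 0))
    (v : α → n → ℝ) : (fun a => M a *ᵥ v a) =o[l] v := by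
  refine isLittleO_pi.2 fun i => IsLittleO.fun_sum fun j _ => ?_
  have hMij : (fun a => M a i j) =o[l] fun _ => (1 : ℝ) :=
    (isLittleO_one_iff ℝ).2 (((continuous_apply_apply i j).tendsto 0).comp hM)
  simpa using hMij.mul_isBigO (isBigO_pi.1 (isBigO_refl v l) j).norm_right

theorem isBigO_dotProduct (v w : α → n → ℝ) :
    (fun a => v a ⬝ᵥ w a) =O[l] fun a => ‖v a‖ * ‖w a‖ :=
  IsBigO.fun_sum fun j _ => (isBigO_pi.1 (isBigO_refl v l) j).norm_right.mul
    (isBigO_pi.1 (isBigO_refl w l) j).norm_right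

theorem isLittleO_dotProduct_mulVec_of_tendsto_zero {M : α → Matrix n n ℝ}
    (hM : Tendsto M l (𝓝 0)) (v : α → n → ℝ) :
    (fun a => v a ⬝ᵥ M a *ᵥ v a) =o[l] fun a => ‖v a‖ ^ 2 := by
  simp only [sq]
  exact (isBigO_dotProduct _ _).trans_isLittleO
    ((isBigO_refl _ l).mul_isLittleO (isLittleO_mulVec_of_tendsto_zero hM v).norm_norm)

theorem isLittleO_quadraticForm_sub (A : Matrix n n ℝ) {u v w : α → n → ℝ}
    (hu : u =O[l] w) (h : (fun a => v a - u a) =o[l] w) :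
    (fun a => v a ⬝ᵥ A *ᵥ v a - u a ⬝ᵥ A *ᵥ u a) =o[l] fun a => ‖w a‖ ^ 2 := by
  have hv : v =O[l] w := (h.isBigO.add hu).congr_left fun a => sub_add_cancel _ _
  simp only [sq]
  refine (((isBigO_dotProduct _ _).trans_isLittleO (h.norm_norm.mul_isBigO
    ((isBigO_mulVec A v).trans hv).norm_norm)).add ((isBigO_dotProduct _ _).trans_isLittleO
      (hu.norm_norm.mul_isLittleO ((isBigO_mulVec A _).trans_isLittleO h).norm_norm))).congr_left
    fun a => ?_
  rw [sub_dotProduct, Matrix.mulVec_sub, dotProduct_sub]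
  ring

/-- Multiplication by `R` turns the hypothesis into `R z ~ y`, and `~` is symmetric. -/
theorem isLittleO_sub_mulVec_of_mul_eq_one [DecidableEq n] {R L : Matrix n n ℝ} (hRL : R * L = 1)
    {y z : α → n → ℝ} (h : (fun a => z a - L *ᵥ y a) =o[l] y) :
    (fun a => y a - R *ᵥ z a) =o[l] z := by
  have hequiv : (fun a => R *ᵥ z a) ~[l] y :=
    ((isBigO_mulVec R _).trans_isLittleO h).congr_left fun a => by
      rw [Matrix.mulVec_sub, Matrix.mulVec_mulVec, hRL, Matrix.one_mulVec, Pi.sub_apply]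
  exact hequiv.symm.isLittleO.trans_isBigO (isBigO_mulVec R z)

end MatrixLandau

section IntegratedTaylor

variable {𝒳 : Type*} [MeasurableSpace 𝒳] {ν : Measure 𝒳}

theorem abs_integral_sub_taylor_le {E : Type*} [NormedAddCommGroup E] [NormedSpace ℝ E]
    {V : E → 𝒳 → ℝ} {U : Set E} (hU : IsOpen U) (hc : Convex ℝ U)
    (hV : ∀ᵐ x ∂ν, ThriceDifferentiableOn (fun t => V t x) U) {M : 𝒳 → ℝ} (hM : Integrable M ν)
    (hVM : ∀ᵐ x ∂ν, ∀ t ∈ U, ‖fderiv ℝ (fderiv ℝ (fderiv ℝ fun t => V t x)) t‖ ≤ M x)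
    {a b : E} (ha : a ∈ U) (hb : b ∈ U) (hVa : AEStronglyMeasurable (V a) ν)
    (hVb : AEStronglyMeasurable (V b) ν)
    (h1 : Integrable (fun x => fderiv ℝ (fun t => V t x) a (b - a)) ν)
    (h2 : Integrable (fun x => fderiv ℝ (fderiv ℝ fun t => V t x) a (b - a) (b - a)) ν) :
    |∫ x, (V b x - V a x) ∂ν - ∫ x, fderiv ℝ (fun t => V t x) a (b - a) ∂ν -
        1 / 2 * ∫ x, fderiv ℝ (fderiv ℝ fun t => V t x) a (b - a) (b - a) ∂ν| ≤
      (∫ x, M x ∂ν) * ‖b - a‖ ^ 3 := by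
  set D1 : 𝒳 → ℝ := fun x => fderiv ℝ (fun t => V t x) a (b - a)
  set D2 : 𝒳 → ℝ := fun x => fderiv ℝ (fderiv ℝ fun t => V t x) a (b - a) (b - a)
  have hrem : ∀ᵐ x ∂ν, ‖V b x - V a x - D1 x - 1 / 2 * D2 x‖ ≤ M x * ‖b - a‖ ^ 3 := by
    filter_upwards [hV, hVM] with x hx hMx using abs_sub_taylor_le hU hc hx hMx ha hb
  have hremi : Integrable (fun x => V b x - V a x - D1 x - 1 / 2 * D2 x) ν :=
    (hM.mul_const (‖b - a‖ ^ 3)).mono' (((hVb.sub hVa).sub h1.1).sub (h2.1.const_mul _)) hrem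
  have hsplit : ∫ x, (V b x - V a x) ∂ν - ∫ x, D1 x ∂ν - 1 / 2 * ∫ x, D2 x ∂ν =
      ∫ x, (V b x - V a x - D1 x - 1 / 2 * D2 x) ∂ν := by
    have hlq : Integrable (fun x => D1 x + 1 / 2 * D2 x) ν := h1.add (h2.const_mul _)
    have hsum : ∫ x, (V b x - V a x) ∂ν =
        ∫ x, ((V b x - V a x - D1 x - 1 / 2 * D2 x) + (D1 x + 1 / 2 * D2 x)) ∂ν := by
      congr 1 with x
      ring
    rw [hsum, integral_add hremi hlq, integral_add h1 (h2.const_mul _), integral_const_mul]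
    ring
  rw [hsplit, ← integral_mul_const, ← Real.norm_eq_abs]
  exact norm_integral_le_of_norm_le (hM.mul_const _) hrem

variable {p : ℕ}

theorem integrable_clm_apply {L : 𝒳 → Param p →L[ℝ] ℝ}
    (hL : ∀ j, Integrable (fun x => L x (dir j)) ν) (v : Param p) :
    Integrable (fun x => L x v) ν := by
  simp only [clm_apply_eq_sum _ v]
  exact integrable_finsetSum _ fun j _ => (hL j).const_mul _

theorem integral_clm_apply {L : 𝒳 → Param p →L[ℝ] ℝ}
    (hL : ∀ j, Integrable (fun x => L x (dir j)) ν) (v : Param p) :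
    ∫ x, L x v ∂ν = v.ofLp ⬝ᵥ fun j => ∫ x, L x (dir j) ∂ν := by
  simp only [clm_apply_eq_sum _ v, smul_eq_mul]
  rw [integral_finsetSum _ fun j _ => (hL j).const_mul _]
  exact Finset.sum_congr rfl fun j _ => integral_const_mul _ _

theorem integrable_bilinear_apply {L : 𝒳 → Param p →L[ℝ] Param p →L[ℝ] ℝ}
    (hL : ∀ j k, Integrable (fun x => L x (dir j) (dir k)) ν) (u v : Param p) :
    Integrable (fun x => L x u v) ν := by
  simp only [bilinear_eq_sum _ u v]
  exact integrable_finsetSum _ fun j _ => integrable_finsetSum _ fun k _ => (hL j k).const_mul _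

theorem integral_bilinear_apply {L : 𝒳 → Param p →L[ℝ] Param p →L[ℝ] ℝ}
    (hL : ∀ j k, Integrable (fun x => L x (dir j) (dir k)) ν) (u v : Param p) :
    ∫ x, L x u v ∂ν =
      u.ofLp ⬝ᵥ (Matrix.of fun j k => ∫ x, L x (dir j) (dir k) ∂ν) *ᵥ v.ofLp := by
  simp only [bilinear_eq_sum _ u v, dotProduct, Matrix.mulVec, Finset.mul_sum, Matrix.of_apply]
  rw [integral_finsetSum _ fun j _ => integrable_finsetSum _ fun k _ => (hL j k).const_mul _]
  refine Finset.sum_congr rfl fun j _ => ?_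
  rw [integral_finsetSum _ fun k _ => (hL j k).const_mul _]
  refine Finset.sum_congr rfl fun k _ => ?_
  rw [integral_const_mul]
  ring

end IntegratedTaylor

section Divergence

variable {𝒳 : Type*} [MeasurableSpace 𝒳] {μ : Measure 𝒳} {p : ℕ} {f : Param p → 𝒳 → ℝ}
  {Θ ω : Set (Param p)} {θ₀ : Param p} {τ : ℝ}

theorem measurable_objTerm (hmodel : IsModel μ f Θ) (θ : Param p) :
    Measurable (objTerm μ f τ θ) := by
  have hf := hmodel.measurable_density θ
  unfold objTerm
  split_ifs <;> fun_prop

theorem divergence_of_ne_zero (hτ : τ ≠ 0)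
    (hself : DiffUnderIntegral μ ω fun θ x => f θ x ^ (1 + τ)) {s t : Param p}
    (htrue : DiffUnderIntegral μ ω fun θ x => f θ x ^ τ * f s x) (hs : s ∈ ω) (ht : t ∈ ω) :
    divergence μ τ (f s) (f t) =
      powInt μ f τ t - (1 + 1 / τ) * ∫ x, f t x ^ τ * f s x ∂μ + 1 / τ * powInt μ f τ s := by
  have hts := (htrue.integrable ht).const_mul (1 + 1 / τ)
  have hdiff : Integrable (fun x => f t x ^ (1 + τ) - (1 + 1 / τ) * (f t x ^ τ * f s x)) μ :=
    (hself.integrable ht).sub hts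
  rw [divergence, if_neg hτ, integral_add hdiff ((hself.integrable hs).const_mul _),
    integral_sub (hself.integrable ht) hts, integral_const_mul, integral_const_mul, powInt, powInt]

theorem divergence_eq_integral (hmodel : IsModel μ f Θ) (hωΘ : ω ⊆ Θ) (hτ : 0 ≤ τ)
    (hself : DiffUnderIntegral μ ω fun θ x => f θ x ^ (1 + τ)) {s t : Param p}
    (htrue : DiffUnderIntegral μ ω fun θ x => f θ x ^ τ * f s x) (hs : s ∈ ω) (ht : t ∈ ω) :
    divergence μ τ (f s) (f t) =
      ∫ x, (objTerm μ f τ t x - objTerm μ f τ s x) ∂(law μ f s) := by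
  rw [hmodel.integral_law (hωΘ hs)]
  by_cases h0 : τ = 0
  · rw [divergence, if_pos h0]
    congr 1 with x
    simp only [objTerm, if_pos h0]
    rcases hmodel.pos_or_zero x with hp | hz
    · rw [Real.log_div (hp s (hωΘ hs)).ne' (hp t (hωΘ ht)).ne']
      ring
    · rw [hz s (hωΘ hs)]
      ring
  · have hts := (htrue.integrable ht).const_mul (1 + 1 / τ)
    have hss := (hself.integrable hs).const_mul (1 + 1 / τ)
    have hpoint (x : 𝒳) : f s x * (objTerm μ f τ t x - objTerm μ f τ s x) =
        (powInt μ f τ t - powInt μ f τ s) * f s x -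
          ((1 + 1 / τ) * (f t x ^ τ * f s x) - (1 + 1 / τ) * f s x ^ (1 + τ)) := by
      rw [Real.rpow_one_add' (hmodel.nonneg s (hωΘ hs) x) (by linarith)]
      simp only [objTerm, if_neg h0, powInt]
      ring
    have hdiff : Integrable (fun x => (1 + 1 / τ) * (f t x ^ τ * f s x) -
      (1 + 1 / τ) * f s x ^ (1 + τ)) μ := hts.sub hss
    simp only [hpoint]
    rw [divergence_of_ne_zero h0 hself htrue hs ht,
      integral_sub ((hmodel.integrable s (hωΘ hs)).const_mul _) hdiff, integral_sub hts hss,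
      integral_const_mul, integral_const_mul, integral_const_mul,
      hmodel.integral_eq_one s (hωΘ hs), ← powInt]
    ring

theorem abs_divergence_sub_quadraticForm_le (hmodel : IsModel μ f Θ) (hω : IsOpen ω)
    (hωΘ : ω ⊆ Θ) (hτ : 0 ≤ τ) (hB : BasuConditions μ f ω ω θ₀ τ) {U : Set (Param p)}
    (hU : IsOpen U) (hUc : Convex ℝ U) (hUω : U ⊆ ω) :
    ∃ C : ℝ, ∀ s ∈ U, ∀ t ∈ U, |2 * divergence μ τ (f s) (f t) -
      (t - s).ofLp ⬝ᵥ ((1 + τ) • matJ μ f τ s) *ᵥ (t - s).ofLp| ≤ C * ‖t - s‖ ^ 3 := by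
  obtain ⟨M, m, hM, hm⟩ := hB.third_deriv.exists_norm_le
  refine ⟨2 * m, fun s hs t ht => ?_⟩
  have hsω := hUω hs
  have hself := hB.diff_self
  have hn := hmodel.ae_smoothPosOrZeroOn hωΘ hB.smooth
  have hac : law μ f s ≪ μ := withDensity_absolutelyContinuous _ _
  have hgrad (j) : (fun x => fderiv ℝ (fun t => objTerm μ f τ t x) s (dir j)) =ᵐ[law μ f s]
      fun x => -(1 + τ) * (score f s x j * f s x ^ τ - vecXi μ f τ s j) :=
    hac.ae_le <| hn.mono fun x hx => fderiv_objTerm_dir hω hn hself hmodel hωΘ hsω j hx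
  have hgradi (j) : Integrable (fun x => fderiv ℝ (fun t => objTerm μ f τ t x) s (dir j))
      (law μ f s) :=
    ((integrable_score_sub_vecXi hω hn hself hτ hmodel hωΘ hsω j).const_mul _).congr (hgrad j).symm
  have hgrad0 : ∫ x, fderiv ℝ (fun t => objTerm μ f τ t x) s (t - s) ∂(law μ f s) = 0 := by
    rw [integral_clm_apply hgradi]
    refine Finset.sum_eq_zero fun j _ => ?_
    beta_reduce
    rw [integral_congr_ae (hgrad j), integral_const_mul,
      integral_score_sub_vecXi hω hn hself hτ hmodel hωΘ hsω, mul_zero, mul_zero]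
  have hhessi (j k) := integrable_fderiv_fderiv_objTerm hω hn hself hτ hmodel hωΘ hsω
    (hB.J_integrable s hsω j k)
  have hhess : ∫ x, fderiv ℝ (fderiv ℝ fun t => objTerm μ f τ t x) s (t - s) (t - s)
      ∂(law μ f s) = (t - s).ofLp ⬝ᵥ ((1 + τ) • matJ μ f τ s) *ᵥ (t - s).ofLp := by
    rw [integral_bilinear_apply hhessi]
    congr 2
    ext j k
    exact integral_fderiv_fderiv_objTerm hω hn hself hτ hmodel hωΘ hsω (hB.J_integrable s hsω j k)
  have hT := abs_integral_sub_taylor_le hU hUc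
    (hac.ae_le <| hn.mono fun x hx θ hθ => thriceDifferentiableOn_objTerm hω hself hx θ (hUω hθ))
    (hm s hsω).1 (hac.ae_le <| hM.mono fun x hx θ hθ => hx θ (hUω hθ)) hs ht
    (measurable_objTerm hmodel s).aestronglyMeasurable
    (measurable_objTerm hmodel t).aestronglyMeasurable
    (integrable_clm_apply hgradi _) (integrable_bilinear_apply hhessi _ _)
  rw [← divergence_eq_integral hmodel hωΘ hτ hself (hB.diff_true s hsω) hsω (hUω ht), hgrad0,
    hhess] at hT
  have hT' := hT.trans (mul_le_mul_of_nonneg_right (hm s hsω).2 (by positivity))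
  rw [abs_le] at hT' ⊢
  constructor <;> linarith [hT'.1, hT'.2]

theorem matA_eq_smul_matJ (hmodel : IsModel μ f Θ) (hω : IsOpen ω) (hωΘ : ω ⊆ Θ) (hτ : 0 ≤ τ)
    (hs : SmoothDensity μ f ω) {θ : Param p} (hθ : θ ∈ ω) :
    matA μ f τ θ = (1 + τ) • matJ μ f τ θ := by
  ext i j
  simp only [matA, matJ, Matrix.of_apply, Matrix.smul_apply, smul_eq_mul]
  congr 1
  refine integral_congr_ae ?_
  filter_upwards [hmodel.ae_smoothPosOrZeroOn hωΘ hs] with x hx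
  have hpow : f θ x ^ (τ - 1) * f θ x * f θ x = f θ x ^ (1 + τ) := by
    rcases (hmodel.nonneg θ (hωΘ hθ) x).lt_or_eq with hp | h0
    · rw [Real.rpow_sub_one hp.ne', div_mul_cancel₀ _ hp.ne', add_comm, Real.rpow_add_one hp.ne']
    · rw [← h0, mul_zero, Real.zero_rpow (by linarith)]
  rw [hx.fderiv_eq_smul_fderiv_log hω hθ, smul_apply, smul_apply, smul_eq_mul, smul_eq_mul, ← hpow]
  simp only [score]
  ring

open Asymptotics in
theorem isLittleO_divergence_sub_quadraticForm (hmodel : IsModel μ f Θ) (hω : IsOpen ω)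
    (hωΘ : ω ⊆ Θ) (hτ : 0 ≤ τ) (hB : BasuConditions μ f ω ω θ₀ τ) (hθ : θ₀ ∈ ω) :
    (fun st : Param p × Param p => 2 * divergence μ τ (f st.1) (f st.2) -
        (st.2 - st.1).ofLp ⬝ᵥ matA μ f τ θ₀ *ᵥ (st.2 - st.1).ofLp)
      =o[𝓝 (θ₀, θ₀)] fun st => ‖st.2 - st.1‖ ^ 2 := by
  obtain ⟨r, hr, hrω⟩ := Metric.isOpen_iff.1 hω θ₀ hθ
  obtain ⟨C, hC⟩ := abs_divergence_sub_quadraticForm_le hmodel hω hωΘ hτ hB Metric.isOpen_ball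
    (convex_ball θ₀ r) hrω
  have hball : ∀ᶠ st : Param p × Param p in 𝓝 (θ₀, θ₀),
      st.1 ∈ Metric.ball θ₀ r ∧ st.2 ∈ Metric.ball θ₀ r :=
    prod_mem_nhds (Metric.ball_mem_nhds θ₀ hr) (Metric.ball_mem_nhds θ₀ hr)
  have hcube : (fun st : Param p × Param p => 2 * divergence μ τ (f st.1) (f st.2) -
        (st.2 - st.1).ofLp ⬝ᵥ ((1 + τ) • matJ μ f τ st.1) *ᵥ (st.2 - st.1).ofLp)
      =O[𝓝 (θ₀, θ₀)] fun st => ‖st.2 - st.1‖ ^ 3 := by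
    refine IsBigO.of_bound C (hball.mono fun st hst => ?_)
    rw [norm_pow, norm_norm]
    exact hC _ hst.1 _ hst.2
  have hdiag : (fun st : Param p × Param p => ‖st.2 - st.1‖ ^ 3) =o[𝓝 (θ₀, θ₀)]
      fun st => ‖st.2 - st.1‖ ^ 2 := by
    have hcont : Tendsto (fun st : Param p × Param p => ‖st.2 - st.1‖) (𝓝 (θ₀, θ₀)) (𝓝 0) :=
      (by fun_prop : Continuous fun st : Param p × Param p => ‖st.2 - st.1‖).tendsto' _ _ (by simp)
    exact (isLittleO_pow_pow (by norm_num : 2 < 3)).comp_tendsto hcont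
  have hJ : Tendsto (fun st : Param p × Param p => (1 + τ) • matJ μ f τ st.1 - matA μ f τ θ₀)
      (𝓝 (θ₀, θ₀)) (𝓝 0) := by
    rw [matA_eq_smul_matJ hmodel hω hωΘ hτ hB.smooth hθ, ← sub_self ((1 + τ) • matJ μ f τ θ₀)]
    exact ((((hB.J_continuous.continuousAt (hω.mem_nhds hθ)).comp_of_eq
      continuousAt_fst rfl).tendsto).const_smul _).sub_const _
  have hquad := (isLittleO_dotProduct_mulVec_of_tendsto_zero hJ
    fun st => (st.2 - st.1).ofLp).trans_isBigO ((isTheta_ofLp _).isBigO.norm_norm.pow 2)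
  refine ((hcube.trans_isLittleO hdiag).add hquad).congr_left fun st => ?_
  rw [Matrix.sub_mulVec, dotProduct_sub]
  ring

end Divergence

section BorderedSystem

open Asymptotics

variable {p r : ℕ} {J M : Matrix (Fin p) (Fin p) ℝ} {G : Matrix (Fin p) (Fin r) ℝ}

theorem fromBlocks_mul_fromBlocks_eq_one (hJ : IsUnit J.det) (hN : IsUnit (Gᵀ * J⁻¹ * G).det) :
    Matrix.fromBlocks (J⁻¹ - J⁻¹ * G * (Gᵀ * J⁻¹ * G)⁻¹ * Gᵀ * J⁻¹)
      (J⁻¹ * G * (Gᵀ * J⁻¹ * G)⁻¹) ((Gᵀ * J⁻¹ * G)⁻¹ * Gᵀ * J⁻¹) (-(Gᵀ * J⁻¹ * G)⁻¹) *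
      Matrix.fromBlocks J G Gᵀ 0 = 1 := by
  have hJJ : J⁻¹ * J = 1 := Matrix.nonsing_inv_mul _ hJ
  have hNN : (Gᵀ * J⁻¹ * G)⁻¹ * (Gᵀ * J⁻¹ * G) = 1 := Matrix.nonsing_inv_mul _ hN
  rw [Matrix.fromBlocks_multiply, ← Matrix.fromBlocks_one]
  congr 1
  · rw [Matrix.sub_mul, Matrix.mul_assoc _ J⁻¹ J, hJJ, Matrix.mul_one]
    abel
  · have hassoc : J⁻¹ * G * (Gᵀ * J⁻¹ * G)⁻¹ * Gᵀ * J⁻¹ * G =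
        J⁻¹ * G * ((Gᵀ * J⁻¹ * G)⁻¹ * (Gᵀ * J⁻¹ * G)) := by simp only [Matrix.mul_assoc]
    rw [Matrix.sub_mul, hassoc, hNN, Matrix.mul_one, Matrix.mul_zero, add_zero, sub_self]
  · rw [Matrix.mul_assoc _ J⁻¹ J, hJJ, Matrix.mul_one, Matrix.neg_mul, add_neg_cancel]
  · rw [Matrix.mul_zero, add_zero, ← hNN]
    simp only [Matrix.mul_assoc]

theorem mulVec_injective_of_rank_eq (h : G.rank = r) : Function.Injective G.mulVec := by
  have hsum := LinearMap.finrank_range_add_finrank_ker G.mulVecLin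
  rw [show Module.finrank ℝ G.mulVecLin.range = r from h, Module.finrank_fin_fun] at hsum
  exact LinearMap.ker_eq_bot.1 (Submodule.finrank_eq_zero.1 (Nat.add_eq_left.1 hsum))

theorem isUnit_det_transpose_mul_inv_mul (hJ : J.PosDef) (hG : G.rank = r) :
    IsUnit (Gᵀ * J⁻¹ * G).det := by
  have h := hJ.inv.conjTranspose_mul_mul_same (mulVec_injective_of_rank_eq hG)
  rw [Matrix.conjTranspose_eq_transpose_of_trivial] at h
  exact (Matrix.isUnit_iff_isUnit_det _).1 h.isUnit

theorem mulVec_injective_of_isUnit_det (h : IsUnit (Gᵀ * M * G).det) :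
    Function.Injective G.mulVec := by
  refine Function.Injective.of_comp (f := (Gᵀ * M).mulVec) ?_
  rw [show (Gᵀ * M).mulVec ∘ G.mulVec = (Gᵀ * M * G).mulVec from
    funext fun v => Matrix.mulVec_mulVec v (Gᵀ * M) G]
  exact Matrix.mulVec_injective_of_isUnit ((Matrix.isUnit_iff_isUnit_det _).2 h)

variable {α : Type*} {l : Filter α}

theorem eventually_mulVec_injective {Gs : α → Matrix (Fin p) (Fin r) ℝ}
    (hN : IsUnit (Gᵀ * M * G).det) (hG : Tendsto Gs l (𝓝 G)) :
    ∀ᶠ a in l, Function.Injective (Gs a).mulVec := by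
  have hcont : Continuous fun G : Matrix (Fin p) (Fin r) ℝ => (Gᵀ * M * G).det := by fun_prop
  filter_upwards [((hcont.tendsto G).comp hG).eventually_ne hN.ne_zero] with a ha
  exact mulVec_injective_of_isUnit_det ha.isUnit

/-- The hypotheses say that `(y, c)` solves the bordered system `J y + G c = z`, `Gᵀ y = 0` up to
terms of smaller order than `(y, c)`. -/
theorem isLittleO_sub_mulVec_of_bordered (hJ : IsUnit J.det) (hN : IsUnit (Gᵀ * J⁻¹ * G).det)
    {y z : α → Fin p → ℝ} {c : α → Fin r → ℝ}
    (hz : (fun a => z a - J *ᵥ y a - G *ᵥ c a) =o[l] fun a => Sum.elim (y a) (c a))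
    (hy : (fun a => Gᵀ *ᵥ y a) =o[l] fun a => Sum.elim (y a) (c a)) :
    (fun a => y a - (J⁻¹ - J⁻¹ * G * (Gᵀ * J⁻¹ * G)⁻¹ * Gᵀ * J⁻¹) *ᵥ z a) =o[l] z := by
  have hzero : (fun a => Sum.elim (z a) (0 : Fin r → ℝ)) =O[l] z := by
    refine isBigO_pi.2 fun i => ?_
    cases i with
    | inl j => exact isBigO_pi.1 (isBigO_refl z l) j
    | inr j => exact isBigO_zero _ _
  have hL : (fun a => Sum.elim (z a) (0 : Fin r → ℝ) -
      Matrix.fromBlocks J G Gᵀ 0 *ᵥ Sum.elim (y a) (c a)) =o[l]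
        fun a => Sum.elim (y a) (c a) := by
    refine isLittleO_pi.2 fun i => ?_
    cases i with
    | inl j => simpa [Matrix.fromBlocks_mulVec, sub_sub] using isLittleO_pi.1 hz j
    | inr j => simpa [Matrix.fromBlocks_mulVec] using (isLittleO_pi.1 hy j).neg_left
  have hsol := (isLittleO_sub_mulVec_of_mul_eq_one (fromBlocks_mul_fromBlocks_eq_one hJ hN)
    hL).trans_isBigO hzero
  refine isLittleO_pi.2 fun j => ?_
  simpa [Matrix.fromBlocks_mulVec] using isLittleO_pi.1 hsol (Sum.inl j)

end BorderedSystem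

section GradientExpansion

open Asymptotics

variable {ι : Type*} {l : Filter ι}

theorem isLittleO_fderiv_sub {E : Type*} [NormedAddCommGroup E] [NormedSpace ℝ E]
    {φ : ι → E → ℝ} {θ : ι → E} {θ₀ : E} {U : Set E} {b : ℝ} (hU : U ∈ 𝓝 θ₀)
    (hφ : ∀ᶠ i in l, ThriceDifferentiableOn (φ i) U)
    (hb : ∀ᶠ i in l, ∀ t ∈ U, ‖fderiv ℝ (fderiv ℝ (fderiv ℝ (φ i))) t‖ ≤ b)
    (hθ : Tendsto θ l (𝓝 θ₀)) :
    (fun i => fderiv ℝ (φ i) (θ i) - fderiv ℝ (φ i) θ₀ -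
      fderiv ℝ (fderiv ℝ (φ i)) θ₀ (θ i - θ₀)) =o[l] fun i => θ i - θ₀ := by
  obtain ⟨ε, hε, hεU⟩ := Metric.mem_nhds_iff.1 hU
  have hsq : (fun i => ‖θ i - θ₀‖ ^ 2) =o[l] fun i => θ i - θ₀ := by
    have hnorm : Tendsto (fun i => ‖θ i - θ₀‖) l (𝓝 0) := by simpa using (hθ.sub_const θ₀).norm
    exact ((isLittleO_pow_id one_lt_two).comp_tendsto hnorm).of_norm_right
  refine IsBigO.trans_isLittleO (IsBigO.of_bound b ?_) hsq
  filter_upwards [hφ, hb, hθ (Metric.ball_mem_nhds θ₀ hε)] with i hφi hbi hθi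
  rw [norm_pow, norm_norm]
  exact norm_fderiv_sub_fderiv_fderiv_le (convex_ball θ₀ ε) (fun t ht => hφi t (hεU ht))
    (fun t ht => hbi t (hεU ht)) (Metric.mem_ball_self hε) hθi

variable {p : ℕ}

/-- The gradient `∂φ/∂θ` as a coordinate vector, the form in which estimating equations state it. -/
def gradVec (φ : Param p → ℝ) (θ : Param p) : Fin p → ℝ :=
  fun j => fderiv ℝ φ θ (dir j)

/-- The Hessian `∂²φ/∂θ∂θᵀ` as a matrix, the form in which it is compared with `matJ`. -/
def hessMat (φ : Param p → ℝ) (θ : Param p) : Matrix (Fin p) (Fin p) ℝ :=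
  Matrix.of fun j k => fderiv ℝ (fderiv ℝ φ) θ (dir k) (dir j)

theorem hessMat_mulVec (φ : Param p → ℝ) (θ v : Param p) (j : Fin p) :
    (hessMat φ θ *ᵥ v.ofLp) j = fderiv ℝ (fderiv ℝ φ) θ v (dir j) := by
  rw [clm_apply_eq_sum (fderiv ℝ (fderiv ℝ φ) θ) v, sum_apply]
  simp only [Matrix.mulVec, dotProduct, hessMat, Matrix.of_apply, smul_apply, smul_eq_mul, mul_comm]

theorem isLittleO_gradVec_sub {φ : ι → Param p → ℝ} {θ : ι → Param p} {θ₀ : Param p}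
    {U : Set (Param p)} {b : ℝ} {H : Matrix (Fin p) (Fin p) ℝ} (hU : U ∈ 𝓝 θ₀)
    (hφ : ∀ᶠ i in l, ThriceDifferentiableOn (φ i) U)
    (hb : ∀ᶠ i in l, ∀ t ∈ U, ‖fderiv ℝ (fderiv ℝ (fderiv ℝ (φ i))) t‖ ≤ b)
    (hH : Tendsto (fun i => hessMat (φ i) θ₀) l (𝓝 H)) (hθ : Tendsto θ l (𝓝 θ₀)) :
    (fun i => gradVec (φ i) (θ i) - gradVec (φ i) θ₀ - H *ᵥ (θ i - θ₀).ofLp) =o[l]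
      fun i => (θ i - θ₀).ofLp := by
  have htaylor : (fun i => gradVec (φ i) (θ i) - gradVec (φ i) θ₀ -
      hessMat (φ i) θ₀ *ᵥ (θ i - θ₀).ofLp) =o[l] fun i => (θ i - θ₀).ofLp := by
    refine (isLittleO_pi.2 fun j => ?_).trans_isTheta (isTheta_ofLp _).symm
    refine (((ContinuousLinearMap.apply ℝ ℝ (dir j)).isBigO_comp _ l).trans_isLittleO
      (isLittleO_fderiv_sub hU hφ hb hθ)).congr_left fun i => ?_
    rw [Pi.sub_apply, Pi.sub_apply, hessMat_mulVec]
    rfl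
  have hhess := isLittleO_mulVec_of_tendsto_zero (by simpa using hH.sub_const H)
    fun i => (θ i - θ₀).ofLp
  refine (htaylor.add hhess).congr_left fun i => ?_
  rw [Matrix.sub_mulVec, sub_add_sub_cancel]

end GradientExpansion

section LagrangeMultipliers

variable {p r : ℕ} {g : Param p → EuclideanSpace ℝ (Fin r)} {θ : Param p}

theorem matG_mulVec (c : Fin r → ℝ) (j : Fin p) :
    (matG g θ *ᵥ c) j = ∑ i, c i * fderiv ℝ g θ (dir j) i := by
  simp only [Matrix.mulVec, dotProduct, matG, Matrix.of_apply, mul_comm]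

theorem transpose_matG_mulVec (v : Param p) : (matG g θ)ᵀ *ᵥ v.ofLp = (fderiv ℝ g θ v).ofLp := by
  ext i
  rw [clm_apply_eq_sum (fderiv ℝ g θ) v]
  simp only [Matrix.mulVec, dotProduct, Matrix.transpose_apply, matG, Matrix.of_apply,
    WithLp.ofLp_sum, WithLp.ofLp_smul, Finset.sum_apply, Pi.smul_apply, smul_eq_mul, mul_comm]

theorem continuousAt_matG (hg : ContDiffAt ℝ 1 g θ) : ContinuousAt (matG g) θ := by
  have hcont : ContinuousAt (fderiv ℝ g) θ := (hg.fderiv_right (m := 0) le_rfl).continuousAt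
  refine continuousAt_pi.2 fun j => continuousAt_pi.2 fun i => ?_
  exact ((EuclideanSpace.proj i : EuclideanSpace ℝ (Fin r) →L[ℝ] ℝ).continuous.continuousAt).comp
    (hcont.clm_apply continuousAt_const)

theorem exists_gradVec_eq_matG_mulVec {φ : Param p → ℝ} {φ' : Param p →L[ℝ] ℝ}
    (hφ : HasStrictFDerivAt φ φ' θ) (hg : ContDiffAt ℝ 1 g θ)
    (hG : Function.Injective (matG g θ).mulVec) (hext : IsLocalExtrOn φ {t | g t = g θ} θ) :
    ∃ c, gradVec φ θ = matG g θ *ᵥ c := by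
  have hgi (i : Fin r) : HasStrictFDerivAt (fun t => g t i)
      ((EuclideanSpace.proj i : EuclideanSpace ℝ (Fin r) →L[ℝ] ℝ) ∘L fderiv ℝ g θ) θ :=
    (EuclideanSpace.proj i).hasStrictFDerivAt.comp θ (hg.hasStrictFDerivAt one_ne_zero)
  have hset : {t | g t = g θ} = {t | ∀ i, g t i = g θ i} := by
    ext t
    exact ⟨fun h i => congrArg (fun v => v i) h, fun h => PiLp.ext h⟩
  rw [hset] at hext
  obtain ⟨a, b, hab, hsum⟩ := hext.exists_multipliers_of_hasStrictFDerivAt hgi hφ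
  have hdir : matG g θ *ᵥ a = -b • gradVec φ θ := by
    ext j
    have hj := DFunLike.congr_fun hsum (dir j)
    simp only [add_apply, sum_apply, smul_apply, smul_eq_mul, zero_apply] at hj
    rw [matG_mulVec, Pi.smul_apply, smul_eq_mul, gradVec, hφ.hasFDerivAt.fderiv, neg_mul]
    exact eq_neg_of_add_eq_zero_left hj
  have hb : b ≠ 0 := by
    rintro rfl
    refine hab (Prod.ext (hG ?_) rfl)
    rw [hdir, neg_zero, zero_smul]
    exact (Matrix.mulVec_zero _).symm
  refine ⟨(-b)⁻¹ • a, ?_⟩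
  rw [Matrix.mulVec_smul, hdir, inv_smul_smul₀ (neg_ne_zero.2 hb)]

end LagrangeMultipliers

section SumsOfFunctions

variable {E : Type*} [NormedAddCommGroup E] [NormedSpace ℝ E] {κ : Type*} [Fintype κ]
  {F : κ → E → ℝ} {U : Set E} {θ : E}

theorem ThriceDifferentiableOn.hasStrictFDerivAt {φ : E → ℝ} (hφ : ThriceDifferentiableOn φ U)
    (hU : IsOpen U) (hθ : θ ∈ U) : HasStrictFDerivAt φ (fderiv ℝ φ θ) θ :=
  hasStrictFDerivAt_of_hasFDerivAt_of_continuousAt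
    (Filter.eventually_of_mem (hU.mem_nhds hθ) fun t ht => (hφ t ht).1.hasFDerivAt)
    (hφ θ hθ).2.1.continuousAt

theorem hasFDerivAt_of_eqOn_smul_sum {G : Type*} [NormedAddCommGroup G] [NormedSpace ℝ G]
    (hU : IsOpen U) {φ : E → G} {Φ : κ → E → G} {c : ℝ}
    (h : Set.EqOn φ (fun t => c • ∑ i, Φ i t) U) (hΦ : ∀ i, DifferentiableAt ℝ (Φ i) θ)
    (hθ : θ ∈ U) : HasFDerivAt φ (c • ∑ i, fderiv ℝ (Φ i) θ) θ :=
  ((HasFDerivAt.fun_sum fun i _ => (hΦ i).hasFDerivAt).fun_const_smul c).congr_of_eventuallyEq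
    (h.eventuallyEq_of_mem (hU.mem_nhds hθ))

variable (hF : ∀ i, ThriceDifferentiableOn (F i) U) (hU : IsOpen U) (c : ℝ)
include hF hU

theorem fderiv_smul_sum (hθ : θ ∈ U) :
    fderiv ℝ (fun t => c • ∑ i, F i t) θ = c • ∑ i, fderiv ℝ (F i) θ :=
  (hasFDerivAt_of_eqOn_smul_sum hU (Set.eqOn_refl _ _) (fun i => (hF i θ hθ).1) hθ).fderiv

theorem fderiv_fderiv_smul_sum (hθ : θ ∈ U) :
    fderiv ℝ (fderiv ℝ fun t => c • ∑ i, F i t) θ = c • ∑ i, fderiv ℝ (fderiv ℝ (F i)) θ :=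
  (hasFDerivAt_of_eqOn_smul_sum hU (fun _ ht => fderiv_smul_sum hF hU c ht)
    (fun i => (hF i θ hθ).2.1) hθ).fderiv

theorem fderiv_fderiv_fderiv_smul_sum (hθ : θ ∈ U) :
    fderiv ℝ (fderiv ℝ (fderiv ℝ fun t => c • ∑ i, F i t)) θ =
      c • ∑ i, fderiv ℝ (fderiv ℝ (fderiv ℝ (F i))) θ :=
  (hasFDerivAt_of_eqOn_smul_sum hU (fun _ ht => fderiv_fderiv_smul_sum hF hU c ht)
    (fun i => (hF i θ hθ).2.2) hθ).fderiv

theorem thriceDifferentiableOn_smul_sum : ThriceDifferentiableOn (fun t => c • ∑ i, F i t) U :=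
  fun θ hθ => ⟨(hasFDerivAt_of_eqOn_smul_sum hU (Set.eqOn_refl _ _)
      (fun i => (hF i θ hθ).1) hθ).differentiableAt,
    (hasFDerivAt_of_eqOn_smul_sum hU (fun _ ht => fderiv_smul_sum hF hU c ht)
      (fun i => (hF i θ hθ).2.1) hθ).differentiableAt,
    (hasFDerivAt_of_eqOn_smul_sum hU (fun _ ht => fderiv_fderiv_smul_sum hF hU c ht)
      (fun i => (hF i θ hθ).2.2) hθ).differentiableAt⟩

end SumsOfFunctions

section Estimators

open Asymptotics

variable {𝒳 : Type*} [MeasurableSpace 𝒳] {μ : Measure 𝒳} {p r : ℕ} {f : Param p → 𝒳 → ℝ}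
  {Θ ω : Set (Param p)} {θ₀ : Param p} {β γ : ℝ} {g : Param p → EuclideanSpace ℝ (Fin r)}

section FixedSample

variable {n : ℕ} {X : Fin n → 𝒳} {θ : Param p} (hω : IsOpen ω)
  (hself : DiffUnderIntegral μ ω fun θ x => f θ x ^ (1 + β))
  (hX : ∀ i, SmoothPosOrZeroOn (fun t => f t (X i)) ω)

theorem objective_eq_smul_sum :
    objective μ f β X = fun t => (1 / (n : ℝ)) • ∑ i, objTerm μ f β t (X i) :=
  rfl

section

include hω hself hX

theorem thriceDifferentiableOn_objective : ThriceDifferentiableOn (objective μ f β X) ω :=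
  thriceDifferentiableOn_smul_sum (fun i => thriceDifferentiableOn_objTerm hω hself (hX i)) hω _

theorem hessMat_objective (hθ : θ ∈ ω) (j k : Fin p) : hessMat (objective μ f β X) θ j k =
    (n : ℝ)⁻¹ * ∑ i, fderiv ℝ (fderiv ℝ fun t => objTerm μ f β t (X i)) θ (dir k) (dir j) := by
  rw [hessMat, Matrix.of_apply, objective_eq_smul_sum, fderiv_fderiv_smul_sum
    (fun i => thriceDifferentiableOn_objTerm hω hself (hX i)) hω _ hθ]
  simp only [smul_apply, sum_apply, smul_eq_mul, one_div]

theorem norm_fderiv_fderiv_fderiv_objective_le {M : 𝒳 → ℝ} (hθ : θ ∈ ω)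
    (hM : ∀ i, ‖fderiv ℝ (fderiv ℝ (fderiv ℝ fun t => objTerm μ f β t (X i))) θ‖ ≤ M (X i)) :
    ‖fderiv ℝ (fderiv ℝ (fderiv ℝ (objective μ f β X))) θ‖ ≤ (n : ℝ)⁻¹ * ∑ i, M (X i) := by
  rw [objective_eq_smul_sum, fderiv_fderiv_fderiv_smul_sum
    (fun i => thriceDifferentiableOn_objTerm hω hself (hX i)) hω _ hθ, norm_smul, one_div,
    Real.norm_of_nonneg (by positivity)]
  gcongr
  exact norm_sum_le_of_le _ fun i _ => hM i

end

variable (hmodel : IsModel μ f Θ) (hωΘ : ω ⊆ Θ)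
  (hn : ∀ᵐ x ∂μ, SmoothPosOrZeroOn (fun t => f t x) ω) (hn0 : n ≠ 0) (hθ : θ ∈ ω)
include hω hself hX hmodel hωΘ hn hn0 hθ

theorem gradVec_objective :
    gradVec (objective μ f β X) θ = -(1 + β) • estFun μ f β X θ := by
  ext j
  rw [gradVec, objective_eq_smul_sum, fderiv_smul_sum
    (fun i => thriceDifferentiableOn_objTerm hω hself (hX i)) hω _ hθ]
  simp only [smul_apply, sum_apply, fderiv_objTerm_dir hω hn hself hmodel hωΘ hθ j (hX _),
    ← Finset.mul_sum, Finset.sum_sub_distrib, Finset.sum_const, Finset.card_univ,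
    Fintype.card_fin, estFun, nsmul_eq_mul, Pi.smul_apply, smul_eq_mul]
  have : (n : ℝ) ≠ 0 := Nat.cast_ne_zero.2 hn0
  field_simp

theorem estFun_eq_zero_of_isMDPDE (hβ : 0 ≤ β) (hest : IsMDPDE μ f Θ β X θ) :
    estFun μ f β X θ = 0 := by
  refine hest.2.elim (fun hmin => ?_) id
  have hgrad : gradVec (objective μ f β X) θ = 0 := by
    ext j
    rw [gradVec, (hmin.isLocalMin (hmodel.isOpen.mem_nhds hest.1)).fderiv_eq_zero]
    rfl
  rw [gradVec_objective hω hself hX hmodel hωΘ hn hn0 hθ] at hgrad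
  exact (smul_eq_zero.1 hgrad).resolve_left (by linarith)

theorem exists_estFun_eq_of_isRMDPDE (hβ : 0 ≤ β) (hg : ContDiffAt ℝ 1 g θ)
    (hG : Function.Injective (matG g θ).mulVec) (hest : IsRMDPDE μ f Θ g β X θ) :
    ∃ c : Fin r → ℝ, estFun μ f β X θ = matG g θ *ᵥ c := by
  refine hest.2.elim (fun hmin => ?_) id
  have hext : IsLocalExtrOn (objective μ f β X) {t | g t = g θ} θ := by
    rw [hest.1.2]
    refine Or.inl ?_
    have hnhds : 𝓝[{t | g t = 0}] θ = 𝓝[nullSet Θ g] θ := by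
      rw [show nullSet Θ g = {t | g t = 0} ∩ Θ from Set.inter_comm _ _,
        nhdsWithin_inter_of_mem' (mem_nhdsWithin_of_mem_nhds (hmodel.isOpen.mem_nhds hest.1.1))]
    change IsMinFilter _ (𝓝[{t | g t = 0}] θ) θ
    rw [hnhds]
    exact hmin
  obtain ⟨c, hc⟩ := exists_gradVec_eq_matG_mulVec
    ((thriceDifferentiableOn_objective hω hself hX).hasStrictFDerivAt hω hθ) hg hG hext
  rw [gradVec_objective hω hself hX hmodel hωΘ hn hn0 hθ] at hc
  refine ⟨(-(1 + β))⁻¹ • c, ?_⟩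
  rw [Matrix.mulVec_smul, ← hc, inv_smul_smul₀ (by linarith)]

end FixedSample

/-- Samples of sizes `N i` whose objective functions obey, along the filter `l`, the laws of large
numbers at `θ₀`: the third derivatives are bounded and the Hessians tend to their expectation.
It separates the deterministic expansion of the estimators from the randomness of the sample. -/
structure IsRegularSample {ι : Type*} (μ : Measure 𝒳) (f : Param p → 𝒳 → ℝ) (ω : Set (Param p))
    (θ₀ : Param p) (β : ℝ) (l : Filter ι) (N : ι → ℕ) (X : ∀ i, Fin (N i) → 𝒳) : Prop where
  size_ne_zero : ∀ᶠ i in l, N i ≠ 0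
  smooth : ∀ᶠ i in l, ∀ j, SmoothPosOrZeroOn (fun t => f t (X i j)) ω
  exists_bound : ∃ b, ∀ᶠ i in l, ∀ θ ∈ ω,
    ‖fderiv ℝ (fderiv ℝ (fderiv ℝ (objective μ f β (X i)))) θ‖ ≤ b
  tendsto_hessMat :
    Tendsto (fun i => hessMat (objective μ f β (X i)) θ₀) l (𝓝 ((1 + β) • matJ μ f β θ₀))

namespace IsRegularSample

variable {ι : Type*} {l : Filter ι} {N : ι → ℕ} {X : ∀ i, Fin (N i) → 𝒳} {s t : ι → Param p}
  (hX : IsRegularSample μ f ω θ₀ β l N X) (hω : IsOpen ω) (hθ₀ : θ₀ ∈ ω)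
  (hself : DiffUnderIntegral μ ω fun θ x => f θ x ^ (1 + β)) (hmodel : IsModel μ f Θ)
  (hωΘ : ω ⊆ Θ) (hn : ∀ᵐ x ∂μ, SmoothPosOrZeroOn (fun t => f t x) ω) (hβ : 0 ≤ β)
include hX hω hθ₀ hself hmodel hωΘ hn hβ

theorem isLittleO_estFun_sub (hs : Tendsto s l (𝓝 θ₀)) :
    (fun i => estFun μ f β (X i) θ₀ - matJ μ f β θ₀ *ᵥ (s i - θ₀).ofLp - estFun μ f β (X i) (s i))
      =o[l] fun i => (s i - θ₀).ofLp := by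
  obtain ⟨b, hb⟩ := hX.exists_bound
  have hβ0 : 1 + β ≠ 0 := by linarith
  have hgrad := isLittleO_gradVec_sub (hω.mem_nhds hθ₀)
    (hX.smooth.mono fun i hi => thriceDifferentiableOn_objective hω hself hi) hb
    hX.tendsto_hessMat hs
  refine (hgrad.const_smul_left (1 + β)⁻¹).congr' ?_ EventuallyEq.rfl
  filter_upwards [hX.size_ne_zero, hX.smooth, hs (hω.mem_nhds hθ₀)] with i hNi hXi hsi
  rw [Pi.smul_apply, gradVec_objective hω hself hXi hmodel hωΘ hn hNi hsi,
    gradVec_objective hω hself hXi hmodel hωΘ hn hNi hθ₀, Matrix.smul_mulVec]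
  refine (inv_smul_eq_iff₀ hβ0).2 ?_
  module

theorem isLittleO_sub_of_estFun_eq_zero (hJ : IsUnit (matJ μ f β θ₀).det)
    (hs : Tendsto s l (𝓝 θ₀)) (h0 : ∀ᶠ i in l, estFun μ f β (X i) (s i) = 0) :
    (fun i => (s i - θ₀).ofLp - (matJ μ f β θ₀)⁻¹ *ᵥ estFun μ f β (X i) θ₀) =o[l]
      fun i => estFun μ f β (X i) θ₀ := by
  refine isLittleO_sub_mulVec_of_mul_eq_one (Matrix.nonsing_inv_mul _ hJ) ?_
  refine (hX.isLittleO_estFun_sub hω hθ₀ hself hmodel hωΘ hn hβ hs).congr' ?_ EventuallyEq.rfl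
  filter_upwards [h0] with i hi
  rw [hi, sub_zero]

theorem isLittleO_sub_of_estFun_eq_matG_mulVec (hJ : IsUnit (matJ μ f β θ₀).det)
    (hN : IsUnit ((matG g θ₀)ᵀ * (matJ μ f β θ₀)⁻¹ * matG g θ₀).det) (hg : ContDiffAt ℝ 1 g θ₀)
    (ht : Tendsto t l (𝓝 θ₀)) {c : ι → Fin r → ℝ}
    (hc : ∀ᶠ i in l, estFun μ f β (X i) (t i) = matG g (t i) *ᵥ c i)
    (hgt : ∀ᶠ i in l, g (t i) = g θ₀) :
    (fun i => (t i - θ₀).ofLp - ((matJ μ f β θ₀)⁻¹ - matB μ f g β θ₀) *ᵥ estFun μ f β (X i) θ₀)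
      =o[l] fun i => estFun μ f β (X i) θ₀ := by
  have hinl : (fun i => (t i - θ₀).ofLp) =O[l] fun i => Sum.elim (t i - θ₀).ofLp (c i) :=
    isBigO_pi.2 fun j =>
      isBigO_pi.1 (isBigO_refl (fun i => Sum.elim (t i - θ₀).ofLp (c i)) l) (Sum.inl j)
  have hinr : c =O[l] fun i => Sum.elim (t i - θ₀).ofLp (c i) :=
    isBigO_pi.2 fun j =>
      isBigO_pi.1 (isBigO_refl (fun i => Sum.elim (t i - θ₀).ofLp (c i)) l) (Sum.inr j)
  refine isLittleO_sub_mulVec_of_bordered (c := c) hJ hN ?_ ?_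
  · have hG : Tendsto (fun i => matG g (t i) - matG g θ₀) l (𝓝 0) := by
      simpa using ((continuousAt_matG hg).tendsto.comp ht).sub_const (matG g θ₀)
    refine (((hX.isLittleO_estFun_sub hω hθ₀ hself hmodel hωΘ hn hβ ht).trans_isBigO hinl).add
      ((isLittleO_mulVec_of_tendsto_zero hG c).trans_isBigO hinr)).congr' ?_ EventuallyEq.rfl
    filter_upwards [hc] with i hi
    rw [hi, Matrix.sub_mulVec]
    abel
  · have hdiff := (hg.differentiableAt one_ne_zero).hasFDerivAt.isLittleO.comp_tendsto ht
    refine IsLittleO.trans_isBigO ?_ hinl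
    refine ((((isTheta_ofLp _).trans_isLittleO hdiff).trans_isTheta
      (isTheta_ofLp _).symm).neg_left).congr' ?_ EventuallyEq.rfl
    filter_upwards [hgt] with i hi
    rw [transpose_matG_mulVec]
    simp [hi]

theorem isLittleO_sub_of_isMDPDE_of_isRMDPDE (hJ : (matJ μ f β θ₀).PosDef)
    (hrank : (matG g θ₀).rank = r) (hg : ContDiffAt ℝ 1 g θ₀) (hg0 : g θ₀ = 0)
    (hs : Tendsto s l (𝓝 θ₀)) (ht : Tendsto t l (𝓝 θ₀))
    (hsE : ∀ᶠ i in l, IsMDPDE μ f Θ β (X i) (s i))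
    (htE : ∀ᶠ i in l, IsRMDPDE μ f Θ g β (X i) (t i)) :
    (fun i => (t i - s i).ofLp - -(matB μ f g β θ₀ *ᵥ estFun μ f β (X i) θ₀)) =o[l]
      fun i => estFun μ f β (X i) θ₀ := by
  have hN := isUnit_det_transpose_mul_inv_mul hJ hrank
  have hJdet : IsUnit (matJ μ f β θ₀).det := (Matrix.isUnit_iff_isUnit_det _).1 hJ.isUnit
  have hs0 : ∀ᶠ i in l, estFun μ f β (X i) (s i) = 0 := by
    filter_upwards [hX.size_ne_zero, hX.smooth, hs (hω.mem_nhds hθ₀), hsE] with i hNi hXi hi hEi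
    exact estFun_eq_zero_of_isMDPDE hω hself hXi hmodel hωΘ hn hNi hi hβ hEi
  have ht0 : ∀ᶠ i in l, ∃ c : Fin r → ℝ, estFun μ f β (X i) (t i) = matG g (t i) *ᵥ c := by
    filter_upwards [hX.size_ne_zero, hX.smooth, ht (hω.mem_nhds hθ₀), htE,
      ht.eventually (hg.eventually (by simp)),
      eventually_mulVec_injective hN ((continuousAt_matG hg).tendsto.comp ht)]
      with i hNi hXi hi hEi hgi hGi
    exact exists_estFun_eq_of_isRMDPDE hω hself hXi hmodel hωΘ hn hNi hi hβ hgi hGi hEi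
  obtain ⟨c, hc⟩ := Filter.skolem.1 ht0
  have hgt : ∀ᶠ i in l, g (t i) = g θ₀ := htE.mono fun i hi => hi.1.2.trans hg0.symm
  refine ((hX.isLittleO_sub_of_estFun_eq_matG_mulVec hω hθ₀ hself hmodel hωΘ hn hβ hJdet hN hg
    ht hc hgt).sub (hX.isLittleO_sub_of_estFun_eq_zero hω hθ₀ hself hmodel hωΘ hn hβ hJdet hs
    hs0)).congr_left fun i => ?_
  rw [Matrix.sub_mulVec, WithLp.ofLp_sub, WithLp.ofLp_sub, WithLp.ofLp_sub]
  abel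

theorem isLittleO_divergence_sub_quadraticForm (hJ : (matJ μ f β θ₀).PosDef)
    (hrank : (matG g θ₀).rank = r) (hg : ContDiffAt ℝ 1 g θ₀) (hg0 : g θ₀ = 0) (hγ : 0 ≤ γ)
    (hB : BasuConditions μ f ω ω θ₀ γ) (hs : Tendsto s l (𝓝 θ₀)) (ht : Tendsto t l (𝓝 θ₀))
    (hsE : ∀ᶠ i in l, IsMDPDE μ f Θ β (X i) (s i))
    (htE : ∀ᶠ i in l, IsRMDPDE μ f Θ g β (X i) (t i)) :
    (fun i => 2 * divergence μ γ (f (s i)) (f (t i)) -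
        (matB μ f g β θ₀ *ᵥ estFun μ f β (X i) θ₀) ⬝ᵥ
          matA μ f γ θ₀ *ᵥ matB μ f g β θ₀ *ᵥ estFun μ f β (X i) θ₀)
      =o[l] fun i => ‖estFun μ f β (X i) θ₀‖ ^ 2 := by
  have hst := hX.isLittleO_sub_of_isMDPDE_of_isRMDPDE hω hθ₀ hself hmodel hωΘ hn hβ hJ hrank hg hg0
    hs ht hsE htE
  have hBz := isBigO_mulVec (l := l) (matB μ f g β θ₀) fun i => estFun μ f β (X i) θ₀
  have hstO : (fun i => t i - s i) =O[l] fun i => estFun μ f β (X i) θ₀ :=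
    (isTheta_ofLp _).symm.trans_isBigO
      ((hst.isBigO.add hBz.neg_left).congr_left fun i => sub_add_cancel _ _)
  refine ((((DPD.isLittleO_divergence_sub_quadraticForm hmodel hω hωΘ hγ hB hθ₀).comp_tendsto
    (hs.prodMk_nhds ht)).trans_isBigO (hstO.norm_norm.pow 2)).add
    (isLittleO_quadraticForm_sub (matA μ f γ θ₀) hBz.neg_left hst)).congr_left fun i => ?_
  simp only [Function.comp_apply, Matrix.mulVec_neg, neg_dotProduct_neg, sub_add_sub_cancel]

end IsRegularSample

end Estimators

section RegularModel

variable {𝒳 : Type*} [MeasurableSpace 𝒳] {μ : Measure 𝒳} {p : ℕ} {f : Param p → 𝒳 → ℝ}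
  {Θ ω : Set (Param p)} {θ₀ : Param p} {β : ℝ}

/-- The assumptions at the null parameter `θ₀` under which both estimators with tuning parameter `β`
are asymptotically linear and the likelihood ratios are asymptotically normal. -/
structure IsRegularModel (μ : Measure 𝒳) (f : Param p → 𝒳 → ℝ) (Θ ω : Set (Param p))
    (θ₀ : Param p) (β : ℝ) : Prop where
  isModel : IsModel μ f Θ
  isOpen : IsOpen ω
  subset : ω ⊆ Θ
  mem : θ₀ ∈ ω
  nonneg : 0 ≤ β
  lehmann : LehmannConditions μ f ω θ₀
  basu : BasuConditions μ f ω {θ₀} θ₀ β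
  integrable_sq : ∀ j k,
    Integrable (fun x => score f θ₀ x j * score f θ₀ x k * f θ₀ x ^ (1 + 2 * β)) μ

theorem integral_sum_sum {ι κ : Type*} [Fintype ι] [Fintype κ] {q : ι → κ → 𝒳 → ℝ}
    (hq : ∀ i j, Integrable (q i j) μ) :
    ∫ x, ∑ i, ∑ j, q i j x ∂μ = ∑ i, ∑ j, ∫ x, q i j x ∂μ := by
  rw [integral_finsetSum _ fun i _ => integrable_finsetSum _ fun j _ => hq i j]
  exact Finset.sum_congr rfl fun i _ => integral_finsetSum _ fun j _ => hq i j

theorem rpow_one_add_two_mul {x : ℝ} (hx : 0 ≤ x) (hβ : 0 ≤ β) :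
    x ^ (1 + 2 * β) = x * (x ^ β * x ^ β) := by
  rw [Real.rpow_one_add' hx (by positivity), two_mul, Real.rpow_add_of_nonneg hx hβ hβ]

theorem LehmannConditions.memLp_score (h : LehmannConditions μ f ω θ₀) (j : Fin p) :
    MemLp (fun x => score f θ₀ x j) 2 (law μ f θ₀) := by
  refine (memLp_two_iff_integrable_sq (h.score_mean j).1.aestronglyMeasurable).2 ?_
  simpa only [sq] using h.info_integrable j j

theorem LehmannConditions.integrable_fderiv_fderiv_log_dir (h : LehmannConditions μ f ω θ₀)
    (j k : Fin p) :
    Integrable (fun x => fderiv ℝ (fderiv ℝ fun t => Real.log (f t x)) θ₀ (dir j) (dir k))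
      (law μ f θ₀) := by
  simpa [iteratedFDeriv_two_apply] using (h.info_identity j k).1

theorem LehmannConditions.integral_fderiv_fderiv_log_dir (h : LehmannConditions μ f ω θ₀)
    (j k : Fin p) :
    ∫ x, fderiv ℝ (fderiv ℝ fun t => Real.log (f t x)) θ₀ (dir j) (dir k) ∂(law μ f θ₀) =
      -∫ x, score f θ₀ x j * score f θ₀ x k ∂(law μ f θ₀) := by
  rw [← (h.info_identity j k).2, integral_neg, neg_neg]
  simp [iteratedFDeriv_two_apply]

theorem LehmannConditions.integrable_fderiv_fderiv_log (h : LehmannConditions μ f ω θ₀)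
    (u v : Param p) :
    Integrable (fun x => fderiv ℝ (fderiv ℝ fun t => Real.log (f t x)) θ₀ u v) (law μ f θ₀) := by
  simp only [bilinear_eq_sum _ u v]
  exact integrable_finsetSum _ fun j _ => integrable_finsetSum _ fun k _ =>
    (h.integrable_fderiv_fderiv_log_dir j k).const_mul _

theorem LehmannConditions.integral_fderiv_fderiv_log (h : LehmannConditions μ f ω θ₀)
    (u v : Param p) :
    ∫ x, fderiv ℝ (fderiv ℝ fun t => Real.log (f t x)) θ₀ u v ∂(law μ f θ₀) =
      -∫ x, (∑ j, u j * score f θ₀ x j) * ∑ k, v k * score f θ₀ x k ∂(law μ f θ₀) := by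
  have hprod (x : 𝒳) : (∑ j, u j * score f θ₀ x j) * ∑ k, v k * score f θ₀ x k =
      ∑ j, ∑ k, u j * v k * (score f θ₀ x j * score f θ₀ x k) := by
    simp only [Finset.sum_mul_sum, mul_mul_mul_comm]
  simp only [bilinear_eq_sum _ u v, hprod]
  rw [integral_sum_sum fun j k => (h.integrable_fderiv_fderiv_log_dir j k).const_mul _,
    integral_sum_sum fun j k => (h.info_integrable j k).const_mul _]
  simp only [integral_const_mul, h.integral_fderiv_fderiv_log_dir, mul_neg,
    Finset.sum_neg_distrib]

namespace IsRegularModel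

theorem isProbabilityMeasure_law (h : IsRegularModel μ f Θ ω θ₀ β) :
    IsProbabilityMeasure (law μ f θ₀) :=
  h.isModel.isProbabilityMeasure_law (h.subset h.mem)

theorem ae_smoothPosOrZeroOn (h : IsRegularModel μ f Θ ω θ₀ β) :
    ∀ᵐ x ∂μ, SmoothPosOrZeroOn (fun t => f t x) ω :=
  h.isModel.ae_smoothPosOrZeroOn h.subset h.basu.smooth

end IsRegularModel

/-- The observation vector. Its entries indexed by `some j` are the contributions of one observation
to the estimating function at `θ₀`, and its entry indexed by `none` is the directional score that
drives the likelihood ratios of the alternatives `localAlt θ₀ d`. -/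
def obsVec (μ : Measure 𝒳) (f : Param p → 𝒳 → ℝ) (β : ℝ) (θ₀ d : Param p) :
    Option (Fin p) → 𝒳 → ℝ
  | some j => fun x => score f θ₀ x j * f θ₀ x ^ β - vecXi μ f β θ₀ j
  | none => fun x => ∑ j, d j * score f θ₀ x j

theorem obsVec_none_apply (d : Param p) (x : 𝒳) :
    obsVec μ f β θ₀ d none x = fderiv ℝ (fun t => Real.log (f t x)) θ₀ d := by
  rw [clm_apply_eq_sum]
  rfl

namespace IsRegularModel

variable (h : IsRegularModel μ f Θ ω θ₀ β)
include h

theorem memLp_score_mul_rpow (j : Fin p) :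
    MemLp (fun x => score f θ₀ x j * f θ₀ x ^ β) 2 (law μ f θ₀) := by
  have hprob := h.isProbabilityMeasure_law
  have hcenter := integrable_score_sub_vecXi h.isOpen h.ae_smoothPosOrZeroOn h.basu.diff_self
    h.nonneg h.isModel h.subset h.mem j
  have hmeas : AEStronglyMeasurable (fun x => score f θ₀ x j * f θ₀ x ^ β) (law μ f θ₀) := by
    refine (hcenter.add (integrable_const (vecXi μ f β θ₀ j))).aestronglyMeasurable.congr ?_
    exact ae_of_all _ fun x => sub_add_cancel _ _
  refine (memLp_two_iff_integrable_sq hmeas).2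
    ((h.isModel.integrable_law_iff (h.subset h.mem)).2 ?_)
  refine (h.integrable_sq j j).congr (ae_of_all _ fun x => ?_)
  simp only [rpow_one_add_two_mul (h.isModel.nonneg _ (h.subset h.mem) x) h.nonneg]
  ring

theorem memLp_obsVec (d : Param p) (o : Option (Fin p)) :
    MemLp (obsVec μ f β θ₀ d o) 2 (law μ f θ₀) := by
  have hprob := h.isProbabilityMeasure_law
  cases o with
  | none => exact memLp_finsetSum Finset.univ fun j _ => (h.lehmann.memLp_score j).const_mul (d j)
  | some j => exact (h.memLp_score_mul_rpow j).sub (memLp_const _)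

theorem integral_score_mul_rpow (j : Fin p) :
    ∫ x, score f θ₀ x j * f θ₀ x ^ β ∂(law μ f θ₀) = vecXi μ f β θ₀ j := by
  have hβ := h.nonneg
  rw [h.isModel.integral_law (h.subset h.mem), vecXi]
  congr! 2 with x
  rw [Real.rpow_one_add' (h.isModel.nonneg _ (h.subset h.mem) x) (by positivity)]
  ring

theorem integral_obsVec (d : Param p) (o : Option (Fin p)) :
    ∫ x, obsVec μ f β θ₀ d o x ∂(law μ f θ₀) = 0 := by
  cases o with
  | none =>
    simp only [obsVec]
    rw [integral_finsetSum _ fun j _ => (h.lehmann.score_mean j).1.const_mul _]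
    simp [integral_const_mul, (h.lehmann.score_mean _).2]
  | some j =>
    exact integral_score_sub_vecXi h.isOpen h.ae_smoothPosOrZeroOn h.basu.diff_self h.nonneg
      h.isModel h.subset h.mem j

theorem momentMatrix_obsVec_some_some (d : Param p) (j k : Fin p) :
    momentMatrix (law μ f θ₀) (obsVec μ f β θ₀ d) (some j) (some k) = matK μ f β θ₀ j k := by
  have hprob := h.isProbabilityMeasure_law
  calc momentMatrix (law μ f θ₀) (obsVec μ f β θ₀ d) (some j) (some k)
      = cov[fun x => score f θ₀ x j * f θ₀ x ^ β, fun x => score f θ₀ x k * f θ₀ x ^ β;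
          law μ f θ₀] := by
        simp only [covariance, h.integral_score_mul_rpow]
        rfl
    _ = ∫ x, score f θ₀ x j * score f θ₀ x k * f θ₀ x ^ (1 + 2 * β) ∂μ -
          vecXi μ f β θ₀ j * vecXi μ f β θ₀ k := by
        rw [covariance_eq_sub (h.memLp_score_mul_rpow j) (h.memLp_score_mul_rpow k),
          h.integral_score_mul_rpow, h.integral_score_mul_rpow,
          h.isModel.integral_law (h.subset h.mem)]
        congr! 3 with x
        rw [rpow_one_add_two_mul (h.isModel.nonneg _ (h.subset h.mem) x) h.nonneg, Pi.mul_apply]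
        ring
    _ = matK μ f β θ₀ j k := rfl

theorem momentMatrix_obsVec_some_none (d : Param p) (j : Fin p) :
    momentMatrix (law μ f θ₀) (obsVec μ f β θ₀ d) (some j) none =
      (matJ μ f β θ₀ *ᵥ d.ofLp) j := by
  have hprob := h.isProbabilityMeasure_law
  have hcov (k : Fin p) : cov[fun x => score f θ₀ x j * f θ₀ x ^ β, fun x => score f θ₀ x k;
      law μ f θ₀] = matJ μ f β θ₀ j k := by
    rw [covariance_eq_sub (h.memLp_score_mul_rpow j) (h.lehmann.memLp_score k),
      (h.lehmann.score_mean k).2, mul_zero, sub_zero, h.isModel.integral_law (h.subset h.mem),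
      matJ, Matrix.of_apply]
    have hβ := h.nonneg
    congr! 2 with x
    rw [Real.rpow_one_add' (h.isModel.nonneg _ (h.subset h.mem) x) (by positivity)]
    simp only [Pi.mul_apply]
    ring
  calc momentMatrix (law μ f θ₀) (obsVec μ f β θ₀ d) (some j) none
      = cov[fun x => score f θ₀ x j * f θ₀ x ^ β, fun x => ∑ k, d k * score f θ₀ x k;
          law μ f θ₀] := by
        have hnone : ∫ x, ∑ k, d k * score f θ₀ x k ∂(law μ f θ₀) = 0 := h.integral_obsVec d none
        simp only [covariance, h.integral_score_mul_rpow, hnone, sub_zero]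
        rfl
    _ = ∑ k, matJ μ f β θ₀ j k * d k := by
        rw [covariance_fun_sum_right (fun k => (h.lehmann.memLp_score k).const_mul (d k))
          (h.memLp_score_mul_rpow j)]
        exact Finset.sum_congr rfl fun k _ => by rw [covariance_const_mul_right, hcov, mul_comm]
    _ = (matJ μ f β θ₀ *ᵥ d.ofLp) j := rfl

end IsRegularModel

end RegularModel

section RandomSamples

variable {𝒳 : Type*} [MeasurableSpace 𝒳]

theorem tendsto_sampleMean_whp {ν : Measure 𝒳} [IsProbabilityMeasure ν] {ψ : 𝒳 → ℝ}
    (hψ : Integrable ψ ν) :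
    Tendsto (fun a => (a.1 : ℝ)⁻¹ * ∑ i, ψ (firstObs a.1 a.2 i)) (whp (seqLaw ν))
      (𝓝 (∫ x, ψ x ∂ν)) := by
  have hmeas (n : ℕ) : AEStronglyMeasurable
      (fun s : ℕ → 𝒳 => (n : ℝ)⁻¹ * ∑ i ∈ Finset.range n, ψ (s i)) (seqLaw ν) :=
    (Finset.aestronglyMeasurable_fun_sum _ fun i _ =>
      hψ.aestronglyMeasurable.comp_measurePreserving (measurePreserving_obs i)).const_mul _
  have hlim : TendstoInMeasure (seqLaw ν)
      (fun (n : ℕ) s => (n : ℝ)⁻¹ * ∑ i ∈ Finset.range n, ψ (s i)) atTop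
      fun _ => ∫ x, ψ x ∂ν :=
    tendstoInMeasure_of_tendsto_ae hmeas (ae_tendsto_sampleMean hψ)
  simpa only [sum_firstObs] using tendsto_whp_of_tendstoInMeasure hlim

theorem eventually_whp_firstObs {ν : Measure 𝒳} [IsProbabilityMeasure ν]
    {E : ∀ n : ℕ, (Fin n → 𝒳) → Prop}
    (h : Tendsto (fun n => (Measure.pi fun _ : Fin n => ν) {X | ¬ E n X}) atTop (𝓝 0)) :
    ∀ᶠ a in whp (seqLaw ν), E a.1 (firstObs a.1 a.2) := by
  refine eventually_whp.2 (tendsto_of_tendsto_of_tendsto_of_le_of_le tendsto_const_nhds h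
    (fun n => zero_le) fun n => ?_)
  rw [← map_firstObs n]
  exact Measure.le_map_apply (measurable_firstObs n).aemeasurable _

theorem integrable_norm_normSum_sq {ν : Measure 𝒳} [IsProbabilityMeasure ν] {ι : Type*} [Fintype ι]
    {ψ : ι → 𝒳 → ℝ} (hψ : ∀ j, MemLp (ψ j) 2 ν) (n : ℕ) :
    Integrable (fun s => ‖normSum ψ n s‖ ^ 2) (seqLaw ν) := by
  simp only [EuclideanSpace.norm_sq_eq, normSum, Real.norm_eq_abs, sq_abs]
  exact integrable_finsetSum _ fun j _ => ((memLp_sum_obs (hψ j) n).const_mul _).integrable_sq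

theorem integral_norm_normSum_sq_le {ν : Measure 𝒳} [IsProbabilityMeasure ν] {ι : Type*} [Fintype ι]
    {ψ : ι → 𝒳 → ℝ} (hψ : ∀ j, MemLp (ψ j) 2 ν) (h0 : ∀ j, ∫ x, ψ j x ∂ν = 0) (n : ℕ) :
    ∫ s, ‖normSum ψ n s‖ ^ 2 ∂(seqLaw ν) ≤ ∑ j, ∫ x, ψ j x ^ 2 ∂ν := by
  simp only [EuclideanSpace.norm_sq_eq, normSum, norm_mul, mul_pow, Real.norm_eq_abs, sq_abs]
  rw [integral_finsetSum _ fun j _ => ((memLp_sum_obs (hψ j) n).integrable_sq).const_mul _]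
  refine Finset.sum_le_sum fun j _ => ?_
  rw [integral_const_mul, integral_sq_sum_obs (hψ j) (h0 j), inv_pow, Real.sq_sqrt n.cast_nonneg,
    ← mul_assoc]
  exact mul_le_of_le_one_left (integral_nonneg fun x => sq_nonneg _) inv_mul_le_one

end RandomSamples

section RandomEstimators

variable {𝒳 : Type*} [MeasurableSpace 𝒳] {μ : Measure 𝒳} {p : ℕ} {f : Param p → 𝒳 → ℝ}
  {Θ ω : Set (Param p)} {θ₀ : Param p} {β : ℝ}

namespace IsConsistentSolution

variable {E : ∀ n : ℕ, (Fin n → 𝒳) → Param p → Prop} {est : ∀ n : ℕ, (Fin n → 𝒳) → Param p}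
  [IsProbabilityMeasure (law μ f θ₀)]

theorem eventually_whp (h : IsConsistentSolution μ f θ₀ E est) :
    ∀ᶠ a in whp (seqLaw (law μ f θ₀)), E a.1 (firstObs a.1 a.2) (est a.1 (firstObs a.1 a.2)) :=
  eventually_whp_firstObs (E := fun n X => E n X (est n X)) h.2.1

theorem tendsto_whp (h : IsConsistentSolution μ f θ₀ E est) :
    Tendsto (fun a => est a.1 (firstObs a.1 a.2)) (whp (seqLaw (law μ f θ₀))) (𝓝 θ₀) := by
  refine Metric.tendsto_nhds.2 fun ε hε =>
    eventually_whp_firstObs (E := fun n X => dist (est n X) θ₀ < ε) ?_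
  simpa only [not_lt, sampleLaw] using h.2.2 ε hε

end IsConsistentSolution

theorem ae_law_of_ae {q : 𝒳 → Prop} {θ : Param p} (h : ∀ᵐ x ∂μ, q x) : ∀ᵐ x ∂(law μ f θ), q x :=
  (withDensity_absolutelyContinuous _ _).ae_le h

theorem normSum_obsVec_some (d : Param p) (n : ℕ) (s : ℕ → 𝒳) :
    (fun j => normSum (obsVec μ f β θ₀ d) n s (some j)) =
      √(n : ℝ) • estFun μ f β (firstObs n s) θ₀ := by
  ext j
  have hsqrt : √(n : ℝ) * (1 / (n : ℝ)) = (√(n : ℝ))⁻¹ := by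
    rw [mul_one_div, Real.sqrt_div_self]
  have hsqrt' : (√(n : ℝ))⁻¹ * n = √(n : ℝ) := by
    rw [inv_mul_eq_div, Real.div_sqrt]
  simp only [normSum, obsVec, estFun, Pi.smul_apply, smul_eq_mul, Finset.sum_sub_distrib,
    Finset.sum_const, Finset.card_range, nsmul_eq_mul,
    sum_firstObs n s fun x => score f θ₀ x j * f θ₀ x ^ β]
  rw [mul_sub, mul_sub, ← mul_assoc √(n : ℝ), hsqrt, ← mul_assoc _ (n : ℝ), hsqrt']

theorem IsRegularModel.isRegularSample_whp (h : IsRegularModel μ f Θ ω θ₀ β)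
    [IsProbabilityMeasure (law μ f θ₀)] :
    IsRegularSample μ f ω θ₀ β (whp (seqLaw (law μ f θ₀))) Prod.fst
      fun a => firstObs a.1 a.2 := by
  obtain ⟨M, m, hM, hm⟩ := h.basu.third_deriv.exists_norm_le
  have hself := h.basu.diff_self
  have hsmooth : ∀ᶠ a in whp (seqLaw (law μ f θ₀)), ∀ j,
      SmoothPosOrZeroOn (fun t => f t (firstObs a.1 a.2 j)) ω :=
    (tendsto_snd_whp.eventually (ae_obs (ae_law_of_ae h.ae_smoothPosOrZeroOn))).mono
      fun a ha j => ha j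
  refine ⟨tendsto_fst_whp.eventually_ne_atTop 0, hsmooth, ⟨∫ x, M x ∂(law μ f θ₀) + 1, ?_⟩, ?_⟩
  · filter_upwards [hsmooth, tendsto_snd_whp.eventually (ae_obs (ae_law_of_ae hM)),
      (tendsto_sampleMean_whp (hm θ₀ rfl).1).eventually_le_const (lt_add_one _)]
      with a ha hMa hmean θ hθ
    exact (norm_fderiv_fderiv_fderiv_objective_le h.isOpen hself ha hθ
      fun i => hMa i θ hθ).trans hmean
  · refine tendsto_pi_nhds.2 fun j => tendsto_pi_nhds.2 fun k => ?_
    have hmean := tendsto_sampleMean_whp (integrable_fderiv_fderiv_objTerm h.isOpen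
      h.ae_smoothPosOrZeroOn hself h.nonneg h.isModel h.subset h.mem
      (h.basu.J_integrable θ₀ rfl k j))
    rw [integral_fderiv_fderiv_objTerm h.isOpen
      h.ae_smoothPosOrZeroOn hself h.nonneg h.isModel h.subset h.mem
      (h.basu.J_integrable θ₀ rfl k j)] at hmean
    have hsymm : (1 + β) * matJ μ f β θ₀ k j = ((1 + β) • matJ μ f β θ₀) j k := by
      simp only [matJ, Matrix.smul_apply, Matrix.of_apply, smul_eq_mul, mul_comm (score f θ₀ _ k)]
    rw [hsymm] at hmean
    refine hmean.congr' ?_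
    filter_upwards [hsmooth] with a ha
    exact (hessMat_objective h.isOpen hself ha h.mem j k).symm

end RandomEstimators

section LikelihoodRatio

variable {𝒳 : Type*} [MeasurableSpace 𝒳] {μ : Measure 𝒳} {p : ℕ} {f : Param p → 𝒳 → ℝ}
  {Θ ω : Set (Param p)} {θ₀ : Param p} {β : ℝ} {n : ℕ}

/-- The log-likelihood ratio of `θ` against `θ₀` at the sample `X`. It vanishes outside the common
support, where the logarithms take the junk value zero. -/
def logRatio (f : Param p → 𝒳 → ℝ) (θ₀ θ : Param p) (X : Fin n → 𝒳) : ℝ :=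
  ∑ i, (Real.log (f θ (X i)) - Real.log (f θ₀ (X i)))

theorem measurable_logRatio (hmodel : IsModel μ f Θ) (θ₀ θ : Param p) :
    Measurable (logRatio f θ₀ θ (n := n)) := by
  have hθ := hmodel.measurable_density θ
  have hθ₀ := hmodel.measurable_density θ₀
  unfold logRatio
  fun_prop

theorem law_eq_withDensity (hmodel : IsModel μ f Θ) {θ θ' : Param p} (hθ : θ ∈ Θ) (hθ' : θ' ∈ Θ) :
    law μ f θ' = (law μ f θ).withDensity fun x =>
      ENNReal.ofReal (Real.exp (Real.log (f θ' x) - Real.log (f θ x))) := by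
  have hm := hmodel.measurable_density θ
  have hm' := hmodel.measurable_density θ'
  rw [law, law, ← withDensity_mul _ hm.ennreal_ofReal (by fun_prop)]
  congr 1
  ext x
  rw [Pi.mul_apply, ← ENNReal.ofReal_mul (hmodel.nonneg θ hθ x)]
  congr 1
  rcases hmodel.pos_or_zero x with hpos | hzero
  · rw [Real.exp_sub, Real.exp_log (hpos _ hθ'), Real.exp_log (hpos _ hθ),
      mul_div_cancel₀ _ (hpos _ hθ).ne']
  · rw [hzero _ hθ, hzero _ hθ', zero_mul]

theorem sampleLaw_eq_withDensity (hmodel : IsModel μ f Θ) {θ θ' : Param p} (hθ : θ ∈ Θ)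
    (hθ' : θ' ∈ Θ) (n : ℕ) :
    sampleLaw μ f n θ' =
      (sampleLaw μ f n θ).withDensity fun X => ENNReal.ofReal (Real.exp (logRatio f θ θ' X)) := by
  have := hmodel.isProbabilityMeasure_law hθ
  have := hmodel.isProbabilityMeasure_law hθ'
  have hm := hmodel.measurable_density θ
  have hm' := hmodel.measurable_density θ'
  have hlaw := law_eq_withDensity hmodel hθ hθ'
  have : IsProbabilityMeasure ((law μ f θ).withDensity fun x =>
      ENNReal.ofReal (Real.exp (Real.log (f θ' x) - Real.log (f θ x)))) := hlaw ▸ this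
  rw [sampleLaw, sampleLaw, hlaw, pi_withDensity (fun _ : Fin n => law μ f θ)
    (g := fun _ x => ENNReal.ofReal (Real.exp (Real.log (f θ' x) - Real.log (f θ x))))
    fun _ => by fun_prop]
  congr 1
  ext X
  rw [← ENNReal.ofReal_prod_of_nonneg fun i _ => (Real.exp_pos _).le, ← Real.exp_sum, logRatio]

theorem integral_sampleLaw_eq_integral_mul_exp (hmodel : IsModel μ f Θ) {θ θ' : Param p}
    (hθ : θ ∈ Θ) (hθ' : θ' ∈ Θ) [IsProbabilityMeasure (law μ f θ)] {q : (Fin n → 𝒳) → ℝ}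
    (hq : Measurable q) :
    ∫ X, q X ∂(sampleLaw μ f n θ') =
      ∫ s, q (firstObs n s) * Real.exp (logRatio f θ θ' (firstObs n s))
        ∂(seqLaw (law μ f θ)) := by
  have hratio := measurable_logRatio (n := n) hmodel θ θ'
  rw [sampleLaw_eq_withDensity hmodel hθ hθ', integral_withDensity_exp hratio, sampleLaw,
    ← map_firstObs]
  exact integral_map (measurable_firstObs n).aemeasurable (hq.mul hratio.exp).aestronglyMeasurable

theorem integral_exp_logRatio (hmodel : IsModel μ f Θ) {θ θ' : Param p} (hθ : θ ∈ Θ)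
    (hθ' : θ' ∈ Θ) [IsProbabilityMeasure (law μ f θ)] (n : ℕ) :
    ∫ s, Real.exp (logRatio f θ θ' (firstObs n s)) ∂(seqLaw (law μ f θ)) = 1 := by
  have := hmodel.isProbabilityMeasure_law hθ'
  simpa [sampleLaw] using
    (integral_sampleLaw_eq_integral_mul_exp hmodel hθ hθ' (n := n) (q := fun _ => 1)
      measurable_const).symm

end LikelihoodRatio

section LocalAlternatives

variable {p : ℕ} {θ₀ d : Param p}

theorem localAlt_eq_add_inv_sqrt_smul (θ₀ d : Param p) (n : ℕ) :
    localAlt θ₀ d n = θ₀ + (√(n : ℝ))⁻¹ • d := by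
  rw [localAlt, Real.rpow_neg n.cast_nonneg, ← Real.sqrt_eq_rpow]

theorem tendsto_inv_sqrt_natCast : Tendsto (fun n : ℕ => (√(n : ℝ))⁻¹) atTop (𝓝 0) :=
  tendsto_inv_atTop_zero.comp (Real.tendsto_sqrt_atTop.comp tendsto_natCast_atTop_atTop)

theorem tendsto_localAlt (θ₀ d : Param p) : Tendsto (localAlt θ₀ d) atTop (𝓝 θ₀) := by
  have h := (tendsto_inv_sqrt_natCast.smul_const d).const_add θ₀
  rw [zero_smul, add_zero] at h
  exact h.congr fun n => (localAlt_eq_add_inv_sqrt_smul θ₀ d n).symm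

theorem abs_logRatio_sub_taylor_le {𝒳 : Type*} {f : Param p → 𝒳 → ℝ} {U : Set (Param p)}
    (hU : IsOpen U) (hc : Convex ℝ U) {n : ℕ} {X : Fin n → 𝒳}
    (hX : ∀ i, ThriceDifferentiableOn (fun t => Real.log (f t (X i))) U) {M : 𝒳 → ℝ}
    (hM : ∀ i, ∀ θ ∈ U,
      ‖fderiv ℝ (fderiv ℝ (fderiv ℝ fun t => Real.log (f t (X i)))) θ‖ ≤ M (X i))
    (hθ₀ : θ₀ ∈ U) {ε : ℝ} (hθ : θ₀ + ε • d ∈ U) :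
    |logRatio f θ₀ (θ₀ + ε • d) X - ε * ∑ i, fderiv ℝ (fun t => Real.log (f t (X i))) θ₀ d -
        1 / 2 * (ε ^ 2 * ∑ i, fderiv ℝ (fderiv ℝ fun t => Real.log (f t (X i))) θ₀ d d)| ≤
      |ε| ^ 3 * ‖d‖ ^ 3 * ∑ i, M (X i) := by
  simp only [logRatio, Finset.mul_sum, ← Finset.sum_sub_distrib]
  refine (Finset.abs_sum_le_sum_abs _ _).trans (Finset.sum_le_sum fun i _ => ?_)
  have htaylor := abs_sub_taylor_le hU hc (hX i) (hM i) hθ₀ hθ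
  simp only [add_sub_cancel_left, map_smul, smul_apply, smul_eq_mul, norm_smul, mul_pow,
    Real.norm_eq_abs] at htaylor
  rw [← mul_assoc ε, ← sq] at htaylor
  rwa [mul_comm (M (X i))] at htaylor

end LocalAlternatives

section LocalAsymptoticNormality

variable {𝒳 : Type*} [MeasurableSpace 𝒳] {μ : Measure 𝒳} {p : ℕ} {f : Param p → 𝒳 → ℝ}
  {Θ ω : Set (Param p)} {θ₀ d : Param p} {β : ℝ}

theorem norm_fderiv_fderiv_fderiv_objTerm_zero (x : 𝒳) (θ : Param p) :
    ‖fderiv ℝ (fderiv ℝ (fderiv ℝ fun t => objTerm μ f 0 t x)) θ‖ =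
      ‖fderiv ℝ (fderiv ℝ (fderiv ℝ fun t => Real.log (f t x))) θ‖ := by
  simp only [objTerm_zero, zero_sub, one_mul]
  have h1 : fderiv ℝ (fun t => -Real.log (f t x)) = -fderiv ℝ fun t => Real.log (f t x) := by
    ext1 t
    exact fderiv_fun_neg
  have h2 : fderiv ℝ (-fderiv ℝ fun t => Real.log (f t x)) =
      -fderiv ℝ (fderiv ℝ fun t => Real.log (f t x)) := by
    ext1 t
    exact fderiv_neg
  rw [h1, h2, fderiv_neg, norm_neg]

namespace IsRegularModel

variable (h : IsRegularModel μ f Θ ω θ₀ β) [IsProbabilityMeasure (law μ f θ₀)]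
include h

theorem ae_eventually_abs_logRatio_sub_le (d : Param p) {M : 𝒳 → ℝ}
    (hM : ∀ᵐ x ∂μ, ∀ θ ∈ ω,
      ‖fderiv ℝ (fderiv ℝ (fderiv ℝ fun t => Real.log (f t x))) θ‖ ≤ M x) :
    ∀ᵐ s ∂(seqLaw (law μ f θ₀)), ∀ᶠ n : ℕ in atTop,
      |logRatio f θ₀ (localAlt θ₀ d n) (firstObs n s) - normSum (obsVec μ f β θ₀ d) n s none -
        1 / 2 * ((n : ℝ)⁻¹ * ∑ i ∈ Finset.range n,
          fderiv ℝ (fderiv ℝ fun t => Real.log (f t (s i))) θ₀ d d)| ≤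
      (√(n : ℝ))⁻¹ * ‖d‖ ^ 3 * ((n : ℝ)⁻¹ * ∑ i ∈ Finset.range n, M (s i)) := by
  obtain ⟨ρ, hρ, hρω⟩ := Metric.isOpen_iff.1 h.isOpen θ₀ h.mem
  filter_upwards [ae_obs (ae_law_of_ae h.ae_smoothPosOrZeroOn), ae_obs (ae_law_of_ae hM)]
    with s hs hMs
  filter_upwards [(tendsto_localAlt θ₀ d).eventually (Metric.ball_mem_nhds θ₀ hρ)] with n hn
  rw [localAlt_eq_add_inv_sqrt_smul] at hn ⊢
  have hbound := abs_logRatio_sub_taylor_le Metric.isOpen_ball (convex_ball θ₀ ρ)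
    (X := firstObs n s) (fun i θ hθ => (hs i).thriceDifferentiableOn_log h.isOpen θ (hρω hθ))
    (fun i θ hθ => hMs i θ (hρω hθ)) (Metric.mem_ball_self hρ) hn
  have hsq : (√(n : ℝ))⁻¹ ^ 2 = (n : ℝ)⁻¹ := by rw [inv_pow, Real.sq_sqrt n.cast_nonneg]
  rw [abs_of_nonneg (inv_nonneg.2 (Real.sqrt_nonneg (n : ℝ))), pow_succ _ 2, hsq,
    sum_firstObs n s M, sum_firstObs n s fun x => fderiv ℝ (fun t => Real.log (f t x)) θ₀ d,
    sum_firstObs n s fun x => fderiv ℝ (fderiv ℝ fun t => Real.log (f t x)) θ₀ d d] at hbound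
  simp only [normSum, obsVec_none_apply]
  exact hbound.trans_eq (by ring)

theorem ae_tendsto_logRatio_sub (d : Param p) :
    ∀ᵐ s ∂(seqLaw (law μ f θ₀)), Tendsto (fun n =>
      logRatio f θ₀ (localAlt θ₀ d n) (firstObs n s) - (normSum (obsVec μ f β θ₀ d) n s none -
        momentMatrix (law μ f θ₀) (obsVec μ f β θ₀ d) none none / 2)) atTop (𝓝 0) := by
  obtain ⟨M, m, hM, hm⟩ := h.lehmann.third_deriv.exists_norm_le
  simp only [norm_fderiv_fderiv_fderiv_objTerm_zero] at hM
  filter_upwards [h.ae_eventually_abs_logRatio_sub_le d hM, ae_tendsto_sampleMean (hm θ₀ rfl).1,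
    ae_tendsto_sampleMean (h.lehmann.integrable_fderiv_fderiv_log d d)] with s hs hmean hinfo
  rw [h.lehmann.integral_fderiv_fderiv_log] at hinfo
  have hbound : Tendsto (fun n : ℕ => (√(n : ℝ))⁻¹ * ‖d‖ ^ 3 *
      ((n : ℝ)⁻¹ * ∑ i ∈ Finset.range n, M (s i))) atTop (𝓝 0) := by
    simpa using (tendsto_inv_sqrt_natCast.mul_const (‖d‖ ^ 3)).mul hmean
  have hlim := (squeeze_zero_norm' (E := ℝ) hs hbound).add ((hinfo.const_mul (1 / 2)).add_const
    (momentMatrix (law μ f θ₀) (obsVec μ f β θ₀ d) none none / 2))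
  have hzero : 0 + (1 / 2 * -momentMatrix (law μ f θ₀) (obsVec μ f β θ₀ d) none none +
      momentMatrix (law μ f θ₀) (obsVec μ f β θ₀ d) none none / 2) = 0 := by ring
  exact (hzero ▸ hlim).congr fun n => by ring

theorem tendstoInMeasure_logRatio_sub (d : Param p) :
    TendstoInMeasure (seqLaw (law μ f θ₀)) (fun n s =>
      logRatio f θ₀ (localAlt θ₀ d n) (firstObs n s) - (normSum (obsVec μ f β θ₀ d) n s none -
        momentMatrix (law μ f θ₀) (obsVec μ f β θ₀ d) none none / 2)) atTop 0 := by
  refine tendstoInMeasure_of_tendsto_ae (fun n => ?_) (h.ae_tendsto_logRatio_sub d)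
  have hratio := (measurable_logRatio h.isModel θ₀ (localAlt θ₀ d n)).comp (measurable_firstObs n)
  have hsum := aemeasurable_normSum
    (fun o => (h.memLp_obsVec d o).aestronglyMeasurable.aemeasurable) n
  exact (hratio.aemeasurable.sub (((WithLp.measurable_ofLp 2 _).comp_aemeasurable hsum |>.eval
    none).sub_const _)).aestronglyMeasurable

theorem convergesInLaw_localAlt {T : ∀ n, (Fin n → 𝒳) → ℝ} (hT : ∀ n, Measurable (T n))
    {q : EuclideanSpace ℝ (Option (Fin p)) → ℝ} (hq : Continuous q)
    (hTq : TendstoInMeasure (seqLaw (law μ f θ₀))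
      (fun n s => T n (firstObs n s) - q (normSum (obsVec μ f β θ₀ d) n s)) atTop 0) :
    ConvergesInLaw (fun n => sampleLaw μ f n (localAlt θ₀ d n)) T
      ((multivariateGaussian 0 (momentMatrix (law μ f θ₀) (obsVec μ f β θ₀ d))).map fun z =>
        q (z + WithLp.toLp 2 ((momentMatrix (law μ f θ₀) (obsVec μ f β θ₀ d)).col none))) := by
  refine ⟨fun n => (hT n).aemeasurable, fun φ => ?_⟩
  have hθ₀ := h.subset h.mem
  have hmem : ∀ᶠ n in atTop, localAlt θ₀ d n ∈ Θ :=
    (tendsto_localAlt θ₀ d).eventually (h.isModel.isOpen.mem_nhds hθ₀)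
  have hlim := tendsto_integral_mul_exp_of_multivariateGaussian
    (posSemidef_momentMatrix (h.memLp_obsVec d)) none
    (tendstoInDistribution_normSum (h.memLp_obsVec d) (h.integral_obsVec d)) hq
    (fun n => ((hT n).comp (measurable_firstObs n)).aemeasurable)
    (fun n => ((measurable_logRatio h.isModel θ₀ (localAlt θ₀ d n)).comp
      (measurable_firstObs n)).aemeasurable)
    hTq (h.tendstoInMeasure_logRatio_sub d)
    (hmem.mono fun n hn => integral_exp_logRatio h.isModel hθ₀ hn n) φ
  rw [integral_map (by fun_prop) (by fun_prop)]
  refine hlim.congr' (hmem.mono fun n hn => ?_)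
  exact (integral_sampleLaw_eq_integral_mul_exp h.isModel hθ₀ hn
    (φ.continuous.measurable.comp (hT n))).symm

end IsRegularModel

end LocalAsymptoticNormality

section Statistic

/-- The quadratic form `(B y)ᵀ A (B y)` in the coordinates `y j = z (some j)`. The test statistic is
asymptotically equal to it at the normalized sum `z` of `obsVec`. -/
def limitForm {p : ℕ} (A B : Matrix (Fin p) (Fin p) ℝ)
    (z : EuclideanSpace ℝ (Option (Fin p))) : ℝ :=
  (B *ᵥ fun j => z (some j)) ⬝ᵥ A *ᵥ B *ᵥ fun j => z (some j)

theorem continuous_limitForm {p : ℕ} (A B : Matrix (Fin p) (Fin p) ℝ) :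
    Continuous (limitForm A B) := by
  unfold limitForm
  fun_prop

variable {𝒳 : Type*} [MeasurableSpace 𝒳] {μ : Measure 𝒳} {p r : ℕ} {f : Param p → 𝒳 → ℝ}
  {Θ ω : Set (Param p)} {θ₀ : Param p} {β γ : ℝ} {est estR : ∀ n : ℕ, (Fin n → 𝒳) → Param p}

theorem measurable_testStat [SFinite μ] (hmodel : IsModel μ f Θ) (hest : ∀ n, Measurable (est n))
    (hestR : ∀ n, Measurable (estR n)) (n : ℕ) : Measurable (testStat μ f γ est estR n) := by
  have hf : Measurable fun z : (Fin n → 𝒳) × 𝒳 => f (est n z.1) z.2 :=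
    hmodel.measurable.comp (((hest n).comp measurable_fst).prodMk measurable_snd)
  have hfR : Measurable fun z : (Fin n → 𝒳) × 𝒳 => f (estR n z.1) z.2 :=
    hmodel.measurable.comp (((hestR n).comp measurable_fst).prodMk measurable_snd)
  refine Measurable.const_mul ?_ _
  unfold divergence
  split_ifs
  all_goals refine (StronglyMeasurable.integral_prod_right ?_).measurable
  · exact (hf.mul (hf.div hfR).log).stronglyMeasurable
  · exact (((hfR.pow_const _).sub (((hfR.pow_const _).mul hf).const_mul _)).add
      ((hf.pow_const _).const_mul _)).stronglyMeasurable

theorem sq_norm_estFun_le_sq_norm_normSum (d : Param p) (n : ℕ) (s : ℕ → 𝒳) :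
    n * ‖estFun μ f β (firstObs n s) θ₀‖ ^ 2 ≤ ‖normSum (obsVec μ f β θ₀ d) n s‖ ^ 2 := by
  have hle : ‖√(n : ℝ) • estFun μ f β (firstObs n s) θ₀‖ ≤ ‖normSum (obsVec μ f β θ₀ d) n s‖ := by
    rw [← normSum_obsVec_some d]
    exact (pi_norm_le_iff_of_nonneg (norm_nonneg _)).2 fun j => PiLp.norm_apply_le _ (some j)
  calc n * ‖estFun μ f β (firstObs n s) θ₀‖ ^ 2
      = ‖√(n : ℝ) • estFun μ f β (firstObs n s) θ₀‖ ^ 2 := by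
        rw [norm_smul, mul_pow, Real.norm_eq_abs, sq_abs, Real.sq_sqrt n.cast_nonneg]
    _ ≤ ‖normSum (obsVec μ f β θ₀ d) n s‖ ^ 2 := by gcongr

theorem testStat_sub_quadraticForm (g : Param p → EuclideanSpace ℝ (Fin r)) (d : Param p) (n : ℕ)
    (s : ℕ → 𝒳) :
    testStat μ f γ est estR n (firstObs n s) -
        limitForm (matA μ f γ θ₀) (matB μ f g β θ₀) (normSum (obsVec μ f β θ₀ d) n s) =
      n * (2 * divergence μ γ (f (est n (firstObs n s))) (f (estR n (firstObs n s))) -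
        (matB μ f g β θ₀ *ᵥ estFun μ f β (firstObs n s) θ₀) ⬝ᵥ
          matA μ f γ θ₀ *ᵥ matB μ f g β θ₀ *ᵥ estFun μ f β (firstObs n s) θ₀) := by
  rw [limitForm, normSum_obsVec_some, Matrix.mulVec_smul, Matrix.mulVec_smul, smul_dotProduct,
    dotProduct_smul, smul_smul, Real.mul_self_sqrt n.cast_nonneg, testStat, smul_eq_mul]
  ring

theorem IsRegularModel.tendstoInMeasure_testStat_sub (h : IsRegularModel μ f Θ ω θ₀ β)
    [IsProbabilityMeasure (law μ f θ₀)] (hγ : 0 ≤ γ) (hB : BasuConditions μ f ω ω θ₀ γ)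
    {g : Param p → EuclideanSpace ℝ (Fin r)} (hg : ContDiffAt ℝ 1 g θ₀) (hg0 : g θ₀ = 0)
    (hrank : (matG g θ₀).rank = r)
    (hest : IsConsistentSolution μ f θ₀ (fun _ X θ => IsMDPDE μ f Θ β X θ) est)
    (hestR : IsConsistentSolution μ f θ₀ (fun _ X θ => IsRMDPDE μ f Θ g β X θ) estR)
    (d : Param p) :
    TendstoInMeasure (seqLaw (law μ f θ₀)) (fun n s => testStat μ f γ est estR n (firstObs n s) -
      limitForm (matA μ f γ θ₀) (matB μ f g β θ₀) (normSum (obsVec μ f β θ₀ d) n s))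
      atTop 0 := by
  refine tendstoInMeasure_zero_of_isLittleO_whp
    (W := fun n s => ‖normSum (obsVec μ f β θ₀ d) n s‖ ^ 2) (fun n s => by positivity)
    (integrable_norm_normSum_sq (h.memLp_obsVec d))
    (integral_norm_normSum_sq_le (h.memLp_obsVec d) (h.integral_obsVec d)) ?_
  have hdiv := h.isRegularSample_whp.isLittleO_divergence_sub_quadraticForm h.isOpen h.mem
    h.basu.diff_self h.isModel h.subset
    h.ae_smoothPosOrZeroOn h.nonneg (h.basu.J_posDef θ₀ rfl) hrank hg hg0 hγ hB
    hest.tendsto_whp hestR.tendsto_whp hest.eventually_whp hestR.eventually_whp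
  refine (((Asymptotics.isBigO_refl (fun a => (a.1 : ℝ)) _).mul_isLittleO hdiv).trans_isBigO
    (.of_norm_le fun a => ?_)).congr_left
      fun a => (testStat_sub_quadraticForm g d a.1 a.2).symm
  rw [Real.norm_of_nonneg (by positivity)]
  exact sq_norm_estFun_le_sq_norm_normSum d a.1 a.2

end Statistic

section LimitLaw

variable {𝒳 : Type*} [MeasurableSpace 𝒳] {μ : Measure 𝒳} {p r : ℕ} {f : Param p → 𝒳 → ℝ}
  {Θ ω : Set (Param p)} {θ₀ d : Param p} {β : ℝ}

theorem isSymm_matJ (μ : Measure 𝒳) (f : Param p → 𝒳 → ℝ) (β : ℝ) (θ : Param p) :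
    (matJ μ f β θ).IsSymm := by
  ext j k
  simp only [matJ, Matrix.transpose_apply, Matrix.of_apply, mul_comm (score f θ _ j)]

theorem isSymm_matB (μ : Measure 𝒳) (f : Param p → 𝒳 → ℝ) (g : Param p → EuclideanSpace ℝ (Fin r))
    (β : ℝ) (θ : Param p) : (matB μ f g β θ).IsSymm := by
  have hJ := isSymm_matJ μ f β θ
  rw [Matrix.IsSymm] at hJ ⊢
  simp only [matB, Matrix.transpose_mul, Matrix.transpose_transpose, Matrix.transpose_nonsing_inv,
    hJ, Matrix.mul_assoc]

theorem posDef_matA (hmodel : IsModel μ f Θ) (hω : IsOpen ω) (hωΘ : ω ⊆ Θ) {γ : ℝ} (hγ : 0 ≤ γ)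
    (hB : BasuConditions μ f ω ω θ₀ γ) (hθ₀ : θ₀ ∈ ω) : (matA μ f γ θ₀).PosDef := by
  rw [matA_eq_smul_matJ hmodel hω hωΘ hγ hB.smooth hθ₀]
  exact (hB.J_posDef θ₀ hθ₀).smul (by positivity)

theorem one_submatrix_mulVec {ι κ : Type*} [Fintype ι] [DecidableEq ι] (e : κ → ι) (z : ι → ℝ) :
    (1 : Matrix ι ι ℝ).submatrix e id *ᵥ z = z ∘ e := by
  ext j
  simp [Matrix.mulVec, dotProduct, Matrix.one_apply]

theorem one_submatrix_mul_mul_transpose {ι κ : Type*} [Fintype ι] [DecidableEq ι] (e : κ → ι)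
    (C : Matrix ι ι ℝ) :
    (1 : Matrix ι ι ℝ).submatrix e id * C * ((1 : Matrix ι ι ℝ).submatrix e id)ᵀ =
      C.submatrix e e := by
  ext i j
  simp [Matrix.mul_apply, Matrix.one_apply]

theorem IsRegularModel.map_limitForm_add_col (h : IsRegularModel μ f Θ ω θ₀ β)
    {A B : Matrix (Fin p) (Fin p) ℝ} (hA : A.PosDef) (hB : B.IsSymm) {k m : ℕ} {lam : Fin k → ℝ}
    (hlam : (A * (B * matK μ f β θ₀ * B)).charpoly.roots.filter (0 < ·) =
      Finset.univ.val.map lam)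
    {S : Matrix (Fin p) (Fin m) ℝ} (hS : S * Sᵀ = B * matK μ f β θ₀ * B)
    {V : Matrix (Fin m) (Fin k) ℝ} (hV : Vᵀ * V = 1)
    (hSV : (Sᵀ * A * S) * V = V * Matrix.diagonal lam) {b : Fin p → ℝ}
    (hb : b = (B * matJ μ f β θ₀) *ᵥ d.ofLp) {w : Fin k → ℝ}
    (hw : w = ((Matrix.diagonal lam)⁻¹ * Vᵀ * Sᵀ * A) *ᵥ b) :
    ((multivariateGaussian 0 (momentMatrix (law μ f θ₀) (obsVec μ f β θ₀ d))).map fun z =>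
      limitForm A B
        (z + WithLp.toLp 2 ((momentMatrix (law μ f θ₀) (obsVec μ f β θ₀ d)).col none))) =
      shiftedChiSq lam w (b ⬝ᵥ A *ᵥ b - w ⬝ᵥ Matrix.diagonal lam *ᵥ w) := by
  have hC := posSemidef_momentMatrix (h.memLp_obsVec d)
  set C := momentMatrix (law μ f θ₀) (obsVec μ f β θ₀ d)
  let M := B * (1 : Matrix (Option (Fin p)) (Option (Fin p)) ℝ).submatrix some id
  have hM (z : Option (Fin p) → ℝ) : M *ᵥ z = B *ᵥ z ∘ some := by
    rw [← Matrix.mulVec_mulVec, one_submatrix_mulVec]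
  have hcov : M * C * Mᵀ = B * matK μ f β θ₀ * B := by
    have hK : C.submatrix some some = matK μ f β θ₀ :=
      Matrix.ext (h.momentMatrix_obsVec_some_some d)
    rw [Matrix.transpose_mul, hB, ← hK, ← one_submatrix_mul_mul_transpose]
    simp only [M, Matrix.mul_assoc]
  have hshift : B *ᵥ (C.col none ∘ some) = b := by
    rw [hb, ← Matrix.mulVec_mulVec]
    exact congrArg (B *ᵥ ·) (funext (h.momentMatrix_obsVec_some_none d))
  rw [← map_quadraticForm_multivariateGaussian hA hC (hcov ▸ hlam) (hcov ▸ hS) hV hSV b hw]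
  congr 1
  ext1 z
  rw [hM, ← hshift, ← Matrix.mulVec_add]
  rfl

end LimitLaw

end DPD

end

theorem theorem9_general {𝒳 : Type*} [MeasurableSpace 𝒳] (μ : Measure 𝒳) [SFinite μ] {p r : ℕ}
    (f : DPD.Param p → 𝒳 → ℝ) (Θ : Set (DPD.Param p)) (hmodel : DPD.IsModel μ f Θ)
    (g : DPD.Param p → EuclideanSpace ℝ (Fin r)) (θ₀ : DPD.Param p) (hg : ContDiffAt ℝ 1 g θ₀)
    (hG : (DPD.matG g θ₀).rank = r) (hg0 : g θ₀ = 0)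
    (β γ : ℝ) (hβ : 0 ≤ β) (hγ : 0 ≤ γ)
    (ω : Set (DPD.Param p)) (hω : IsOpen ω) (hωΘ : ω ⊆ Θ) (hθω : θ₀ ∈ ω)
    (hL : DPD.LehmannConditions μ f ω θ₀)
    (hBβ : DPD.BasuConditions μ f ω {θ₀} θ₀ β)
    (hBγ : DPD.BasuConditions μ f ω ω θ₀ γ)
    (hK : ∀ j k, Integrable (fun x =>
      DPD.score f θ₀ x j * DPD.score f θ₀ x k * f θ₀ x ^ (1 + 2 * β)) μ)
    (est estR : ∀ n : ℕ, (Fin n → 𝒳) → DPD.Param p)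
    (hest : DPD.IsConsistentSolution μ f θ₀ (fun _ X θ => DPD.IsMDPDE μ f Θ β X θ) est)
    (hestR : DPD.IsConsistentSolution μ f θ₀ (fun _ X θ => DPD.IsRMDPDE μ f Θ g β X θ) estR)
    (d : DPD.Param p)
    (A B J K : Matrix (Fin p) (Fin p) ℝ)
    (hA : A = DPD.matA μ f γ θ₀) (hB : B = DPD.matB μ f g β θ₀)
    (hJ : J = DPD.matJ μ f β θ₀) (hKdef : K = DPD.matK μ f β θ₀)
    {k : ℕ} (lam : Fin k → ℝ)
    (hlam : (A * (B * K * B)).charpoly.roots.filter (fun t => 0 < t) =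
      (Finset.univ : Finset (Fin k)).val.map lam)
    {m : ℕ} (S : Matrix (Fin p) (Fin m) ℝ) (hS : S * Sᵀ = B * K * B)
    (V : Matrix (Fin m) (Fin k) ℝ) (hV : Vᵀ * V = 1)
    (hSV : (Sᵀ * A * S) * V = V * Matrix.diagonal lam)
    (w : Fin k → ℝ)
    (hw : w = ((Matrix.diagonal lam)⁻¹ * Vᵀ * Sᵀ * A * B * J) *ᵥ ⇑d)
    (η : ℝ)
    (hη : η = ((B * J) *ᵥ ⇑d) ⬝ᵥ (A *ᵥ ((B * J) *ᵥ ⇑d)) - w ⬝ᵥ (Matrix.diagonal lam *ᵥ w)) :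
    DPD.ConvergesInLaw (fun n => DPD.sampleLaw μ f n (DPD.localAlt θ₀ d n))
      (DPD.testStat μ f γ est estR) (DPD.shiftedChiSq lam w η) := by
  have hreg : DPD.IsRegularModel μ f Θ ω θ₀ β := ⟨hmodel, hω, hωΘ, hθω, hβ, hL, hBβ, hK⟩
  have hprob := hreg.isProbabilityMeasure_law
  subst hA hB hJ hKdef hη
  have hmeas := DPD.measurable_testStat (μ := μ) (γ := γ) hmodel hest.1 hestR.1
  have happrox := hreg.tendstoInMeasure_testStat_sub hγ hBγ hg hg0 hG hest hestR d
  have hlim := hreg.convergesInLaw_localAlt hmeas (DPD.continuous_limitForm _ _) happrox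
  have hA := DPD.posDef_matA hmodel hω hωΘ hγ hBγ hθω
  rw [Matrix.mul_assoc _ _ (DPD.matJ μ f β θ₀), ← Matrix.mulVec_mulVec] at hw
  rwa [hreg.map_limitForm_add_col hA (DPD.isSymm_matB μ f g β θ₀) hlam hS hV hSV rfl hw] at hlim

theorem theorem9 {𝒳 : Type*} [MeasurableSpace 𝒳] (μ : Measure 𝒳) [SigmaFinite μ]
    {p r : ℕ} (hrp : r < p)
    -- the parametric model
    (f : DPD.Param p → 𝒳 → ℝ) (Θ : Set (DPD.Param p)) (hmodel : DPD.IsModel μ f Θ)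
    -- the restrictions defining the null hypothesis
    (g : DPD.Param p → EuclideanSpace ℝ (Fin r)) (hg : ContDiffOn ℝ 1 g Θ)
    (hG : ∀ θ ∈ Θ, (DPD.matG g θ).rank = r)
    (θ₀ : DPD.Param p) (hθ₀ : θ₀ ∈ DPD.nullSet Θ g)
    -- tuning parameters
    (β γ : ℝ) (hβ : 0 ≤ β) (hγ : 0 ≤ γ)
    -- the Lehmann and Basu et al. conditions
    (ω : Set (DPD.Param p)) (hω : IsOpen ω) (hωΘ : ω ⊆ Θ) (hθω : θ₀ ∈ ω)
    (hL : DPD.LehmannConditions μ f ω θ₀)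
    (hBβ : DPD.BasuConditions μ f ω {θ₀} θ₀ β)
    (hBγ : DPD.BasuConditions μ f ω ω θ₀ γ)
    (hK : ∀ j k, Integrable (fun x =>
      DPD.score f θ₀ x j * DPD.score f θ₀ x k * f θ₀ x ^ (1 + 2 * β)) μ)
    -- the unrestricted and the restricted estimator
    (est estR : ∀ n : ℕ, (Fin n → 𝒳) → DPD.Param p)
    (hest : DPD.IsConsistentSolution μ f θ₀ (fun _ X θ => DPD.IsMDPDE μ f Θ β X θ) est)
    (hestR : DPD.IsConsistentSolution μ f θ₀ (fun _ X θ => DPD.IsRMDPDE μ f Θ g β X θ) estR)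
    -- the direction of the alternatives
    (d : DPD.Param p)
    -- the matrices at the null parameter
    (A B J K : Matrix (Fin p) (Fin p) ℝ)
    (hA : A = DPD.matA μ f γ θ₀) (hB : B = DPD.matB μ f g β θ₀)
    (hJ : J = DPD.matJ μ f β θ₀) (hKdef : K = DPD.matK μ f β θ₀)
    -- the positive eigenvalues of A B K B, with multiplicity
    {k : ℕ} (lam : Fin k → ℝ)
    (hlam : (A * (B * K * B)).charpoly.roots.filter (fun t => 0 < t) =
      (Finset.univ : Finset (Fin k)).val.map lam)
    -- a square root of B K B, and orthonormal eigenvectors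
    {m : ℕ} (S : Matrix (Fin p) (Fin m) ℝ) (hS : S * Sᵀ = B * K * B)
    (V : Matrix (Fin m) (Fin k) ℝ) (hV : Vᵀ * V = 1)
    (hSV : (Sᵀ * A * S) * V = V * Matrix.diagonal lam)
    (w : Fin k → ℝ)
    (hw : w = ((Matrix.diagonal lam)⁻¹ * Vᵀ * Sᵀ * A * B * J) *ᵥ ⇑d)
    (η : ℝ)
    (hη : η = ((B * J) *ᵥ ⇑d) ⬝ᵥ (A *ᵥ ((B * J) *ᵥ ⇑d)) - w ⬝ᵥ (Matrix.diagonal lam *ᵥ w)) :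
    DPD.ConvergesInLaw (fun n => DPD.sampleLaw μ f n (DPD.localAlt θ₀ d n))
      (DPD.testStat μ f γ est estR) (DPD.shiftedChiSq lam w η) :=
  theorem9_general μ f Θ hmodel g θ₀ (hg.contDiffAt (hmodel.isOpen.mem_nhds hθ₀.1)) (hG θ₀ hθ₀.1)
    hθ₀.2 β γ hβ hγ ω hω hωΘ hθω hL hBβ hBγ hK est estR hest hestR d A B J K hA hB hJ hKdef lam
    hlam S hS V hV hSV w hw η hη
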